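/- Let $\Omega\subset\mathbb R^2$ be a compact strictly convex region whose boundary is a simple closed $C^\infty$ (for instance $C^\omega$) curve $\xi$ of perimeter $1$ with everywhere positive curvature, parametrized counterclockwise by arc length $s\in\mathbb T=\mathbb R/\mathbb Z$; let $\rho(s)$ be its curvature radius. Let $\phi(s,v)=(s',v')$ be the billiard map of the annulus $\mathbb T\times[0,\pi]$: the ray leaving $\xi(s)$ at angle $v$ from the positive tangent hits the boundary again at $\xi(s')$, where it makes the angle $v'$ with the positive tangent; $\phi$ is extended continuously to $v=0$ and $v=\pi$, and lifted to $\mathbb R\times[0,\pi]$ with $s'\in(s,s+1)$ for $0<v<\pi$. Put $\kappa=\frac14\bigl(\int_0^1\rho(s)^{-2/3}\,ds\bigr)^3$. Then there are $R>0$, a $C^\infty$ diffeomorphism $\Phi=(S,V)$ from $\mathbb T\times[0,R)$ onto $\mathbb T\times[0,\pi)$ (smooth up to the boundary circle, homotopic to the identity) and real numbers $c_3,c_5,c_7,\dots$ such that the following hold. 1. $\Phi$ is exact symplectic from $\kappa\,y\,dy\wedge dx$ to $\sin v\,dv\wedge ds$: there is a $C^\infty$ function $G$ on $\mathbb T\times[0,R)$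 with $(1-\cos V)\,dS-\kappa\frac{y^2}{2}\,dx=dG$. 2. $\Phi$ is compatible with the mirror symmetry: its extension to $\mathbb T\times(-R,R)$ which commutes with $(x,y)\mapsto(x,-y)$ is $C^\infty$. 3. The map $\psi=\Phi^{-1}\circ\phi\circ\Phi$ of $\mathbb T\times[0,R)$ has, to all orders at the boundary $y=0$, the Birkhoff normal form $x^+=x+\zeta_\infty(y)$, $y^+=y$, where $\zeta_\infty(y)=y+\sum_{i\ge1}c_{2i+1}y^{2i+1}$ is an odd formal power series. That is, for every $N\ge0$ there are $C^\infty$ functions $f_N,g_N$ on $\mathbb T\times[0,R)$ such that, with $c_1=1$, $$x^+=x+\sum_{i=0}^{N}c_{2i+1}y^{2i+1}+y^{2N+3}f_N(x,y),\qquad y^+=y+y^{2N+4}g_N(x,y).$$ -/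

import Mathlib

open Set Filter Topology
open scoped ContDiff ComplexConjugate

noncomputable section

/-- A strictly convex billiard table in the plane `ℂ = ℝ²`: a compact strictly convex region whose
boundary is a simple closed `C^∞` curve `ξ` of perimeter `1`, parametrized counterclockwise by arc
length, with positive curvature. -/
structure BilliardTable where
  /-- the (closed) region -/
  region : Set ℂ
  /-- the arc length parametrization of the boundary -/
  ξ : ℝ → ℂ
  isCompact_region : IsCompact region
  strictConvex_region : StrictConvex ℝ region
  frontier_region : frontier region = range ξ
  contDiff_ξ : ContDiff ℝ ∞ ξ
  periodic_ξ : Function.Periodic ξ 1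
  simple_ξ : ∀ s t : ℝ, ξ s = ξ t → ∃ n : ℤ, t = s + n
  unit_speed : ∀ s, ‖deriv ξ s‖ = 1
  curvature_pos : ∀ s, 0 < (conj (deriv ξ s) * deriv (deriv ξ) s).im

namespace BilliardTable

variable (B : BilliardTable)

/-- The curvature of the boundary; it is the reciprocal of the curvature radius. -/
def curvature (s : ℝ) : ℝ := (conj (deriv B.ξ s) * deriv (deriv B.ξ) s).im

/-- The ray that leaves `ξ s` at the angle `v` from the positive tangent hits the boundary at `ξ t`,
where `t` is the representative of the parameter in `(s, s + 1)`. -/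
def IsNextBounce (s v t : ℝ) : Prop :=
  t ∈ Ioo s (s + 1) ∧
    ∃ l : ℝ, 0 < l ∧ B.ξ t = B.ξ s + l * (Complex.exp (v * Complex.I) * deriv B.ξ s)

theorem hasDerivAt_ξ (s : ℝ) : HasDerivAt B.ξ (deriv B.ξ s) s :=
  ((B.contDiff_ξ.differentiable (by simp)) s).hasDerivAt

theorem hasDerivAt_deriv_ξ (s : ℝ) : HasDerivAt (deriv B.ξ) (deriv (deriv B.ξ) s) s := by
  have h : ContDiff ℝ (∞ + 1) B.ξ := B.contDiff_ξ
  have h2 := (contDiff_succ_iff_deriv.1 h).2.2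
  exact ((h2.differentiable (by simp)) s).hasDerivAt

theorem hasDerivAt_height (w : ℂ) (s t : ℝ) :
    HasDerivAt (fun t => (conj w * (B.ξ t - B.ξ s)).im) (conj w * deriv B.ξ t).im t := by
  have h := (((B.hasDerivAt_ξ t).sub_const (B.ξ s)).const_mul (conj w))
  exact (Complex.imCLM.hasFDerivAt.comp_hasDerivAt t h)

theorem ξ_mem (s : ℝ) : B.ξ s ∈ B.region := by
  have h : B.ξ s ∈ frontier B.region := B.frontier_region ▸ mem_range_self s
  exact B.isCompact_region.isClosed.frontier_subset h

theorem ξ_notMem (s : ℝ) : B.ξ s ∉ interior B.region := by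
  have h : B.ξ s ∈ frontier B.region := B.frontier_region ▸ mem_range_self s
  exact h.2

theorem ξ_ne {s t : ℝ} (h : t ∈ Ioo (s - 1) (s + 1)) (hst : t ≠ s) : B.ξ s ≠ B.ξ t := by
  intro he
  obtain ⟨n, hn⟩ := B.simple_ξ s t he
  have h1 : (n : ℝ) < 1 := by linarith [h.2]
  have h2 : (-1 : ℝ) < n := by linarith [h.1]
  have h1' : n < 1 := by exact_mod_cast h1
  have h2' : -1 < n := by exact_mod_cast h2
  have : n = 0 := by omega
  exact hst (by rw [hn, this]; simp)

/-- The boundary lies strictly on the left of each of its tangents. -/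
theorem height_pos {s t : ℝ} (ht : t ∈ Ioo s (s + 1)) :
    0 < (conj (deriv B.ξ s) * (B.ξ t - B.ξ s)).im := by
  set τ := deriv B.ξ s with hτ
  obtain ⟨g, hg⟩ := geometric_hahn_banach_open_point
    B.strictConvex_region.convex.interior isOpen_interior (B.ξ_notMem s)
  have key : ∀ r ∈ Ioo (s - 1) (s + 1), r ≠ s → g (B.ξ r) < g (B.ξ s) := by
    intro r hr hrs
    have hm : (1 / 2 : ℝ) • B.ξ s + (1 / 2 : ℝ) • B.ξ r ∈ interior B.region :=
      B.strictConvex_region (B.ξ_mem s) (B.ξ_mem r) (B.ξ_ne hr hrs) (by norm_num) (by norm_num)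
        (by norm_num)
    have := hg _ hm
    simp only [map_add, map_smul, smul_eq_mul] at this
    linarith
  have hnhds : Ioo (s - 1) (s + 1) ∈ 𝓝 s := Ioo_mem_nhds (by linarith) (by linarith)
  have hgτ : g τ = 0 := by
    have hmax : IsLocalMax (fun r => g (B.ξ r)) s := by
      filter_upwards [hnhds] with r hr
      by_cases h : r = s
      · rw [h]
      · exact (key r hr h).le
    exact hmax.hasDerivAt_eq_zero (g.hasFDerivAt.comp_hasDerivAt s (B.hasDerivAt_ξ s))
  have hττ : τ * conj τ = 1 := by
    rw [Complex.mul_conj, Complex.normSq_eq_norm_sq, B.unit_speed s]; simp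
  have hdec : ∀ z : ℂ, g z = (conj τ * z).im * g (Complex.I * τ) := by
    intro z
    have hz : z = (conj τ * z).re • τ + (conj τ * z).im • (Complex.I * τ) := by
      have h1 : z = τ * (conj τ * z) := by rw [← mul_assoc, hττ, one_mul]
      conv_lhs => rw [h1, ← Complex.re_add_im (conj τ * z)]
      simp only [Complex.real_smul]
      ring
    conv_lhs => rw [hz]
    rw [map_add, map_smul, map_smul, hgτ, smul_zero, zero_add, smul_eq_mul]
  have key2 : ∀ r ∈ Ioo (s - 1) (s + 1), r ≠ s →
      (conj τ * (B.ξ r - B.ξ s)).im * g (Complex.I * τ) < 0 := by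
    intro r hr hrs
    rw [← hdec, map_sub]
    linarith [key r hr hrs]
  have hmin : IsLocalMin (fun r => (conj τ * (B.ξ r - B.ξ s)).im) s := by
    have hd : deriv (fun r => (conj τ * (B.ξ r - B.ξ s)).im)
        = fun r => (conj τ * deriv B.ξ r).im :=
      funext fun r => (B.hasDerivAt_height τ s r).deriv
    apply isLocalMin_of_deriv_deriv_pos
    · rw [hd]
      have h2 := Complex.imCLM.hasFDerivAt.comp_hasDerivAt s
        ((B.hasDerivAt_deriv_ξ s).const_mul (conj τ))
      have h3 : deriv (fun r => (conj τ * deriv B.ξ r).im) s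
          = (conj τ * deriv (deriv B.ξ) s).im := h2.deriv
      rw [h3]
      exact B.curvature_pos s
    · rw [hd]
      simp only [← hτ]
      rw [mul_comm, hττ]; simp
    · exact (B.hasDerivAt_height τ s s).continuousAt
  have hneg : g (Complex.I * τ) < 0 := by
    obtain ⟨ε, hε, hball⟩ := Metric.eventually_nhds_iff.1 (hmin.and hnhds)
    have hr := @hball (s + ε / 2) (by
      rw [Real.dist_eq, add_sub_cancel_left, abs_of_pos (half_pos hε)]; linarith)
    have h1 := key2 _ hr.2 (by linarith)
    have h2 := hr.1
    simp only [sub_self, mul_zero, Complex.zero_im] at h2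
    by_contra hcon
    push Not at hcon
    exact absurd (mul_nonneg h2 hcon) (not_le.2 h1)
  have := key2 t ⟨by linarith [ht.1], ht.2⟩ (ne_of_gt ht.1)
  nlinarith

theorem norm_direction (s v : ℝ) :
    (Complex.exp (v * Complex.I) * deriv B.ξ s) *
      conj (Complex.exp (v * Complex.I) * deriv B.ξ s) = 1 := by
  rw [Complex.mul_conj, Complex.normSq_eq_norm_sq, norm_mul, B.unit_speed s,
    Complex.norm_exp_ofReal_mul_I]
  simp

theorem exists_isNextBounce (s : ℝ) {v : ℝ} (hv : v ∈ Ioo 0 Real.pi) :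
    ∃ t, B.IsNextBounce s v t := by
  have hsin : 0 < Real.sin v := Real.sin_pos_of_pos_of_lt_pi hv.1 hv.2
  have hττ : deriv B.ξ s * conj (deriv B.ξ s) = 1 := by
    rw [Complex.mul_conj, Complex.normSq_eq_norm_sq, B.unit_speed s]; simp
  set w := Complex.exp (v * Complex.I) * deriv B.ξ s with hw
  have hww : w * conj w = 1 := B.norm_direction s v
  let e : ℝ → ℝ := fun t => (conj w * (B.ξ t - B.ξ s)).im
  have hwτ : (conj w * deriv B.ξ s).im = -Real.sin v := by
    have h : conj w * deriv B.ξ s = conj (Complex.exp (v * Complex.I)) := by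
      rw [hw, map_mul, mul_assoc, mul_comm (conj (deriv B.ξ s)), hττ, mul_one]
    rw [h, Complex.conj_im, Complex.exp_ofReal_mul_I_im]
  have hper : deriv B.ξ (s + 1) = deriv B.ξ s := by
    have h : (fun r => B.ξ (r + 1)) = B.ξ := funext B.periodic_ξ
    rw [← deriv_comp_add_const, h]
  have he0 : e s = 0 := by simp [e]
  have he1 : e (s + 1) = 0 := by simp [e, B.periodic_ξ s]
  have hd0 : HasDerivAt e (-Real.sin v) s := by
    rw [← hwτ]; exact B.hasDerivAt_height w s s
  have hd1 : HasDerivAt e (-Real.sin v) (s + 1) := by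
    rw [← hwτ, ← hper]; exact B.hasDerivAt_height w s (s + 1)
  have hcont : Continuous e :=
    continuous_iff_continuousAt.2 fun r => (B.hasDerivAt_height w s r).continuousAt
  obtain ⟨ε₀, hε₀, hb₀⟩ := Metric.eventually_nhds_iff.1
    (eventually_nhdsWithin_iff.1
      ((hasDerivAt_iff_tendsto_slope.1 hd0).eventually_lt_const (by linarith : -Real.sin v < 0)))
  obtain ⟨ε₁, hε₁, hb₁⟩ := Metric.eventually_nhds_iff.1
    (eventually_nhdsWithin_iff.1
      ((hasDerivAt_iff_tendsto_slope.1 hd1).eventually_lt_const (by linarith : -Real.sin v < 0)))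
  obtain ⟨δ, hδ, hδ0, hδ1, hδ2⟩ : ∃ δ : ℝ, 0 < δ ∧ δ < ε₀ ∧ δ < ε₁ ∧ δ < 1 / 2 :=
    ⟨min (min ε₀ ε₁) (1 / 2) / 2, by positivity, by
      have : min (min ε₀ ε₁) (1 / 2) ≤ ε₀ := (min_le_left _ _).trans (min_le_left _ _)
      have : 0 < min (min ε₀ ε₁) (1 / 2) := by positivity
      linarith, by
      have : min (min ε₀ ε₁) (1 / 2) ≤ ε₁ := (min_le_left _ _).trans (min_le_right _ _)
      have : 0 < min (min ε₀ ε₁) (1 / 2) := by positivity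
      linarith, by
      have : min (min ε₀ ε₁) (1 / 2) ≤ 1 / 2 := min_le_right _ _
      linarith⟩
  have hA : e (s + δ) < 0 := by
    have h := @hb₀ (s + δ) (by rw [Real.dist_eq]; simp [abs_of_pos hδ, hδ0])
      (by simp [hδ.ne'])
    rw [slope_def_field, he0] at h
    have h' : e (s + δ) / δ < 0 := by simpa using h
    by_contra hc
    push Not at hc
    exact absurd (div_nonneg hc hδ.le) (not_le.2 h')
  have hB : 0 < e (s + 1 - δ) := by
    have h := @hb₁ (s + 1 - δ) (by rw [Real.dist_eq]; simp [abs_of_pos hδ, hδ1])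
      (by simp [hδ.ne'])
    rw [slope_def_field, he1] at h
    have h' : e (s + 1 - δ) / (-δ) < 0 := by simpa using h
    by_contra hc
    push Not at hc
    have h2 : 0 ≤ e (s + 1 - δ) / (-δ) := div_nonneg_of_nonpos hc (by linarith)
    exact absurd h2 (not_le.2 h')
  obtain ⟨t, ht, hte⟩ := intermediate_value_Icc (show s + δ ≤ s + 1 - δ by linarith)
    hcont.continuousOn ⟨hA.le, hB.le⟩
  have htI : t ∈ Ioo s (s + 1) := ⟨by linarith [ht.1], by linarith [ht.2]⟩
  have hchord : B.ξ t - B.ξ s = ((conj w * (B.ξ t - B.ξ s)).re : ℂ) * w := by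
    have h1 : B.ξ t - B.ξ s = (conj w * (B.ξ t - B.ξ s)) * w := by
      rw [mul_comm, ← mul_assoc, hww, one_mul]
    have h2 : conj w * (B.ξ t - B.ξ s) = ((conj w * (B.ξ t - B.ξ s)).re : ℂ) := by
      apply Complex.ext
      · simp
      · rw [Complex.ofReal_im]; exact hte
    rw [← h2]
    exact h1
  refine ⟨t, htI, (conj w * (B.ξ t - B.ξ s)).re, ?_, ?_⟩
  · have hp := B.height_pos htI
    set l := (conj w * (B.ξ t - B.ξ s)).re
    rw [hchord] at hp
    have h3 : conj (deriv B.ξ s) * ((l : ℂ) * w) = l * Complex.exp (v * Complex.I) := by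
      rw [hw]
      linear_combination (l : ℂ) * Complex.exp (v * Complex.I) * hττ
    rw [h3, Complex.im_ofReal_mul, Complex.exp_ofReal_mul_I_im] at hp
    exact (pos_iff_pos_of_mul_pos hp).2 hsin
  · rw [← hchord]; ring

theorem isNextBounce_unique {s v t₁ t₂ : ℝ} (h₁ : B.IsNextBounce s v t₁)
    (h₂ : B.IsNextBounce s v t₂) : t₁ = t₂ := by
  have main : ∀ {t r : ℝ}, t ∈ Ioo s (s + 1) → r ∈ Ioo s (s + 1) → ∀ l m : ℝ, 0 < l → l < m →
      B.ξ t = B.ξ s + l * (Complex.exp (v * Complex.I) * deriv B.ξ s) →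
      B.ξ r = B.ξ s + m * (Complex.exp (v * Complex.I) * deriv B.ξ s) → False := by
    intro t r _ hr l m hl hlm e₁ e₂
    have hm : 0 < m := hl.trans hlm
    have hint := B.strictConvex_region (B.ξ_mem s) (B.ξ_mem r)
      (B.ξ_ne ⟨by linarith [hr.1], hr.2⟩ (ne_of_gt hr.1))
      (show 0 < 1 - l / m by rw [sub_pos, div_lt_one hm]; exact hlm)
      (div_pos hl hm) (by ring)
    refine B.ξ_notMem t ?_
    convert hint using 1
    rw [e₁, e₂]
    simp only [Complex.real_smul]
    push_cast
    have : (m : ℂ) ≠ 0 := by exact_mod_cast hm.ne'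
    field_simp
    ring
  obtain ⟨ht₁, l₁, hl₁, e₁⟩ := h₁
  obtain ⟨ht₂, l₂, hl₂, e₂⟩ := h₂
  rcases lt_trichotomy l₁ l₂ with h | h | h
  · exact (main ht₁ ht₂ l₁ l₂ hl₁ h e₁ e₂).elim
  · by_contra hne
    exact B.ξ_ne ⟨by linarith [ht₁.2, ht₂.1], by linarith [ht₁.1, ht₂.2]⟩ (Ne.symm hne)
      (by rw [e₁, e₂, h])
  · exact (main ht₂ ht₁ l₂ l₁ hl₂ h e₂ e₁).elim

open Classical in
/-- The arc length parameter of the next bounce, in the universal cover. -/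
def nextBounce (s v : ℝ) : ℝ :=
  if h : ∃ t, B.IsNextBounce s v t then h.choose else s

theorem nextBounce_spec (s : ℝ) {v : ℝ} (hv : v ∈ Ioo 0 Real.pi) :
    B.IsNextBounce s v (B.nextBounce s v) := by
  have h := B.exists_isNextBounce s hv
  rw [nextBounce, dif_pos h]
  exact h.choose_spec

/-- The billiard map `(s, v) ↦ (s', v')` on the universal cover `ℝ × [0, π]` of the closed annulus:
the ray leaving `ξ s` at angle `v` from the positive tangent hits the boundary at `ξ s'`, and is
reflected at the angle `v'` that the ray makes with the positive tangent at `ξ s'`. On the two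
boundary circles it is the continuous extension: `(s, 0) ↦ (s, 0)` and `(s, π) ↦ (s + 1, π)`. -/
def billiardMap (p : ℝ × ℝ) : ℝ × ℝ :=
  if p.2 ≤ 0 then p
  else if Real.pi ≤ p.2 then (p.1 + 1, p.2)
  else (B.nextBounce p.1 p.2,
    InnerProductGeometry.angle (B.ξ (B.nextBounce p.1 p.2) - B.ξ p.1)
      (deriv B.ξ (B.nextBounce p.1 p.2)))

/-- The constant `(∫₀¹ ρ(s)^(-2/3) ds)³ / 4`, where `ρ = 1 / curvature` is the curvature radius. -/
def lazutkinConst : ℝ := (∫ s in (0 : ℝ)..1, (B.curvature s) ^ (2 / 3 : ℝ)) ^ 3 / 4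

end BilliardTable

/-- The universal cover `ℝ × [0, R)` of the annulus `𝕋 × [0, R)`, where `𝕋 = ℝ / ℤ`. -/
def annulus (R : ℝ) : Set (ℝ × ℝ) := {p | 0 ≤ p.2 ∧ p.2 < R}

/-- A `C^∞` diffeomorphism from `𝕋 × [0, R)` onto `𝕋 × [0, R')`, smooth up to the boundary circle
and homotopic to the identity, given with its inverse through lifts to the universal covers. -/
structure AnnulusDiffeo (R R' : ℝ) where
  toFun : ℝ × ℝ → ℝ × ℝ
  invFun : ℝ × ℝ → ℝ × ℝ
  mapsTo_toFun : MapsTo toFun (annulus R) (annulus R')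
  mapsTo_invFun : MapsTo invFun (annulus R') (annulus R)
  left_inv : LeftInvOn invFun toFun (annulus R)
  right_inv : RightInvOn invFun toFun (annulus R')
  contDiffOn_toFun : ContDiffOn ℝ ∞ toFun (annulus R)
  contDiffOn_invFun : ContDiffOn ℝ ∞ invFun (annulus R')
  toFun_add_one : ∀ p ∈ annulus R, toFun (p.1 + 1, p.2) = ((toFun p).1 + 1, (toFun p).2)

/-- `F = (S, V)` is exact symplectic from `(𝕋 × [0, R), k y dy ∧ dx)` to the phase space of the
billiard with the form `sin v dv ∧ ds`: for the primitives `(1 - cos v) ds` and `k y² / 2 dx` one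
has `(1 - cos V) dS - k y² / 2 dx = dG` with a function `G` on the annulus. -/
def IsExactSymplectic (k R : ℝ) (F : ℝ × ℝ → ℝ × ℝ) : Prop :=
  ∃ G : ℝ × ℝ → ℝ, ContDiffOn ℝ ∞ G (annulus R) ∧
    (∀ p ∈ annulus R, G (p.1 + 1, p.2) = G p) ∧
    ∀ p ∈ annulus R, ∀ w : ℝ × ℝ,
      (1 - Real.cos (F p).2) * (fderivWithin ℝ F (annulus R) p w).1 - k * (p.2 ^ 2 / 2) * w.1
        = fderivWithin ℝ G (annulus R) p w

/-- The extension of a map of the half plane `y ≥ 0` to the plane that commutes with the mirror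
reflection `(x, y) ↦ (x, -y)`. -/
def mirrorExtend (F : ℝ × ℝ → ℝ × ℝ) (p : ℝ × ℝ) : ℝ × ℝ :=
  if 0 ≤ p.2 then F p else ((F (p.1, -p.2)).1, -(F (p.1, -p.2)).2)

/-- To all orders at the boundary `y = 0`, the map `ψ` of `𝕋 × [0, R)` has the Birkhoff normal form
`x⁺ = x + ζ(y)`, `y⁺ = y` with the odd formal series `ζ(y) = ∑ i, c (2 i + 1) y ^ (2 i + 1)`. -/
def IsFormalBirkhoffNormalForm (R : ℝ) (ψ : ℝ × ℝ → ℝ × ℝ) (c : ℕ → ℝ) : Prop :=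
  ∀ N : ℕ, ∃ f g : ℝ × ℝ → ℝ, ContDiffOn ℝ ∞ f (annulus R) ∧ ContDiffOn ℝ ∞ g (annulus R) ∧
    (∀ p ∈ annulus R, f (p.1 + 1, p.2) = f p ∧ g (p.1 + 1, p.2) = g p) ∧
    ∀ p ∈ annulus R, ψ p =
      (p.1 + ∑ i ∈ Finset.range (N + 1), c (2 * i + 1) * p.2 ^ (2 * i + 1)
          + p.2 ^ (2 * N + 3) * f p,
        p.2 + p.2 ^ (2 * N + 4) * g p)

end

/-! Near the boundary the billiard map is an exact, reversible twist map that fixes the boundary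
circle. Such a map has a formal Birkhoff normal form there: at every order reversibility and
exactness remove the obstructions, and Borel summation turns the formal change of variables into a
smooth one.

Geometry. For `|t - s| < 1` the signed angle from the tangent at `s` to the chord towards `t` is
smooth, also across `t = s`, and by strict convexity it increases with `t` (`deriv_chordAngle_pos`).
Its inverse extends the bounce smoothly to negative angles, where chords are retraced backwards. In
Lazutkin's coordinates (`x` the normalized affine length, `r` equal to `tan (v / 2)` over the cube
root of the curvature) this gives a map `(f, g)` of the whole cylinder. It has constant twist `4 /
L`, with `L` the affine length, its inverse is its conjugate by `r ↦ -r`, and by the first variation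
of the chord length it is exact (`reversibleTwist`).

Invariant curves. A family `r = Y (x, u)`, odd in `u`, is corrected order by order, starting from `Y
= u`. Suppose the defect `g (x, Y) - Y (f (x, Y), u)` is divisible by `u ^ (2 n + 3)`. Reversibility
makes that coefficient vanish (`divPow_defect_succ_of_odd`), and exactness, in the form of zero net
flux, makes the next coefficient `e` have mean zero (`integral_leading_defect`). So `τ q' = e` has a
periodic solution, and adding `q u ^ (2 n + 3)` gains two orders. A Borel sum of the corrections
with small derivative foliates the plane by curves whose defect is flat (`exists_flat_curveFamily`).

Normal form. Let `M u` be the area under the curve of parameter `u`. The action `y` is defined by `κ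
y ^ 2 / 2 = M u`, and the angle is the normalized integral of the area density along the curve;
together they are exact symplectic (`fderiv_G`). In these coordinates `y` is preserved up to flat
terms, so exactness makes the angle displacement a function of `u` alone up to flat terms
(`isFlat_shift_sub`), and reversibility makes that function odd (`exists_odd_shift`). Its expansion
in odd powers of `y` gives the coefficients `c`; the value of `κ` is the one for which the first of
them is `1`. -/

/-! ### Parameter integrals, divided differences and smooth inverses -/

/-- Integrals depending smoothly on a parameter. -/
theorem contDiff_nat_integral_unitInterval {E : Type} [NormedAddCommGroup E] [NormedSpace ℝ E]
    [ProperSpace E] (n : ℕ) : ∀ {F : Type} [NormedAddCommGroup F] [NormedSpace ℝ F]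
    [CompleteSpace F] {f : E × ℝ → F}, ContDiff ℝ ∞ f →
    ContDiff ℝ n (fun x => ∫ θ in (0 : ℝ)..1, f (x, θ)) := by
  -- The target space is quantified inside the induction, because the derivative is again such an
  -- integral, of a function with values in continuous linear maps.
  induction n with
  | zero =>
    intro F _ _ _ f hf
    have : ContDiff ℝ 0 (fun x => ∫ θ in (0 : ℝ)..1, f (x, θ)) := by
      rw [contDiff_zero]
      exact intervalIntegral.continuous_parametric_intervalIntegral_of_continuous'
        (f := fun x θ => f (x, θ)) hf.continuous 0 1
    exact_mod_cast this
  | succ n ih =>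
    intro F _ _ _ f hf
    have hf' : ContDiff ℝ ∞ (fderiv ℝ f) := hf.fderiv_right (by simp)
    have hg : ContDiff ℝ ∞
        (fun p : E × ℝ => (fderiv ℝ f p).comp (ContinuousLinearMap.inl ℝ E ℝ)) :=
      hf'.clm_comp contDiff_const
    have hgc := hg.continuous
    push_cast
    refine contDiff_succ_iff_hasFDerivAt (𝕜 := ℝ).2
      ⟨fun x => ∫ θ in (0 : ℝ)..1, (fderiv ℝ f (x, θ)).comp (ContinuousLinearMap.inl ℝ E ℝ),
        ih hg, fun x₀ => ?_⟩
    obtain ⟨C, hC⟩ := ((isCompact_closedBall x₀ 1).prod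
      (isCompact_Icc (a := (0 : ℝ)) (b := 1))).exists_bound_of_continuousOn hgc.continuousOn
    have hfc := hf.continuous
    refine intervalIntegral.hasFDerivAt_integral_of_dominated_of_fderiv_le (𝕜 := ℝ)
      (F := fun x θ => f (x, θ))
      (F' := fun x θ => (fderiv ℝ f (x, θ)).comp (ContinuousLinearMap.inl ℝ E ℝ)) (bound := fun _ => C)
      (Metric.closedBall_mem_nhds x₀ one_pos) ?_ ?_ ?_ ?_ ?_ ?_
    · exact Eventually.of_forall fun x => (hfc.comp (by fun_prop)).aestronglyMeasurable
    · exact (hfc.comp (by fun_prop)).intervalIntegrable 0 1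
    · exact (hgc.comp (by fun_prop : Continuous fun θ : ℝ => (x₀, θ))).aestronglyMeasurable
    · refine Eventually.of_forall fun θ hθ x hx => hC (x, θ) ⟨hx, ?_⟩
      rw [uIoc_of_le zero_le_one] at hθ
      exact ⟨hθ.1.le, hθ.2⟩
    · exact intervalIntegrable_const
    · refine Eventually.of_forall fun θ _ x _ => ?_
      exact ((hf.differentiable (by simp)) (x, θ)).hasFDerivAt.comp x
        (hasFDerivAt_prodMk_left x θ)

theorem contDiff_integral_unitInterval {E : Type} [NormedAddCommGroup E] [NormedSpace ℝ E]
    [ProperSpace E] {F : Type} [NormedAddCommGroup F] [NormedSpace ℝ F]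
    [CompleteSpace F] {f : E × ℝ → F} (hf : ContDiff ℝ ∞ f) :
    ContDiff ℝ ∞ (fun x => ∫ θ in (0 : ℝ)..1, f (x, θ)) :=
  contDiff_infty.2 fun n => contDiff_nat_integral_unitInterval n hf

/-- Divided differences of a smooth function are smooth. -/
theorem exists_dividedDifference {E : Type} [NormedAddCommGroup E] [NormedSpace ℝ E]
    [ProperSpace E] {F : Type} [NormedAddCommGroup F] [NormedSpace ℝ F]
    [CompleteSpace F] {G : E × ℝ → F} (hG : ContDiff ℝ ∞ G) :
    ∃ H : E × ℝ × ℝ → F, ContDiff ℝ ∞ H ∧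
      ∀ e a b, G (e, a) - G (e, b) = (a - b) • H (e, a, b) := by
  let g : E × ℝ → F := fun p => fderiv ℝ G p (0, 1)
  have hg : ContDiff ℝ ∞ g := (hG.fderiv_right (by simp)).clm_apply contDiff_const
  have hd : ∀ e a, HasDerivAt (fun a => G (e, a)) (g (e, a)) a := fun e a =>
    ((hG.differentiable (by simp)) (e, a)).hasFDerivAt.comp_hasDerivAt a
      ((hasDerivAt_const a e).prodMk (hasDerivAt_id a))
  -- Hadamard's formula: the mean of the derivative over the segment from `b` to `a` is smooth even
  -- where `a = b`.
  refine ⟨fun p => ∫ θ in (0 : ℝ)..1, g (p.1, p.2.2 + θ * (p.2.1 - p.2.2)),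
    contDiff_integral_unitInterval
      (f := fun z : (E × ℝ × ℝ) × ℝ => g (z.1.1, z.1.2.2 + z.2 * (z.1.2.1 - z.1.2.2)))
      (hg.comp (by fun_prop)), fun e a b => ?_⟩
  have hgc := hg.continuous
  have h := intervalIntegral.integral_eq_sub_of_hasDerivAt (a := 0) (b := 1)
    (f := fun θ : ℝ => G (e, b + θ * (a - b)))
    (f' := fun θ : ℝ => (a - b) • g (e, b + θ * (a - b))) (fun θ _ => by
      have h1 : HasDerivAt (fun θ : ℝ => b + θ * (a - b)) (a - b) θ := by
        simpa using ((hasDerivAt_id θ).mul_const (a - b)).const_add b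
      exact (hd e (b + θ * (a - b))).scomp θ h1)
    (Continuous.intervalIntegrable (by fun_prop) 0 1)
  rw [intervalIntegral.integral_smul] at h
  rw [h]
  simp

/-- Off the diagonal `H` is the slope, so its value on the diagonal is by continuity the limit of
slopes. -/
theorem dividedDifference_self {E : Type} {G : E × ℝ → ℝ}
    {H : E × ℝ × ℝ → ℝ} [TopologicalSpace E] (hH : Continuous H)
    (h : ∀ e a b, G (e, a) - G (e, b) = (a - b) * H (e, a, b)) {e : E} {b d : ℝ}
    (hd : HasDerivAt (fun a => G (e, a)) d b) : H (e, b, b) = d := by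
  have h1 := hasDerivAt_iff_tendsto_slope.1 hd
  have h2 : Tendsto (fun a => H (e, a, b)) (𝓝[≠] b) (𝓝 (H (e, b, b))) :=
    ((hH.comp (by fun_prop : Continuous fun a : ℝ => (e, a, b))).tendsto b).mono_left
      nhdsWithin_le_nhds
  refine tendsto_nhds_unique (h2.congr' ?_) h1
  filter_upwards [self_mem_nhdsWithin] with a ha
  have : a - b ≠ 0 := sub_ne_zero.2 ha
  rw [slope_def_field, h]
  field_simp

/-- A global inverse of a smooth injective local diffeomorphism is smooth. -/
theorem contDiffOn_of_rightInverse {E : Type} [NormedAddCommGroup E] [NormedSpace ℝ E]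
    [CompleteSpace E] {F G : E → E} {U W : Set E} (hU : IsOpen U) (hW : IsOpen W)
    (hF : ContDiffOn ℝ ∞ F U)
    (hinj : InjOn F U) (hG : MapsTo G W U) (hFG : ∀ q ∈ W, F (G q) = q)
    (hd : ∀ p ∈ U, ∃ A : E ≃L[ℝ] E, HasFDerivAt F (A : E →L[ℝ] E) p) : ContDiffOn ℝ ∞ G W := by
  intro q hq
  refine ContDiffAt.contDiffWithinAt ?_
  obtain ⟨A, hA⟩ := hd _ (hG hq)
  have hFat : ContDiffAt ℝ ∞ F (G q) := hF.contDiffAt (hU.mem_nhds (hG hq))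
  have hn : (∞ : WithTop ℕ∞) ≠ 0 := by simp
  have hs := hFat.to_localInverse hA hn
  rw [hFG q hq] at hs
  refine hs.congr_of_eventuallyEq ?_
  set Li := hFat.localInverse hA hn with hLi
  have h1 : Li q = G q := by
    have := hFat.localInverse_apply_image hA hn
    rwa [hFG q hq] at this
  have h2 : ∀ᶠ q' in 𝓝 q, F (Li q') = q' := by
    have := (hFat.hasStrictFDerivAt' hA hn).eventually_right_inverse
    rwa [hFG q hq] at this
  have h3 : ∀ᶠ q' in 𝓝 q, Li q' ∈ U :=
    hs.continuousAt.eventually (by rw [h1]; exact hU.mem_nhds (hG hq))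
  -- The local inverse supplied by the inverse function theorem is a right inverse with values in
  -- `U`, so injectivity identifies it with `G` near `q`. Continuity of `G` is not needed.
  filter_upwards [h2, h3, hW.mem_nhds hq] with q' h2 h3 hq'
  exact hinj (hG hq') h3 ((hFG q' hq').trans h2.symm)

/-- The map `(s, t) ↦ (s, g (s, t))` has a triangular derivative, invertible as soon as the
derivative in `t` is nonzero. The inverse function theorem then makes the fiberwise inverse jointly
smooth. -/
theorem contDiffOn_fiberwise_inverse {g T : ℝ × ℝ → ℝ} {U W : Set (ℝ × ℝ)} (hU : IsOpen U)
    (hW : IsOpen W)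
    (hg : ContDiffOn ℝ ∞ g U)
    (hinj : ∀ s t t', (s, t) ∈ U → (s, t') ∈ U → g (s, t) = g (s, t') → t = t')
    (hT : ∀ s v, (s, v) ∈ W → (s, T (s, v)) ∈ U ∧ g (s, T (s, v)) = v)
    (hd : ∀ s t, (s, t) ∈ U → deriv (fun t => g (s, t)) t ≠ 0) : ContDiffOn ℝ ∞ T W := by
  have key : ContDiffOn ℝ ∞ (fun p : ℝ × ℝ => (p.1, T p)) W := by
    refine contDiffOn_of_rightInverse (F := fun p : ℝ × ℝ => (p.1, g p)) hU hW
      (contDiffOn_fst.prodMk hg) ?_ (fun p hp => (hT p.1 p.2 hp).1)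
      (fun p hp => Prod.ext rfl (hT p.1 p.2 hp).2) ?_
    · rintro ⟨s, t⟩ h ⟨s', t'⟩ h' he
      simp only [Prod.mk.injEq] at he
      obtain ⟨rfl, he⟩ := he
      rw [hinj s t t' h h' he]
    · rintro ⟨s, t⟩ hp
      have hg1 : HasFDerivAt g (fderiv ℝ g (s, t)) (s, t) :=
        ((hg.contDiffAt (hU.mem_nhds hp)).differentiableAt (by simp)).hasFDerivAt
      set L := fderiv ℝ g (s, t) with hL
      have hg2 : HasDerivAt (fun t => g (s, t)) (L (0, 1)) t :=
        hg1.comp_hasDerivAt t ((hasDerivAt_const t s).prodMk (hasDerivAt_id t))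
      have h0 : L (0, 1) ≠ 0 := hg2.deriv ▸ hd s t hp
      have hLd : ∀ a b : ℝ, L (a, b) = a * L (1, 0) + b * L (0, 1) := by
        intro a b
        have : ((a, b) : ℝ × ℝ) = a • (1, 0) + b • (0, 1) := by simp
        rw [this, map_add, map_smul, map_smul]; simp
      refine ⟨ContinuousLinearEquiv.equivOfInverse
        ((ContinuousLinearMap.fst ℝ ℝ ℝ).prod L)
        ((ContinuousLinearMap.fst ℝ ℝ ℝ).prod ((L (0, 1))⁻¹ •
          (ContinuousLinearMap.snd ℝ ℝ ℝ - L (1, 0) • ContinuousLinearMap.fst ℝ ℝ ℝ))) ?_ ?_, ?_⟩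
      · rintro ⟨a, b⟩
        simp [hLd a b]
        field_simp
        ring
      · rintro ⟨a, b⟩
        simp [hLd a]
        field_simp
        ring
      · exact hasFDerivAt_fst.prodMk hg1
  exact contDiff_snd.comp_contDiffOn key

theorem contDiffOn_inverse {g T : ℝ → ℝ} {U W : Set ℝ} (hU : IsOpen U) (hW : IsOpen W)
    (hg : ContDiffOn ℝ ∞ g U) (hinj : InjOn g U) (hT : ∀ v ∈ W, T v ∈ U ∧ g (T v) = v)
    (hd : ∀ t ∈ U, deriv g t ≠ 0) : ContDiffOn ℝ ∞ T W := by
  have h := contDiffOn_fiberwise_inverse (g := fun p => g p.2) (T := fun p => T p.2)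
    (hU.preimage continuous_snd) (hW.preimage continuous_snd)
    (hg.comp contDiffOn_snd fun _ h => h) (fun s t t' h h' he => hinj h h' he)
    (fun s v h => hT v h) (fun s t h => hd t h)
  exact h.comp (f := fun v : ℝ => ((0 : ℝ), v)) (by fun_prop) fun _ h => h

/-- The partial derivative in the first variable. -/
noncomputable def partialFst (f : ℝ × ℝ → ℝ) (p : ℝ × ℝ) : ℝ := fderiv ℝ f p (1, 0)

/-- The partial derivative in the second variable. -/
noncomputable def partialSnd (f : ℝ × ℝ → ℝ) (p : ℝ × ℝ) : ℝ := fderiv ℝ f p (0, 1)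

theorem ContDiff.partialFst {f : ℝ × ℝ → ℝ} (hf : ContDiff ℝ ∞ f) :
    ContDiff ℝ ∞ (partialFst f) :=
  (hf.fderiv_right (by simp)).clm_apply contDiff_const

theorem ContDiff.partialSnd {f : ℝ × ℝ → ℝ} (hf : ContDiff ℝ ∞ f) :
    ContDiff ℝ ∞ (partialSnd f) :=
  (hf.fderiv_right (by simp)).clm_apply contDiff_const

theorem ContDiff.hasDerivAt_fst {f : ℝ × ℝ → ℝ} (hf : ContDiff ℝ ∞ f) (x u : ℝ) :
    HasDerivAt (fun x => f (x, u)) (_root_.partialFst f (x, u)) x :=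
  ((hf.differentiable (by simp)) (x, u)).hasFDerivAt.comp_hasDerivAt x
    ((hasDerivAt_id x).prodMk (hasDerivAt_const x u))

theorem ContDiff.hasDerivAt_snd {f : ℝ × ℝ → ℝ} (hf : ContDiff ℝ ∞ f) (x u : ℝ) :
    HasDerivAt (fun u => f (x, u)) (_root_.partialSnd f (x, u)) u :=
  ((hf.differentiable (by simp)) (x, u)).hasFDerivAt.comp_hasDerivAt u
    ((hasDerivAt_const u x).prodMk (hasDerivAt_id u))

theorem fderiv_apply_eq_partials (f : ℝ × ℝ → ℝ) (p w : ℝ × ℝ) :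
    fderiv ℝ f p w = partialFst f p * w.1 + partialSnd f p * w.2 := by
  have : w = w.1 • ((1, 0) : ℝ × ℝ) + w.2 • ((0, 1) : ℝ × ℝ) := by ext <;> simp
  conv_lhs => rw [this]
  rw [map_add, map_smul, map_smul]
  simp [partialFst, partialSnd, mul_comm]

/-- The chain rule along a curve in the plane. -/
theorem ContDiff.hasDerivAt_comp_curve {f : ℝ × ℝ → ℝ} (hf : ContDiff ℝ ∞ f) {a b : ℝ → ℝ}
    {a' b' t : ℝ} (ha : HasDerivAt a a' t) (hb : HasDerivAt b b' t) :
    HasDerivAt (fun t => f (a t, b t))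
      (_root_.partialFst f (a t, b t) * a' + _root_.partialSnd f (a t, b t) * b') t := by
  have h := ((hf.differentiable (by simp)) (a t, b t)).hasFDerivAt.comp_hasDerivAt t
    (ha.prodMk hb)
  rwa [fderiv_apply_eq_partials] at h

/-- Rescaling to the unit interval turns the variable endpoint into a parameter of the integrand. -/
theorem contDiff_integral_fst {f : ℝ × ℝ → ℝ} (hf : ContDiff ℝ ∞ f) :
    ContDiff ℝ ∞ (fun p : ℝ × ℝ => ∫ σ in (0 : ℝ)..p.1, f (σ, p.2)) := by
  have h : (fun p : ℝ × ℝ => ∫ σ in (0 : ℝ)..p.1, f (σ, p.2))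
      = fun p : ℝ × ℝ => p.1 * ∫ θ in (0 : ℝ)..1, f (p.1 * θ, p.2) := by
    funext p
    have := intervalIntegral.smul_integral_comp_mul_left (a := 0) (b := 1)
      (fun σ => f (σ, p.2)) p.1
    rw [smul_eq_mul] at this
    rw [this]
    simp
  rw [h]
  exact contDiff_fst.mul (contDiff_integral_unitInterval
    (f := fun z : (ℝ × ℝ) × ℝ => f (z.1.1 * z.2, z.1.2)) (by fun_prop))

/-! ### Orders of vanishing at the boundary -/

/-- Smooth functions on the plane that are divisible by the `m`-th power of the second
coordinate. -/
def DivPow (m : ℕ) (f : ℝ × ℝ → ℝ) : Prop :=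
  ∃ g, ContDiff ℝ ∞ g ∧ ∀ x u, f (x, u) = u ^ m * g (x, u)

namespace DivPow

variable {m n : ℕ} {f g : ℝ × ℝ → ℝ}

theorem congr (h : DivPow m f) (hfg : ∀ x u, g (x, u) = f (x, u)) : DivPow m g := by
  obtain ⟨k, hk, h⟩ := h
  exact ⟨k, hk, fun x u => (hfg x u).trans (h x u)⟩

protected theorem contDiff (h : DivPow m f) : ContDiff ℝ ∞ f := by
  obtain ⟨g, hg, h⟩ := h
  have : f = fun p => p.2 ^ m * g p := funext fun p => h p.1 p.2
  rw [this]
  fun_prop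

theorem of_contDiff (h : ContDiff ℝ ∞ f) : DivPow 0 f := ⟨f, h, by simp⟩

theorem add (hf : DivPow m f) (hg : DivPow m g) : DivPow m (fun p => f p + g p) := by
  obtain ⟨a, ha, hf⟩ := hf
  obtain ⟨b, hb, hg⟩ := hg
  exact ⟨fun p => a p + b p, ha.add hb, fun x u => by simp only [hf, hg]; ring⟩

theorem neg (hf : DivPow m f) : DivPow m (fun p => -f p) := by
  obtain ⟨a, ha, hf⟩ := hf
  exact ⟨fun p => -a p, ha.neg, fun x u => by simp only [hf]; ring⟩

theorem sub (hf : DivPow m f) (hg : DivPow m g) : DivPow m (fun p => f p - g p) := by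
  obtain ⟨a, ha, hf⟩ := hf
  obtain ⟨b, hb, hg⟩ := hg
  exact ⟨fun p => a p - b p, ha.sub hb, fun x u => by simp only [hf, hg]; ring⟩

theorem mul (hf : DivPow m f) (hg : DivPow n g) : DivPow (m + n) (fun p => f p * g p) := by
  obtain ⟨a, ha, hf⟩ := hf
  obtain ⟨b, hb, hg⟩ := hg
  exact ⟨fun p => a p * b p, ha.mul hb, fun x u => by simp only [hf, hg]; ring⟩

theorem mul_right (hf : DivPow m f) (hg : ContDiff ℝ ∞ g) : DivPow m (fun p => f p * g p) :=
  hf.mul (of_contDiff hg)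

theorem mul_left (hg : ContDiff ℝ ∞ g) (hf : DivPow m f) : DivPow m (fun p => g p * f p) :=
  (hf.mul_right hg).congr fun _ _ => mul_comm _ _

theorem snd : DivPow 1 (fun p => p.2) := ⟨fun _ => 1, contDiff_const, by simp⟩

theorem snd_pow (m : ℕ) : DivPow m (fun p => p.2 ^ m) := ⟨fun _ => 1, contDiff_const, by simp⟩

theorem zero (m : ℕ) : DivPow m (fun _ => 0) := ⟨fun _ => 0, contDiff_const, by simp⟩

theorem mono (h : m ≤ n) (hf : DivPow n f) : DivPow m f := by
  obtain ⟨a, ha, hf⟩ := hf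
  obtain ⟨k, rfl⟩ := Nat.exists_eq_add_of_le h
  exact ⟨fun p => p.2 ^ k * a p, by fun_prop, fun x u => by rw [hf]; ring⟩

theorem one_of_contDiff (hf : ContDiff ℝ ∞ f) (h0 : ∀ x, f (x, 0) = 0) : DivPow 1 f := by
  obtain ⟨H, hH, h⟩ := exists_dividedDifference hf
  refine ⟨fun p => H (p.1, p.2, 0), by fun_prop, fun x u => ?_⟩
  have := h x u 0
  rw [h0] at this
  simpa using this

theorem succ (hg : ContDiff ℝ ∞ g) (h : ∀ x u, f (x, u) = u ^ m * g (x, u))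
    (h0 : ∀ x, g (x, 0) = 0) : DivPow (m + 1) f := by
  obtain ⟨k, hk, h'⟩ := one_of_contDiff hg h0
  exact ⟨k, hk, fun x u => by rw [h, h']; ring⟩

/-- The quotient by a power of the second coordinate is determined by continuity. -/
theorem quotient_unique {a b : ℝ → ℝ} (ha : Continuous a) (hb : Continuous b)
    (h : ∀ u, u ^ m * a u = u ^ m * b u) (u : ℝ) : a u = b u := by
  have hd : Dense ({0}ᶜ : Set ℝ) := dense_compl_singleton 0
  refine congrFun (Continuous.ext_on hd ha hb fun v hv => ?_) u
  exact mul_left_cancel₀ (pow_ne_zero m hv) (h v)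

theorem two_of_contDiff (hf : ContDiff ℝ ∞ f) (h0 : ∀ x, f (x, 0) = 0)
    (h1 : ∀ x, HasDerivAt (fun u => f (x, u)) 0 0) : DivPow 2 f := by
  obtain ⟨H, hH, h⟩ := exists_dividedDifference hf
  refine succ (g := fun p => H (p.1, p.2, 0)) (m := 1) (by fun_prop) (fun x u => ?_) fun x => ?_
  · have := h x u 0
    rw [h0] at this
    simpa using this
  · exact dividedDifference_self hH.continuous (by simpa using h) (h1 x)

theorem comp {a b : ℝ × ℝ → ℝ} (hf : DivPow m f) (ha : ContDiff ℝ ∞ a) (hb : DivPow 1 b) :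
    DivPow m (fun p => f (a p, b p)) := by
  obtain ⟨k, hk, h⟩ := hf
  have hb' := hb.contDiff
  obtain ⟨c, hc, hb⟩ := hb
  refine ⟨fun p => c p ^ m * k (a p, b p), by fun_prop, fun x u => ?_⟩
  beta_reduce
  rw [h, hb]
  ring

/-- The difference is `a - b` times a smooth divided difference of `F`, so no order of vanishing is
lost. -/
theorem comp_sub_comp {E : Type} [NormedAddCommGroup E] [NormedSpace ℝ E] [ProperSpace E]
    {F : E × ℝ → ℝ} {c : ℝ × ℝ → E} {a b : ℝ × ℝ → ℝ} (hF : ContDiff ℝ ∞ F)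
    (hc : ContDiff ℝ ∞ c) (ha : ContDiff ℝ ∞ a) (hb : ContDiff ℝ ∞ b)
    (h : DivPow m (fun p => a p - b p)) : DivPow m (fun p => F (c p, a p) - F (c p, b p)) := by
  obtain ⟨H, hH, hF'⟩ := exists_dividedDifference hF
  exact (h.mul_right (g := fun p => H (c p, a p, b p)) (by fun_prop)).congr
    fun x u => hF' _ _ _

theorem comp_sub_comp_fst {F : ℝ × ℝ → ℝ} {a b c : ℝ × ℝ → ℝ} (hF : ContDiff ℝ ∞ F)
    (hc : ContDiff ℝ ∞ c) (ha : ContDiff ℝ ∞ a) (hb : ContDiff ℝ ∞ b)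
    (h : DivPow m (fun p => a p - b p)) : DivPow m (fun p => F (a p, c p) - F (b p, c p)) :=
  comp_sub_comp (F := fun q : ℝ × ℝ => F (q.2, q.1)) (by fun_prop) hc ha hb h

/-- Induction on `m`: the bound forces the quotient found so far to vanish at `u = 0`. This is
checked for each `x` separately, so `C` and `δ` may depend on `x`. -/
theorem of_bound (hf : ContDiff ℝ ∞ f)
    (h : ∀ x, ∃ C δ : ℝ, 0 < δ ∧ ∀ u, |u| < δ → |f (x, u)| ≤ C * |u| ^ m) : DivPow m f := by
  induction m with
  | zero => exact of_contDiff hf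
  | succ m ih =>
    obtain ⟨g, hg, hfg⟩ := ih fun x => by
      obtain ⟨C, δ, hδ, hb⟩ := h x
      refine ⟨|C|, min δ 1, by positivity, fun u hu => ?_⟩
      have h1 : |u| ≤ 1 := (hu.trans_le (min_le_right _ _)).le
      refine (hb u (hu.trans_le (min_le_left _ _))).trans ?_
      calc C * |u| ^ (m + 1) ≤ |C| * |u| ^ (m + 1) := by gcongr; exact le_abs_self C
        _ ≤ |C| * |u| ^ m := by
          gcongr ?_ * ?_
          exact pow_le_pow_of_le_one (abs_nonneg u) h1 (Nat.le_succ m)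
    refine succ hg hfg fun x => ?_
    obtain ⟨C, δ, hδ, hb⟩ := h x
    have hc : Continuous fun u => |g (x, u)| := by
      have := hg.continuous
      fun_prop
    have hlim : Tendsto (fun u => |g (x, u)|) (𝓝[≠] 0) (𝓝 |g (x, 0)|) :=
      (hc.tendsto 0).mono_left nhdsWithin_le_nhds
    have hlim0 : Tendsto (fun u : ℝ => C * |u|) (𝓝[≠] 0) (𝓝 0) := by
      have : Tendsto (fun u : ℝ => C * |u|) (𝓝 0) (𝓝 (C * |0|)) :=
        (by fun_prop : Continuous fun u : ℝ => C * |u|).tendsto 0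
      simp only [abs_zero, mul_zero] at this
      exact this.mono_left nhdsWithin_le_nhds
    have hle : |g (x, 0)| ≤ 0 := by
      refine le_of_tendsto_of_tendsto hlim hlim0 ?_
      filter_upwards [self_mem_nhdsWithin,
        nhdsWithin_le_nhds (Metric.ball_mem_nhds (0 : ℝ) hδ)] with u hu hu'
      have h1 := hb u (by simpa using hu')
      rw [hfg, abs_mul, abs_pow, pow_succ] at h1
      have h2 : 0 < |u| ^ m := pow_pos (abs_pos.2 hu) m
      refine le_of_mul_le_mul_left ?_ h2
      linarith
    exact abs_eq_zero.1 (le_antisymm hle (abs_nonneg _))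

theorem partialFst (hf : DivPow m f) : DivPow m (partialFst f) := by
  have hf' := hf.contDiff
  obtain ⟨g, hg, h⟩ := hf
  refine ⟨_root_.partialFst g, hg.partialFst, fun x u => ?_⟩
  have h1 := (hg.hasDerivAt_fst x u).const_mul (u ^ m)
  have h2 : (fun x => f (x, u)) = fun x => u ^ m * g (x, u) := funext fun x => h x u
  rw [← h2] at h1
  exact (hf'.hasDerivAt_fst x u).unique h1

theorem partialSnd (hf : DivPow (m + 1) f) : DivPow m (partialSnd f) := by
  have hf' := hf.contDiff
  obtain ⟨g, hg, h⟩ := hf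
  refine ⟨fun p => (m + 1) * g p + p.2 * _root_.partialSnd g p,
    by have := hg.partialSnd; fun_prop, fun x u => ?_⟩
  have h1 := (hasDerivAt_pow (m + 1) u).mul (hg.hasDerivAt_snd x u)
  have h2 : (fun u => f (x, u)) = (fun u => u ^ (m + 1)) * fun u => g (x, u) :=
    funext fun u => h x u
  rw [← h2] at h1
  rw [(hf'.hasDerivAt_snd x u).unique h1]
  simp
  ring

theorem integral_fst (hf : DivPow m f) :
    DivPow m (fun p => ∫ σ in (0 : ℝ)..p.1, f (σ, p.2)) := by
  obtain ⟨g, hg, h⟩ := hf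
  refine ⟨_, contDiff_integral_fst hg, fun x u => ?_⟩
  simp only [h]
  rw [intervalIntegral.integral_const_mul]

end DivPow

/-! ### Flat functions and Borel's lemma -/

/-- Smooth functions on the plane that vanish to all orders on the line `u = 0`. -/
def IsFlat (f : ℝ × ℝ → ℝ) : Prop := ∀ m, DivPow m f

/-- An even smooth cutoff function, equal to `1` on `[-1, 1]`. -/
noncomputable def evenCutoff (t : ℝ) : ℝ := Real.smoothTransition (2 - t ^ 2)

theorem contDiff_evenCutoff : ContDiff ℝ ∞ evenCutoff :=
  Real.smoothTransition.contDiff.comp (by fun_prop)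

theorem evenCutoff_neg (t : ℝ) : evenCutoff (-t) = evenCutoff t := by simp [evenCutoff]

theorem evenCutoff_of_abs_le {t : ℝ} (h : |t| ≤ 1) : evenCutoff t = 1 :=
  Real.smoothTransition.one_of_one_le (by nlinarith [sq_abs t, abs_nonneg t])

theorem evenCutoff_of_two_le_abs {t : ℝ} (h : 2 ≤ |t|) : evenCutoff t = 0 :=
  Real.smoothTransition.zero_of_nonpos (by nlinarith [sq_abs t, abs_nonneg t])

theorem exists_bound_of_periodic_of_support {F : Type} [NormedAddCommGroup F] {f : ℝ × ℝ → F}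
    (hf : Continuous f) (hper : ∀ x u, f (x + 1, u) = f (x, u))
    (hs : ∀ x u, 2 < |u| → f (x, u) = 0) : ∃ C, 0 ≤ C ∧ ∀ p, ‖f p‖ ≤ C := by
  obtain ⟨C, hC⟩ := ((isCompact_Icc (a := (0 : ℝ)) (b := 1)).prod
    (isCompact_Icc (a := (-2 : ℝ)) (b := 2))).exists_bound_of_continuousOn hf.continuousOn
  have h0 := hC (0, 0) ⟨by simp, by simp⟩
  have hC0 : 0 ≤ C := (norm_nonneg _).trans h0
  refine ⟨C, hC0, fun ⟨x, u⟩ => ?_⟩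
  by_cases hu : 2 < |u|
  · rw [hs x u hu]; simpa using hC0
  · have hp : Function.Periodic (fun x => f (x, u)) 1 := fun x => hper x u
    have h1 : f (Int.fract x, u) = f (x, u) := by
      have := hp.sub_int_mul_eq (x := x) ⌊x⌋
      rwa [mul_one] at this
    rw [← h1]
    refine hC _ ⟨⟨Int.fract_nonneg x, (Int.fract_lt_one x).le⟩, ?_⟩
    push Not at hu
    exact abs_le.1 hu

/-- The summand of Borel's construction: cut off at scale `ε`, the monomial has derivatives of order
`k < K` of size at most a constant times `ε ^ (K - k)`, hence as small as desired. An even cutoff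
keeps the odd symmetry. In the last bound one power of `u` is traded for a factor `ε`; this makes
the tail of a series of such terms uniformly small of high order. -/
theorem exists_small_monomial {q : ℝ → ℝ} (hq : ContDiff ℝ ∞ q) (hper : Function.Periodic q 1)
    {K k₀ : ℕ} (hK : Odd K) (hk : k₀ < K) {δ : ℝ} (hδ : 0 < δ) :
    ∃ T : ℝ × ℝ → ℝ, ContDiff ℝ ∞ T ∧ (∀ x u, T (x + 1, u) = T (x, u)) ∧
      (∀ x u, T (x, -u) = -T (x, u)) ∧
      (∃ ε > 0, ∀ x u, |u| < ε → T (x, u) = q x * u ^ K) ∧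
      (∀ k ≤ k₀, ∀ p, ‖iteratedFDeriv ℝ k T p‖ ≤ δ) ∧
      ∀ x u, |T (x, u)| ≤ δ * |u| ^ (K - 1) := by
  have hχ := contDiff_evenCutoff
  set f : ℝ × ℝ → ℝ := fun p => q p.1 * p.2 ^ K * evenCutoff p.2 with hf
  have hfs : ContDiff ℝ ∞ f := by fun_prop
  have hfper : ∀ p, f (p + (1, 0)) = f p := fun p => by simp [hf, hper p.1]
  have hDs : ∀ k (x u : ℝ), 2 < |u| → iteratedFDeriv ℝ k f (x, u) = 0 := by
    intro k x u hu
    have : f =ᶠ[𝓝 (x, u)] fun _ => (0 : ℝ) := by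
      have ho : ∀ᶠ p : ℝ × ℝ in 𝓝 (x, u), 2 < |p.2| :=
        (continuous_snd.abs.tendsto (x, u)).eventually_const_lt hu
      filter_upwards [ho] with p hp
      simp [hf, evenCutoff_of_two_le_abs hp.le]
    rw [(this.iteratedFDeriv ℝ k).eq_of_nhds]
    simp
  have hDper : ∀ k (x u : ℝ), iteratedFDeriv ℝ k f (x + 1, u) = iteratedFDeriv ℝ k f (x, u) := by
    intro k x u
    have h1 := iteratedFDeriv_comp_add_right (𝕜 := ℝ) (f := f) k ((1 : ℝ), (0 : ℝ)) (x, u)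
    have h2 : (fun p => f (p + (1, 0))) = f := funext hfper
    rw [h2] at h1
    simpa using h1.symm
  have hbd : ∀ k, ∃ C, 0 ≤ C ∧ ∀ p, ‖iteratedFDeriv ℝ k f p‖ ≤ C := fun k =>
    exists_bound_of_periodic_of_support
      (hfs.continuous_iteratedFDeriv (by exact_mod_cast le_top)) (hDper k) (hDs k)
  choose C hC0 hC using hbd
  obtain ⟨Q, hQ0, hQ⟩ := exists_bound_of_periodic_of_support (f := fun p : ℝ × ℝ =>
      q p.1 * evenCutoff p.2 * p.2)
    (by have := hq.continuous; have := hχ.continuous; fun_prop)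
    (fun x u => by simp [hper x]) (fun x u hu => by simp [evenCutoff_of_two_le_abs hu.le])
  -- `B₀` dominates every constant used below, so the single choice `ε ≤ δ / B₀` serves all the
  -- bounds.
  set B₀ : ℝ := 1 + Q + ∑ k ∈ Finset.range (k₀ + 1), C k
  have hsum : 0 ≤ ∑ k ∈ Finset.range (k₀ + 1), C k := Finset.sum_nonneg fun k _ => hC0 k
  have hB₀ : 0 < B₀ := by positivity
  set ε := min 1 (δ / B₀) with hε
  have hε0 : 0 < ε := by positivity
  have hε1 : ε ≤ 1 := min_le_left _ _
  have hεδ : ε * B₀ ≤ δ := by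
    calc ε * B₀ ≤ δ / B₀ * B₀ := by gcongr; exact min_le_right _ _
      _ = δ := by field_simp
  refine ⟨fun p => q p.1 * p.2 ^ K * evenCutoff (p.2 / ε), by fun_prop,
    fun x u => by simp [hper x], fun x u => by
      simp only [hK.neg_pow, neg_div, evenCutoff_neg]; ring,
    ⟨ε, hε0, fun x u hu => ?_⟩, fun k hkk p => ?_, fun x u => ?_⟩
  · have : |u / ε| ≤ 1 := by
      rw [abs_div, abs_of_pos hε0, div_le_one hε0]; exact hu.le
    simp [evenCutoff_of_abs_le this]
  · set A : (ℝ × ℝ) →L[ℝ] (ℝ × ℝ) := (ContinuousLinearMap.fst ℝ ℝ ℝ).prod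
      (ε⁻¹ • ContinuousLinearMap.snd ℝ ℝ ℝ) with hA
    -- The function is `ε ^ K` times a rescaling of the fixed function `f`; each derivative costs at
    -- most a factor `ε⁻¹`, because `ε ≤ 1`.
    have hTA : (fun p : ℝ × ℝ => q p.1 * p.2 ^ K * evenCutoff (p.2 / ε))
        = fun p => ε ^ K • (f ∘ A) p := by
      funext p
      simp only [hf, hA, Function.comp_apply, ContinuousLinearMap.prod_apply, smul_eq_mul,
        ContinuousLinearMap.coe_fst', FunLike.coe_smul, Pi.smul_apply,
        ContinuousLinearMap.coe_snd', mul_pow, inv_pow]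
      have : ε ^ K ≠ 0 := by positivity
      field_simp
    have hAn : ‖A‖ ≤ ε⁻¹ := by
      refine A.opNorm_le_bound (by positivity) fun p => ?_
      have h1 : 1 ≤ ε⁻¹ := (one_le_inv₀ hε0).2 hε1
      simp only [hA, ContinuousLinearMap.prod_apply, Prod.norm_def]
      refine max_le ?_ ?_
      · calc ‖p.1‖ ≤ max ‖p.1‖ ‖p.2‖ := le_max_left _ _
          _ ≤ ε⁻¹ * max ‖p.1‖ ‖p.2‖ := le_mul_of_one_le_left (by positivity) h1
      · simp only [FunLike.coe_smul, Pi.smul_apply, ContinuousLinearMap.coe_snd',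
          smul_eq_mul, norm_mul, norm_inv, Real.norm_of_nonneg hε0.le]
        gcongr
        exact le_max_right _ _
    have hfk : ContDiff ℝ k f := hfs.of_le (by exact_mod_cast le_top)
    rw [hTA, iteratedFDeriv_const_smul_apply' (hfk.comp A.contDiff).contDiffAt,
      A.iteratedFDeriv_comp_right hfk p le_rfl, norm_smul]
    calc ‖ε ^ K‖ * ‖(iteratedFDeriv ℝ k f (A p)).compContinuousLinearMap fun _ => A‖
        ≤ ε ^ K * (C k * (ε⁻¹) ^ k) := by
          rw [Real.norm_of_nonneg (by positivity)]
          gcongr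
          refine (ContinuousMultilinearMap.norm_compContinuousLinearMap_le _ _).trans ?_
          rw [Finset.prod_const, Finset.card_univ, Fintype.card_fin]
          gcongr
          · exact hC0 k
          · exact hC k _
      _ = ε ^ (K - k) * C k := by
          obtain ⟨j, rfl⟩ := Nat.exists_eq_add_of_le (hkk.trans hk.le)
          rw [Nat.add_sub_cancel_left, pow_add, inv_pow]
          field_simp
      _ ≤ ε * B₀ := by
          have h1 : C k ≤ ∑ k ∈ Finset.range (k₀ + 1), C k :=
            Finset.single_le_sum (f := C) (fun i _ => hC0 i) (by simpa using Nat.lt_succ_of_le hkk)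
          have h2 : ε ^ (K - k) ≤ ε := pow_le_of_le_one hε0.le hε1 (by omega)
          have := hC0 k
          gcongr
          linarith
      _ ≤ δ := hεδ
  · have h1 := hQ (x, u / ε)
    obtain ⟨j, rfl⟩ : ∃ j, K = j + 1 := ⟨K - 1, by omega⟩
    have h2 : q x * u ^ (j + 1) * evenCutoff (u / ε)
        = ε * (q x * evenCutoff (u / ε) * (u / ε)) * u ^ j := by
      field_simp
      ring
    simp only [Real.norm_eq_abs] at h1
    beta_reduce
    rw [h2, abs_mul, abs_mul, abs_pow, abs_of_pos hε0, Nat.add_sub_cancel]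
    gcongr
    refine le_trans ?_ hεδ
    gcongr
    linarith

/-- Borel's lemma with a periodic parameter: an odd smooth function with prescribed formal
expansion and a small derivative. -/
theorem exists_borel_sum {q : ℕ → ℝ → ℝ} (hq : ∀ n, ContDiff ℝ ∞ (q n))
    (hper : ∀ n, Function.Periodic (q n) 1) :
    ∃ b : ℝ × ℝ → ℝ, ContDiff ℝ ∞ b ∧ (∀ x u, b (x + 1, u) = b (x, u)) ∧
      (∀ x u, b (x, -u) = -b (x, u)) ∧ (∀ p, |partialSnd b p| ≤ 1 / 2) ∧
      ∀ N, DivPow (2 * N + 3)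
        (fun p => b p - ∑ n ∈ Finset.range N, q n p.1 * p.2 ^ (2 * n + 3)) := by
  -- With `k₀ = n + 1` the derivatives of order `k` are controlled for all `n ≥ k`, and those of
  -- order one for every `n`. The factor `1 / 4` makes the bounds add up to `1 / 2`, which later
  -- keeps `u + b` increasing in `u`.
  choose T hT hTper hTodd hTε hTd hTb using fun n => exists_small_monomial (hq n) (hper n)
    (K := 2 * n + 3) (k₀ := n + 1) ⟨n + 1, by ring⟩ (by omega)
    (δ := (1 / 4 : ℝ) * (1 / 2) ^ n) (by positivity)
  have hgeo : Summable fun n : ℕ => (1 / 4 : ℝ) * (1 / 2) ^ n :=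
    (summable_geometric_of_lt_one (by norm_num) (by norm_num)).mul_left _
  have hgeos : ∑' n : ℕ, (1 / 4 : ℝ) * (1 / 2) ^ n = 1 / 2 := by
    rw [tsum_mul_left, tsum_geometric_of_lt_one (by norm_num) (by norm_num)]; norm_num
  have hTn : ∀ n p, ‖T n p‖ ≤ (1 / 4 : ℝ) * (1 / 2) ^ n := fun n p => by
    simpa using hTd n 0 (by omega) p
  have hsummable : ∀ p, Summable fun n => T n p := fun p =>
    Summable.of_norm_bounded hgeo fun n => hTn n p
  have hsmooth : ∀ N, ContDiff ℝ ∞ (fun p => ∑' n, T (n + N) p) := by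
    intro N
    refine contDiff_tsum_of_eventually (N := ⊤) (v := fun _ n => (1 / 4 : ℝ) * (1 / 2) ^ (n + N))
      (fun n => hT _) (fun k _ => (summable_nat_add_iff N).2 hgeo) fun k _ => ?_
    rw [Nat.cofinite_eq_atTop]
    filter_upwards [eventually_ge_atTop k] with n hn p
    exact hTd _ k (by omega) p
  have hb : ContDiff ℝ ∞ (fun p => ∑' n, T n p) := by simpa using hsmooth 0
  refine ⟨fun p => ∑' n, T n p, hb, fun x u => by simp only [hTper], fun x u => ?_,
    fun p => ?_, fun N => ?_⟩
  · simp only [hTodd]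
    rw [tsum_neg]
  · have hfd : ∀ n p, ‖fderiv ℝ (T n) p‖ ≤ (1 / 4 : ℝ) * (1 / 2) ^ n := fun n p => by
      have := hTd n 1 (by omega) p
      rwa [norm_iteratedFDeriv_one] at this
    have h1 := hasFDerivAt_tsum hgeo
      (fun n p => ((hT n).differentiable (by simp) p).hasFDerivAt) hfd (hsummable 0) p
    have h2 : ‖fderiv ℝ (fun p => ∑' n, T n p) p‖ ≤ 1 / 2 := by
      rw [h1.fderiv, ← hgeos]
      exact tsum_of_norm_bounded hgeo.hasSum fun n => hfd n p
    calc |partialSnd (fun p => ∑' n, T n p) p| ≤ ‖fderiv ℝ (fun p => ∑' n, T n p) p‖ *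
          ‖((0, 1) : ℝ × ℝ)‖ := (fderiv ℝ (fun p => ∑' n, T n p) p).le_opNorm _
      _ ≤ 1 / 2 * 1 := by
          gcongr
          simp [Prod.norm_def]
      _ = 1 / 2 := by norm_num
  -- Near `u = 0` the terms with `n < N` cancel their monomials exactly. The term `N` is kept apart,
  -- since its uniform bound `|u| ^ (2 N + 2)` is one power short, whereas near `u = 0` it is the
  -- monomial itself. From `N + 1` on the uniform bounds suffice.
  · have hsplit : ∀ p, (∑' n, T n p) - ∑ n ∈ Finset.range N, q n p.1 * p.2 ^ (2 * n + 3)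
        = (∑ n ∈ Finset.range N, (T n p - q n p.1 * p.2 ^ (2 * n + 3)))
          + T N p + ∑' n, T (n + (N + 1)) p := by
      intro p
      rw [← (hsummable p).sum_add_tsum_nat_add (N + 1), Finset.sum_range_succ,
        Finset.sum_sub_distrib]
      ring
    refine DivPow.congr (f := fun p => (∑ n ∈ Finset.range N,
      (T n p - q n p.1 * p.2 ^ (2 * n + 3))) + T N p + ∑' n, T (n + (N + 1)) p) ?_
      fun x u => hsplit (x, u)
    have near : ∀ n, DivPow (2 * N + 3) (fun p => T n p - q n p.1 * p.2 ^ (2 * n + 3)) := by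
      intro n
      have := hT n
      have := hq n
      refine DivPow.of_bound (by fun_prop) fun x => ?_
      obtain ⟨ε, hε, h⟩ := hTε n
      exact ⟨0, ε, hε, fun u hu => by simp [h x u hu]⟩
    refine DivPow.add (DivPow.add ?_ ?_) ?_
    · have : ∀ M, DivPow (2 * N + 3)
          (fun p => ∑ n ∈ Finset.range M, (T n p - q n p.1 * p.2 ^ (2 * n + 3))) := by
        intro M
        induction M with
        | zero => simpa using DivPow.zero _
        | succ M ih =>
          simp only [Finset.sum_range_succ]
          exact ih.add (near M)
      exact this N
    · have h1 : DivPow (2 * N + 3) (fun p => q N p.1 * p.2 ^ (2 * N + 3)) :=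
        DivPow.mul_left (by have := hq N; fun_prop) (DivPow.snd_pow _)
      exact ((near N).add h1).congr fun x u => by ring
    · refine DivPow.of_bound (hsmooth (N + 1)) fun x => ⟨1 / 2, 1, one_pos, fun u hu => ?_⟩
      have hg' := (summable_nat_add_iff (N + 1)).2 hgeo
      have hle : ∀ n, ‖T (n + (N + 1)) (x, u)‖
          ≤ ((1 / 4 : ℝ) * (1 / 2) ^ (n + (N + 1))) * |u| ^ (2 * N + 3) := by
        intro n
        refine (hTb _ x u).trans ?_
        gcongr ?_ * ?_
        exact pow_le_pow_of_le_one (abs_nonneg u) hu.le (by omega)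
      have h3 := tsum_of_norm_bounded (hg'.mul_right (|u| ^ (2 * N + 3))).hasSum hle
      refine h3.trans ?_
      rw [tsum_mul_right]
      gcongr
      have hst := hgeo.sum_add_tsum_nat_add (N + 1)
      rw [hgeos] at hst
      have : 0 ≤ ∑ i ∈ Finset.range (N + 1), (1 / 4 : ℝ) * (1 / 2) ^ i :=
        Finset.sum_nonneg fun i _ => by positivity
      linarith

/-- Integrating from `u = 0` along a path scaled to the unit interval gains one factor `u`. -/
theorem DivPow.of_partialSnd {m : ℕ} {f : ℝ × ℝ → ℝ} (hf : ContDiff ℝ ∞ f)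
    (h0 : ∀ x, f (x, 0) = 0) (h : DivPow m (_root_.partialSnd f)) : DivPow (m + 1) f := by
  obtain ⟨g, hg, h⟩ := h
  refine ⟨fun p => ∫ θ in (0 : ℝ)..1, θ ^ m * g (p.1, p.2 * θ), contDiff_integral_unitInterval
    (f := fun z : (ℝ × ℝ) × ℝ => z.2 ^ m * g (z.1.1, z.1.2 * z.2)) (by fun_prop),
    fun x u => ?_⟩
  have hc := hg.continuous
  have h1 := intervalIntegral.integral_eq_sub_of_hasDerivAt (a := 0) (b := 1)
    (f := fun θ : ℝ => f (x, u * θ)) (f' := fun θ => u ^ (m + 1) * (θ ^ m * g (x, u * θ)))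
    (fun θ _ => by
      have h2 : HasDerivAt (fun θ : ℝ => u * θ) u θ := by
        simpa using (hasDerivAt_id θ).const_mul u
      have h3 := (hf.hasDerivAt_snd x (u * θ)).comp θ h2
      rw [h] at h3
      convert! h3 using 1
      ring)
    (Continuous.intervalIntegrable (by fun_prop) 0 1)
  rw [intervalIntegral.integral_const_mul] at h1
  simp only [h1, mul_one, mul_zero, h0, sub_zero]

/-! ### Exact reversible twist maps and their lowest orders -/

/-- An exact reversible twist map `(x, r) ↦ (f, g)` of the cylinder, lifted to the plane. The
primitive of the invariant area form is `2 * L * r ^ 2 / (1 + W x * r ^ 2) dx`, and the reversor is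
`(x, r) ↦ (x, -r)`. -/
structure ReversibleTwist where
  f : ℝ × ℝ → ℝ
  g : ℝ × ℝ → ℝ
  F : ℝ × ℝ → ℝ
  W : ℝ → ℝ
  L : ℝ
  τ : ℝ
  L_pos : 0 < L
  τ_pos : 0 < τ
  W_pos : ∀ x, 0 < W x
  contDiff_f : ContDiff ℝ ∞ f
  contDiff_g : ContDiff ℝ ∞ g
  contDiff_F : ContDiff ℝ ∞ F
  contDiff_W : ContDiff ℝ ∞ W
  f_add_one : ∀ x r, f (x + 1, r) = f (x, r) + 1
  g_add_one : ∀ x r, g (x + 1, r) = g (x, r)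
  F_add_one : ∀ x r, F (x + 1, r) = F (x, r)
  W_add_one : ∀ x, W (x + 1) = W x
  f_zero : ∀ x, f (x, 0) = x
  g_zero : ∀ x, g (x, 0) = 0
  twist : ∀ x, partialSnd f (x, 0) = τ
  rev_f : ∀ p, f (f p, -g p) = p.1
  rev_g : ∀ p, g (f p, -g p) = -p.2
  exact_fst : ∀ p, 2 * L * g p ^ 2 / (1 + W (f p) * g p ^ 2) * partialFst f p
    - 2 * L * p.2 ^ 2 / (1 + W p.1 * p.2 ^ 2) = partialFst F p
  exact_snd : ∀ p, 2 * L * g p ^ 2 / (1 + W (f p) * g p ^ 2) * partialSnd f p = partialSnd F p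

namespace ReversibleTwist

variable (T : ReversibleTwist)

/-- The coefficient of the primitive of the area form. -/
noncomputable def P (p : ℝ × ℝ) : ℝ := 2 * T.L * p.2 ^ 2 / (1 + T.W p.1 * p.2 ^ 2)

/-- The quotient of `T.P` by the square of the second coordinate. -/
noncomputable def density (p : ℝ × ℝ) : ℝ := 2 * T.L / (1 + T.W p.1 * p.2 ^ 2)

theorem denom_pos (p : ℝ × ℝ) : 0 < 1 + T.W p.1 * p.2 ^ 2 := by
  have := (T.W_pos p.1).le
  positivity

theorem contDiff_density : ContDiff ℝ ∞ T.density := by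
  have := T.contDiff_W
  exact ContDiff.div (by fun_prop) (by fun_prop) fun p => (T.denom_pos p).ne'

theorem P_eq (p : ℝ × ℝ) : T.P p = p.2 ^ 2 * T.density p := by
  rw [P, density]; ring

theorem contDiff_P : ContDiff ℝ ∞ T.P := by
  have := T.contDiff_density
  rw [show T.P = fun p => p.2 ^ 2 * T.density p from funext T.P_eq]
  fun_prop

theorem density_zero (x : ℝ) : T.density (x, 0) = 2 * T.L := by simp [density]

theorem density_pos (p : ℝ × ℝ) : 0 < T.density p :=
  div_pos (by linarith [T.L_pos]) (T.denom_pos p)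

theorem divPow_density : DivPow 2 (fun p => T.density p - 2 * T.L) := by
  have h := T.contDiff_density
  have hW := T.contDiff_W
  refine ⟨fun p => -(T.W p.1 * T.density p), by fun_prop, fun x u => ?_⟩
  have := (T.denom_pos (x, u)).ne'
  simp only [density] at *
  field_simp
  ring

theorem exactness_fst (p : ℝ × ℝ) :
    T.P (T.f p, T.g p) * partialFst T.f p - T.P p = partialFst T.F p := T.exact_fst p

theorem exactness_snd (p : ℝ × ℝ) :
    T.P (T.f p, T.g p) * partialSnd T.f p = partialSnd T.F p := T.exact_snd p

theorem divPow_f : DivPow 2 (fun p => T.f p - p.1 - T.τ * p.2) := by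
  have hf := T.contDiff_f
  refine DivPow.two_of_contDiff (by fun_prop) (fun x => by simp [T.f_zero]) fun x => ?_
  have h1 := hf.hasDerivAt_snd x 0
  rw [T.twist] at h1
  have h2 := (h1.sub_const x).fun_sub ((hasDerivAt_id' (0 : ℝ)).const_mul T.τ)
  simpa using h2

theorem partialFst_f_zero (x : ℝ) : partialFst T.f (x, 0) = 1 := by
  have h := T.contDiff_f.hasDerivAt_fst x 0
  simp only [T.f_zero] at h
  exact h.unique (hasDerivAt_id x)

/-- Differentiating the reversibility relation `f (f, -g) = x` in `r` at `r = 0` gives `τ - τ * ∂g =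
0`, and `τ ≠ 0`. -/
theorem partialSnd_g_zero (x : ℝ) : partialSnd T.g (x, 0) = 1 := by
  have h1 := T.contDiff_f.hasDerivAt_snd x 0
  have h2 := T.contDiff_g.hasDerivAt_snd x 0
  have h3 := T.contDiff_f.hasDerivAt_comp_curve h1 h2.fun_neg
  simp only [T.rev_f, T.f_zero, T.g_zero, neg_zero, T.twist, T.partialFst_f_zero] at h3
  have h4 := h3.unique (hasDerivAt_const 0 x)
  have := T.τ_pos.ne'
  have h5 : T.τ * (1 - partialSnd T.g (x, 0)) = 0 := by linarith
  rcases mul_eq_zero.1 h5 with h | h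
  · exact absurd h this
  · linarith

theorem divPow_g_two : DivPow 2 (fun p => T.g p - p.2) := by
  have hg := T.contDiff_g
  refine DivPow.two_of_contDiff (by fun_prop) (fun x => by simp [T.g_zero]) fun x => ?_
  have h1 := hg.hasDerivAt_snd x 0
  rw [T.partialSnd_g_zero] at h1
  simpa using h1.fun_sub (hasDerivAt_id' (0 : ℝ))

theorem divPow_g_one : DivPow 1 T.g := DivPow.one_of_contDiff T.contDiff_g T.g_zero

/-- By exactness the derivative of `F` in `r` is `r ^ 2` times a smooth `B`, whose boundary value `2
L τ` does not depend on `x` because the twist is constant. As `F` is constant on `r = 0`, the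
dependence of `F` on `x` starts at order four. -/
theorem divPow_partialFst_F : DivPow 4 (partialFst T.F) := by
  have hf := T.contDiff_f
  have hF := T.contDiff_F
  have hm := T.contDiff_density
  have hg := T.contDiff_g
  obtain ⟨a, ha, hga⟩ := T.divPow_g_one
  simp only [pow_one] at hga
  have ha0 : ∀ x, a (x, 0) = 1 := fun x => by
    have h1 : HasDerivAt (fun u => T.g (x, u)) (1 * a (x, 0) + 0 * partialSnd a (x, 0)) 0 := by
      simp only [hga]
      exact (hasDerivAt_id (0 : ℝ)).mul (ha.hasDerivAt_snd x 0)
    have h2 := (hg.hasDerivAt_snd x 0).unique h1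
    rw [T.partialSnd_g_zero] at h2
    linarith
  set B : ℝ × ℝ → ℝ := fun p => a p ^ 2 * T.density (T.f p, T.g p) * partialSnd T.f p with hB
  have hBs : ContDiff ℝ ∞ B := by
    have := hf.partialSnd
    fun_prop
  have hFB : ∀ x u, partialSnd T.F (x, u) = u ^ 2 * B (x, u) := fun x u => by
    rw [← T.exactness_snd, P_eq]
    simp only [hB]
    rw [hga]
    ring
  have hB0 : ∀ x, B (x, 0) = 2 * T.L * T.τ := fun x => by
    simp only [hB, ha0, T.f_zero, T.g_zero, T.density_zero, T.twist]; ring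
  have hF0 : ∀ x, T.F (x, 0) = T.F (0, 0) := by
    have hd : ∀ x, HasDerivAt (fun x => T.F (x, 0)) 0 x := fun x => by
      have := hF.hasDerivAt_fst x 0
      rw [← T.exactness_fst] at this
      simpa [P_eq, T.g_zero] using this
    intro x
    exact is_const_of_deriv_eq_zero (fun x => (hd x).differentiableAt) (fun x => (hd x).deriv) x 0
  have hQ : DivPow 4 (fun p => T.F p - T.F (0, p.2)) := by
    refine DivPow.of_partialSnd (by fun_prop) (fun x => by simp [hF0 x]) ?_
    have h1 : DivPow 3 (fun p => p.2 ^ 2 * (B p - B (0, p.2))) :=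
      (DivPow.snd_pow 2).mul (DivPow.one_of_contDiff (by fun_prop) fun x => by simp [hB0])
    refine h1.congr fun x u => ?_
    have hs : ContDiff ℝ ∞ (fun p : ℝ × ℝ => T.F p - T.F (0, p.2)) := by fun_prop
    have h2 := (hF.hasDerivAt_snd x u).sub (hF.hasDerivAt_snd 0 u)
    rw [(hs.hasDerivAt_snd x u).unique h2, hFB, hFB]
    ring
  refine hQ.partialFst.congr fun x u => ?_
  have h2 := (hF.hasDerivAt_fst x u).sub_const (T.F (0, u))
  exact h2.unique (hQ.contDiff.hasDerivAt_fst x u)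

/-- The start of the iteration: the curves `r = u` have a defect of order three. Exactness together
with `∂f/∂x = 1 + O(r ^ 2)` shows that `P` changes along the map by `O(r ^ 4)` only; since `P = 2 L
r ^ 2 + O(r ^ 4)`, also `g ^ 2 - r ^ 2 = O(r ^ 4)`. -/
theorem divPow_g : DivPow 3 (fun p => T.g p - p.2) := by
  have hf := T.contDiff_f
  have hm := T.contDiff_density
  have hg := T.contDiff_g
  have hfx : DivPow 2 (fun p => partialFst T.f p - 1) := by
    refine T.divPow_f.partialFst.congr fun x u => ?_
    have h1 := ((hf.hasDerivAt_fst x u).sub (hasDerivAt_id x)).sub_const (T.τ * u)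
    exact h1.unique (T.divPow_f.contDiff.hasDerivAt_fst x u)
  have hP : DivPow 2 (fun p => T.P (T.f p, T.g p)) := by
    have : DivPow 2 T.P := ⟨T.density, hm, fun x u => T.P_eq _⟩
    exact this.comp hf T.divPow_g_one
  have h1 : DivPow 4 (fun p => T.P (T.f p, T.g p) - T.P p) :=
    (T.divPow_partialFst_F.sub (hP.mul hfx)).congr fun x u => by
      simp only [← T.exactness_fst]; ring
  have h2 : DivPow 4 (fun p => 2 * T.L * (T.g p ^ 2 - p.2 ^ 2)) := by
    have h3 : DivPow 4 (fun p => p.2 ^ 2 * (T.density p - 2 * T.L)) :=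
      (DivPow.snd_pow 2).mul T.divPow_density
    have h4 := h3.comp hf T.divPow_g_one
    refine ((h1.sub h4).add h3).congr fun x u => ?_
    simp only [T.P_eq]
    ring
  obtain ⟨k, hk, h2⟩ := h2
  obtain ⟨b, hb, hgb⟩ := T.divPow_g_two
  refine DivPow.succ hb hgb fun x => ?_
  -- With `g = u + u ^ 2 b` one has `g ^ 2 - u ^ 2 = u ^ 3 b (2 + u b)`, so divisibility by `u ^ 4`
  -- forces `b` to vanish at `u = 0`.
  have h5 := DivPow.quotient_unique (m := 3) (a := fun u => 2 * T.L * (b (x, u) * (2 + u * b (x, u))))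
    (b := fun u => u * k (x, u)) (by have := hb.continuous; fun_prop)
    (by have := hk.continuous; fun_prop) (fun u => by
      have e1 := h2 x u
      have e2 : T.g (x, u) = u + u ^ 2 * b (x, u) := by linarith [hgb x u]
      simp only [e2] at e1
      linear_combination e1) 0
  have := T.L_pos
  simp at h5
  rcases h5 with h | h
  · linarith
  · exact h

end ReversibleTwist

theorem partialSnd_eq_of_eq_mul {f k : ℝ × ℝ → ℝ} (hf : ContDiff ℝ ∞ f) (hk : ContDiff ℝ ∞ k)
    (h : ∀ x u, f (x, u) = u * k (x, u)) (x : ℝ) : partialSnd f (x, 0) = k (x, 0) := by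
  have h1 : HasDerivAt (fun u => f (x, u)) (1 * k (x, 0) + 0 * partialSnd k (x, 0)) 0 := by
    simp only [h]
    exact (hasDerivAt_id (0 : ℝ)).mul (hk.hasDerivAt_snd x 0)
  rw [(hf.hasDerivAt_snd x 0).unique h1]
  ring

/-! ### Formally invariant curves and the homological equation -/

/-- A family of graphs `r = Y (x, u)` over the circle, odd in the parameter `u` and close to
`r = u` near the boundary. -/
structure IsCurveFamily (Y : ℝ × ℝ → ℝ) : Prop where
  contDiff : ContDiff ℝ ∞ Y
  add_one : ∀ x u, Y (x + 1, u) = Y (x, u)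
  odd : ∀ x u, Y (x, -u) = -Y (x, u)
  divPow : DivPow 3 (fun p => Y p - p.2)

theorem IsCurveFamily.zero {Y : ℝ × ℝ → ℝ} (hY : IsCurveFamily Y) (x : ℝ) : Y (x, 0) = 0 := by
  have := hY.odd x 0
  rw [neg_zero] at this
  linarith

theorem IsCurveFamily.divPow_one {Y : ℝ × ℝ → ℝ} (hY : IsCurveFamily Y) : DivPow 1 Y :=
  DivPow.one_of_contDiff hY.contDiff hY.zero

theorem IsCurveFamily.partialSnd_zero {Y : ℝ × ℝ → ℝ} (hY : IsCurveFamily Y) (x : ℝ) :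
    partialSnd Y (x, 0) = 1 := by
  obtain ⟨k, hk, h⟩ := hY.divPow
  have e : (fun u => Y (x, u)) = fun u => u + u ^ 3 * k (x, u) :=
    funext fun u => by linarith [h x u]
  have h1 := hY.contDiff.hasDerivAt_snd x 0
  rw [e] at h1
  have h2 := (hasDerivAt_id' (0 : ℝ)).fun_add
    ((hasDerivAt_pow 3 (0 : ℝ)).fun_mul (hk.hasDerivAt_snd x 0))
  simpa using h1.unique h2

theorem isCurveFamily_snd : IsCurveFamily (fun p => p.2) :=
  ⟨contDiff_snd, fun _ _ => rfl, fun _ _ => rfl, (DivPow.zero 3).congr fun _ _ => sub_self _⟩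

theorem IsCurveFamily.add_monomial {Y : ℝ × ℝ → ℝ} (hY : IsCurveFamily Y) {q : ℝ → ℝ}
    (hq : ContDiff ℝ ∞ q) (hper : Function.Periodic q 1) (n : ℕ) :
    IsCurveFamily (fun p => Y p + q p.1 * p.2 ^ (2 * n + 3)) where
  contDiff := by have := hY.contDiff; fun_prop
  add_one x u := by simp only [hY.add_one, hper x]
  odd x u := by
    rw [hY.odd, Odd.neg_pow ⟨n + 1, by ring⟩]
    ring
  divPow := by
    have h : DivPow 3 (fun p => q p.1 * p.2 ^ (2 * n + 3)) :=
      DivPow.mul_left (by fun_prop) ((DivPow.snd_pow (2 * n + 3)).mono (by omega))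
    exact (hY.divPow.add h).congr fun x u => by ring

namespace ReversibleTwist

variable (T : ReversibleTwist)

/-- The failure of the family of curves `r = Y (x, u)` to be invariant. -/
def defect (Y : ℝ × ℝ → ℝ) (p : ℝ × ℝ) : ℝ :=
  T.g (p.1, Y p) - Y (T.f (p.1, Y p), p.2)

variable {T} {Y Y' : ℝ × ℝ → ℝ} {m : ℕ}

theorem contDiff_defect (hY : ContDiff ℝ ∞ Y) : ContDiff ℝ ∞ (T.defect Y) := by
  have := T.contDiff_f
  have := T.contDiff_g
  unfold defect
  fun_prop

theorem defect_add_one (hY : IsCurveFamily Y) (x u : ℝ) :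
    T.defect Y (x + 1, u) = T.defect Y (x, u) := by
  simp only [defect, hY.add_one, T.g_add_one, T.f_add_one]

/-- Used to pass the defect of the partial sums on to the Borel sum. The difference splits into the
changes of `g`, of the base point at which `Y` is evaluated, and of `Y` itself. -/
theorem divPow_defect_sub (hY : ContDiff ℝ ∞ Y) (hY' : ContDiff ℝ ∞ Y')
    (h : DivPow m (fun p => Y p - Y' p)) :
    DivPow m (fun p => T.defect Y p - T.defect Y' p) := by
  have hf := T.contDiff_f
  have hg := T.contDiff_g
  have h1 : DivPow m (fun p => T.g (p.1, Y p) - T.g (p.1, Y' p)) :=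
    DivPow.comp_sub_comp hg contDiff_fst hY hY' h
  have h2 : DivPow m (fun p => T.f (p.1, Y p) - T.f (p.1, Y' p)) :=
    DivPow.comp_sub_comp hf contDiff_fst hY hY' h
  have h3 : DivPow m (fun p => Y (T.f (p.1, Y p), p.2) - Y (T.f (p.1, Y' p), p.2)) :=
    DivPow.comp_sub_comp_fst hY contDiff_snd (by fun_prop) (by fun_prop) h2
  have h4 : DivPow m (fun p => Y (T.f (p.1, Y' p), p.2) - Y' (T.f (p.1, Y' p), p.2)) :=
    h.comp (a := fun p => T.f (p.1, Y' p)) (b := fun p => p.2) (by fun_prop) DivPow.snd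
  exact ((h1.sub h3).sub h4).congr fun x u => by simp only [defect]; ring

/-- By reversibility the leading order of the defect is even. -/
theorem divPow_defect_succ_of_odd (hY : IsCurveFamily Y) (hm : Odd m)
    (h : DivPow m (T.defect Y)) : DivPow (m + 1) (T.defect Y) := by
  obtain ⟨e, he, h⟩ := h
  refine DivPow.succ he h fun x => ?_
  have hf := T.contDiff_f
  have hg := T.contDiff_g
  have hYs := hY.contDiff
  -- `Ψ ((X, u), a)` measures how far the image of `(X, a)` is from the curve of parameter `-u`. At
  -- `a = Y (X, -u)` it is the defect at `(X, -u)`.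
  set Ψ : (ℝ × ℝ) × ℝ → ℝ :=
    fun z => T.g (z.1.1, z.2) - Y (T.f (z.1.1, z.2), -z.1.2) with hΨ
  obtain ⟨H, hH, hΨH⟩ := exists_dividedDifference (G := Ψ) (by fun_prop)
  simp only [smul_eq_mul] at hΨH
  have hH0 : H ((x, 0), 0, 0) = 1 := by
    refine dividedDifference_self hH.continuous hΨH ?_
    have h1 := hg.hasDerivAt_snd x 0
    have h2 := hYs.hasDerivAt_comp_curve (hf.hasDerivAt_snd x 0) (hasDerivAt_const (0 : ℝ) (0 : ℝ))
    have hYx : partialFst Y (x, 0) = 0 := by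
      have := hYs.hasDerivAt_fst x 0
      simp only [hY.zero] at this
      exact this.unique (hasDerivAt_const x 0)
    rw [T.f_zero, hYx] at h2
    rw [T.partialSnd_g_zero] at h1
    have h3 := h1.fun_sub h2
    simpa [hΨ] using h3
  set x' : ℝ → ℝ := fun u => T.f (x, Y (x, u)) with hx'
  -- The reversed image `(x', -g)` is mapped to `(x, -Y (x, u))`, which lies exactly on the curve of
  -- parameter `-u`, so `Ψ` vanishes there. The two heights compared differ by the defect at `(x,
  -- u)`, hence the defects at `(x', -u)` and `(x, u)` agree up to the factor `H`, which tends to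
  -- `1`.
  have key : ∀ u, T.defect Y (x' u, -u)
      = T.defect Y (x, u) * H ((x' u, u), Y (x' u, -u), Y (x' u, -u) - T.defect Y (x, u)) := by
    intro u
    have h1 := hΨH (x' u, u) (Y (x' u, -u)) (Y (x' u, -u) - T.defect Y (x, u))
    have hW : Y (x' u, -u) - T.defect Y (x, u) = -T.g (x, Y (x, u)) := by
      simp only [defect, hY.odd, hx']; ring
    have h2 : Ψ ((x' u, u), Y (x' u, -u) - T.defect Y (x, u)) = 0 := by
      rw [hW]
      simp only [hΨ, hx', T.rev_f, T.rev_g, hY.odd]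
      ring
    rw [h2] at h1
    simp only [sub_zero, sub_sub_cancel] at h1
    exact h1
  have hDc := (contDiff_defect (T := T) hYs).continuous
  have hfc := hf.continuous
  have hYc := hYs.continuous
  have hec := he.continuous
  have hHc := hH.continuous
  have hx'c : Continuous x' := by fun_prop
  -- Cancelling `u ^ m` with `m` odd and letting `u` tend to `0` gives `-e = e` at `(x, 0)`.
  have hq := DivPow.quotient_unique (m := m) (a := fun u => -e (x' u, -u))
    (b := fun u => e (x, u) *
      H ((x' u, u), Y (x' u, -u), Y (x' u, -u) - T.defect Y (x, u)))
    (by fun_prop) (by fun_prop) (fun u => by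
      have := key u
      rw [h, h x u, hm.neg_pow] at this
      rw [h x u]
      linear_combination this) 0
  have hD0 : T.defect Y (x, 0) = 0 := by
    simp [defect, hY.zero, T.g_zero]
  have hx0 : x' 0 = x := by simp [hx', hY.zero, T.f_zero]
  simp only [neg_zero, hx0, hY.zero, hD0, sub_zero, hH0, mul_one] at hq
  linarith

/-- By exactness the leading coefficient of the defect has mean value zero. -/
theorem integral_leading_defect (hY : IsCurveFamily Y) {e : ℝ × ℝ → ℝ} (he : ContDiff ℝ ∞ e)
    (h : ∀ x u, T.defect Y (x, u) = u ^ m * e (x, u)) : ∫ x in (0 : ℝ)..1, e (x, 0) = 0 := by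
  have hf := T.contDiff_f
  have hg := T.contDiff_g
  have hF := T.contDiff_F
  have hP := T.contDiff_P
  have hYs := hY.contDiff
  set φ : ℝ × ℝ → ℝ := fun p => T.f (p.1, Y p) with hφ
  have hφs : ContDiff ℝ ∞ φ := by fun_prop
  have hφ' := hφs.partialFst
  have hden := T.contDiff_density
  have hL := T.L_pos
  -- The explicit factorization of the difference shows the factor `a + b`, which contributes one
  -- further power of `u` along the curves.
  have hPH : ∀ x a b, T.P (x, a) - T.P (x, b)
      = (a - b) * ((a + b) / (2 * T.L) * T.density (x, a) * T.density (x, b)) := by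
    intro x a b
    have h1 := (T.denom_pos (x, a)).ne'
    have h2 := (T.denom_pos (x, b)).ne'
    simp only [P, density] at *
    rw [div_sub_div _ _ h1 h2]
    trans 2 * T.L * (a ^ 2 - b ^ 2) / ((1 + T.W x * a ^ 2) * (1 + T.W x * b ^ 2))
    · congr 1
      ring
    · generalize 1 + T.W x * a ^ 2 = A at *
      generalize 1 + T.W x * b ^ 2 = B at *
      field_simp
      ring
  obtain ⟨a, ha, hga⟩ := T.divPow_g_one
  obtain ⟨b, hb, hYb⟩ := hY.divPow_one
  simp only [pow_one] at hga hYb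
  have ha0 : ∀ x, a (x, 0) = 1 := fun x => by
    rw [← partialSnd_eq_of_eq_mul hg ha hga, T.partialSnd_g_zero]
  have hb0 : ∀ x, b (x, 0) = 1 := fun x => by
    rw [← partialSnd_eq_of_eq_mul hYs hb hYb, hY.partialSnd_zero]
  set k : ℝ × ℝ → ℝ := fun p => (b p * a (p.1, Y p) + b (φ p, p.2)) / (2 * T.L) *
    T.density (φ p, T.g (p.1, Y p)) * T.density (φ p, Y (φ p, p.2)) with hk'
  have hk : ContDiff ℝ ∞ k := by fun_prop
  have hKk : ∀ x u, T.P (φ (x, u), T.g (x, Y (x, u))) - T.P (φ (x, u), Y (φ (x, u), u))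
      = (T.g (x, Y (x, u)) - Y (φ (x, u), u)) * (u * k (x, u)) := by
    intro x u
    have e1 : T.g (x, Y (x, u)) + Y (φ (x, u), u)
        = u * (b (x, u) * a (x, Y (x, u)) + b (φ (x, u), u)) := by
      rw [hga, hYb (φ (x, u)) u]
      conv_lhs => enter [1, 1]; rw [hYb]
      ring
    rw [hPH, e1]
    simp only [hk']
    ring
  -- Zero net flux: by exactness the image of the curve bounds the same area as the curve, and the
  -- curve reparametrized by `φ`, a lift of a circle map of degree one, bounds that area as well.
  have hflux : ∀ u, ∫ x in (0 : ℝ)..1,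
      (T.P (φ (x, u), T.g (x, Y (x, u))) - T.P (φ (x, u), Y (φ (x, u), u)))
        * partialFst φ (x, u) = 0 := by
    intro u
    have hYu := fun x => hYs.hasDerivAt_fst x u
    have hd : ∀ x, HasDerivAt (fun x => T.F (x, Y (x, u)))
        (T.P (φ (x, u), T.g (x, Y (x, u))) * partialFst φ (x, u) - T.P (x, Y (x, u))) x := by
      intro x
      have h1 := hF.hasDerivAt_comp_curve (hasDerivAt_id' x) (hYu x)
      have h2 := hf.hasDerivAt_comp_curve (hasDerivAt_id' x) (hYu x)
      rw [(hφs.hasDerivAt_fst x u).unique h2]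
      convert! h1 using 1
      rw [← T.exactness_fst, ← T.exactness_snd]
      ring
    have hcY := hYs.continuous
    have hcP := hP.continuous
    have hcg := hg.continuous
    have hcφ := hφs.continuous
    have hcφ' := hφ'.continuous
    have h1 := intervalIntegral.integral_eq_sub_of_hasDerivAt (a := 0) (b := 1)
      (fun x _ => hd x) (Continuous.intervalIntegrable (by fun_prop) 0 1)
    have hend : T.F (1, Y (1, u)) = T.F (0, Y (0, u)) := by
      have e1 := hY.add_one 0 u
      have e2 := T.F_add_one 0 (Y (0, u))
      rw [zero_add] at e1 e2
      rw [e1, e2]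
    rw [hend, sub_self, intervalIntegral.integral_sub
      (Continuous.intervalIntegrable (by fun_prop) 0 1)
      (Continuous.intervalIntegrable (by fun_prop) 0 1)] at h1
    have h2 := intervalIntegral.integral_comp_mul_deriv (a := 0) (b := 1)
      (f := fun x => φ (x, u)) (f' := fun x => partialFst φ (x, u))
      (g := fun x => T.P (x, Y (x, u))) (fun x _ => hφs.hasDerivAt_fst x u)
      (by fun_prop) (by fun_prop)
    have hφ1 : φ (1, u) = φ (0, u) + 1 := by
      have e1 := hY.add_one 0 u
      have e2 := T.f_add_one 0 (Y (0, u))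
      rw [zero_add] at e1 e2
      simp only [hφ, e1, e2]
    have hper : Function.Periodic (fun x => T.P (x, Y (x, u))) 1 := fun x => by
      simp only [hY.add_one, P, T.W_add_one]
    have h3 := hper.intervalIntegral_add_eq (φ (0, u)) 0
    rw [hφ1, h3, zero_add] at h2
    simp only [sub_mul]
    rw [intervalIntegral.integral_sub (Continuous.intervalIntegrable (by fun_prop) 0 1)
      (Continuous.intervalIntegrable (by fun_prop) 0 1)]
    simp only [Function.comp_apply] at h2
    linarith
  have hcke : Continuous fun u : ℝ => ∫ x in (0 : ℝ)..1, e (x, u) * k (x, u) * partialFst φ (x, u) :=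
    intervalIntegral.continuous_parametric_intervalIntegral_of_continuous'
      (f := fun u x => e (x, u) * k (x, u) * partialFst φ (x, u))
      (by have := he.continuous; have := hk.continuous; have := hφ'.continuous; fun_prop) 0 1
  have hq := DivPow.quotient_unique (m := m + 1) hcke (b := fun _ => 0) continuous_const
    (fun u => by
      rw [← intervalIntegral.integral_const_mul, mul_zero]
      refine Eq.trans ?_ (hflux u)
      refine intervalIntegral.integral_congr fun x _ => ?_
      have e1 := h x u
      simp only [defect] at e1
      have e2 : T.g (x, Y (x, u)) - Y (φ (x, u), u) = u ^ m * e (x, u) := e1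
      rw [hKk, e2]
      ring) 0
  -- The limit `4 L` is a nonzero constant, so the vanishing flux becomes the vanishing of the mean
  -- of `e (x, 0)`.
  have hk0 : ∀ x, k (x, 0) = 4 * T.L := fun x => by
    simp only [hk', hY.zero, hφ, T.f_zero, T.g_zero, ha0, hb0, T.density_zero]
    field_simp
    norm_num
  have hφ0 : ∀ x, partialFst φ (x, 0) = 1 := fun x => by
    have h1 := hφs.hasDerivAt_fst x 0
    simp only [hφ, hY.zero, T.f_zero] at h1
    exact h1.unique (hasDerivAt_id' x)
  simp only [hk0, hφ0, mul_one] at hq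
  rw [intervalIntegral.integral_mul_const] at hq
  rcases mul_eq_zero.1 hq with h | h
  · exact h
  · linarith

end ReversibleTwist

namespace ReversibleTwist

variable {T : ReversibleTwist} {Y : ℝ × ℝ → ℝ}

/-- The homological equation: the effect of a correction of the curves on the defect. -/
theorem divPow_defect_add_monomial (hY : IsCurveFamily Y) {q q' : ℝ → ℝ}
    (hq : ContDiff ℝ ∞ q) (hq' : ContDiff ℝ ∞ q') (hqq' : ∀ x, HasDerivAt q (q' x) x)
    (hper : Function.Periodic q 1) (n : ℕ) :
    DivPow (2 * n + 5) (fun p =>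
      T.defect (fun p => Y p + q p.1 * p.2 ^ (2 * n + 3)) p - T.defect Y p
        + T.τ * q' p.1 * p.2 ^ (2 * n + 4)) := by
  have hf := T.contDiff_f
  have hg := T.contDiff_g
  have hYs := hY.contDiff
  set Z : ℝ × ℝ → ℝ := fun p => Y p + q p.1 * p.2 ^ (2 * n + 3) with hZ
  have hZf : IsCurveFamily Z := hY.add_monomial hq hper n
  have hZs := hZf.contDiff
  have hdiff : DivPow (2 * n + 3) (fun p => Z p - Y p) :=
    (DivPow.mul_left (g := fun p => q p.1) (by fun_prop) (DivPow.snd_pow (2 * n + 3))).congr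
      fun x u => by simp [hZ]
  obtain ⟨g₃, hg₃, hgg⟩ := T.divPow_g
  obtain ⟨a, ha, hYa⟩ := hY.divPow
  -- Since `g - r` is divisible by `r ^ 3`, changing the curve at order `2 n + 3` changes `g - r`
  -- two orders later.
  have h1 : DivPow (2 * n + 5) (fun p => (T.g (p.1, Z p) - Z p) - (T.g (p.1, Y p) - Y p)) := by
    have e1 : DivPow (2 * n + 5) (fun p => (Z p - Y p) *
        (Z p * Z p + Z p * Y p + Y p * Y p) * g₃ (p.1, Z p)) :=
      (hdiff.mul (((hZf.divPow_one.mul hZf.divPow_one).add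
        (hZf.divPow_one.mul hY.divPow_one)).add (hY.divPow_one.mul hY.divPow_one))).mul_right
        (by fun_prop)
    have e2 : DivPow (2 * n + 3) (fun p => g₃ (p.1, Z p) - g₃ (p.1, Y p)) :=
      DivPow.comp_sub_comp hg₃ contDiff_fst hZs hYs hdiff
    have e3 := ((hY.divPow_one.mul (hY.divPow_one.mul hY.divPow_one)).mul e2).mono
      (m := 2 * n + 5) (by omega)
    refine (e1.add e3).congr fun x u => ?_
    have r1 := hgg x (Z (x, u))
    have r2 := hgg x (Y (x, u))
    beta_reduce at r1 r2
    linear_combination r1 - r2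
  -- As `Y = u + u ^ 3 a`, a shift of the base point of order `2 n + 3` changes `Y` only at order `2
  -- n + 6`.
  have h2 : DivPow (2 * n + 5) (fun p =>
      (Y (T.f (p.1, Z p), p.2) - Y (T.f (p.1, Y p), p.2))) := by
    have e1 : DivPow (2 * n + 3) (fun p => T.f (p.1, Z p) - T.f (p.1, Y p)) :=
      DivPow.comp_sub_comp hf contDiff_fst hZs hYs hdiff
    have e2 : DivPow (2 * n + 3) (fun p => a (T.f (p.1, Z p), p.2) - a (T.f (p.1, Y p), p.2)) :=
      DivPow.comp_sub_comp_fst ha contDiff_snd (by fun_prop) (by fun_prop) e1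
    have e3 := ((DivPow.snd_pow 3).mul e2).mono (m := 2 * n + 5) (by omega)
    refine e3.congr fun x u => ?_
    have r1 := hYa (T.f (x, Z (x, u))) u
    have r2 := hYa (T.f (x, Y (x, u))) u
    linear_combination r1 - r2
  -- The main term: the map moves the base point by `τ u` to first order, so `q` changes by `τ q'
  -- u`.
  have h3 : DivPow (2 * n + 5) (fun p =>
      p.2 ^ (2 * n + 3) * (q (T.f (p.1, Z p)) - q p.1 - T.τ * q' p.1 * p.2)) := by
    refine (DivPow.snd_pow (2 * n + 3)).mul (n := 2) ?_
    refine DivPow.two_of_contDiff (by fun_prop)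
      (fun x => by simp [hZf.zero, T.f_zero]) fun x => ?_
    have r1 := hf.hasDerivAt_comp_curve (hasDerivAt_const (0 : ℝ) x) (hZs.hasDerivAt_snd x 0)
    have r2 : HasDerivAt q (q' x) (T.f (x, Z (x, 0))) := by
      rw [hZf.zero, T.f_zero]; exact hqq' x
    have r3 := (((r2.comp 0 r1).sub_const (q x)).fun_sub
      ((hasDerivAt_id' (0 : ℝ)).const_mul (T.τ * q' x)))
    simp only [hZf.zero, T.twist, hZf.partialSnd_zero] at r3
    convert! r3 using 1
    ring
  refine ((h1.sub h2).sub h3).congr fun x u => ?_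
  simp only [defect, hZ]
  ring

/-- Reversibility raises the order of the defect to `2 n + 4`. The leading coefficient there has
mean zero by exactness, so its primitive divided by `τ` is periodic and solves the homological
equation. -/
theorem exists_improved_curveFamily (hY : IsCurveFamily Y) {n : ℕ}
    (h : DivPow (2 * n + 3) (T.defect Y)) :
    ∃ q : ℝ → ℝ, ContDiff ℝ ∞ q ∧ Function.Periodic q 1 ∧
      DivPow (2 * n + 5) (T.defect (fun p => Y p + q p.1 * p.2 ^ (2 * n + 3))) := by
  obtain ⟨e, he, h⟩ := divPow_defect_succ_of_odd hY ⟨n + 1, by ring⟩ h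
  have hec := he.continuous
  have hmean := integral_leading_defect hY he h
  have heper : Function.Periodic (fun x => e (x, 0)) 1 := fun x =>
    DivPow.quotient_unique (m := 2 * n + 3 + 1) (a := fun u => e (x + 1, u))
      (b := fun u => e (x, u)) (by fun_prop) (by fun_prop)
      (fun u => by rw [← h, ← h, defect_add_one hY]) 0
  have hτ := T.τ_pos.ne'
  set q : ℝ → ℝ := fun x => T.τ⁻¹ * ∫ σ in (0 : ℝ)..x, e (σ, 0) with hq
  have hqs : ContDiff ℝ ∞ q := by
    have := contDiff_integral_fst (f := fun p => e (p.1, 0)) (by fun_prop)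
    have h2 : ContDiff ℝ ∞ fun x : ℝ => ∫ σ in (0 : ℝ)..x, e (σ, 0) :=
      this.comp (f := fun x : ℝ => (x, (0 : ℝ))) (by fun_prop)
    fun_prop
  have hqd : ∀ x, HasDerivAt q (T.τ⁻¹ * e (x, 0)) x := fun x => by
    have hc : Continuous fun σ => e (σ, 0) := by fun_prop
    exact (intervalIntegral.integral_hasDerivAt_right (hc.intervalIntegrable 0 x)
      hc.aestronglyMeasurable.stronglyMeasurableAtFilter hc.continuousAt).const_mul _
  have hqper : Function.Periodic q 1 := fun x => by
    have hc : Continuous fun σ => e (σ, 0) := by fun_prop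
    have h1 := intervalIntegral.integral_add_adjacent_intervals (hc.intervalIntegrable 0 x)
      (hc.intervalIntegrable x (x + 1)) (μ := MeasureTheory.volume)
    have h2 := heper.intervalIntegral_add_eq x 0
    rw [zero_add, hmean] at h2
    simp only [hq]
    rw [← h1, h2, add_zero]
  refine ⟨q, hqs, hqper, ?_⟩
  have h1 := divPow_defect_add_monomial (T := T) hY hqs (q' := fun x => T.τ⁻¹ * e (x, 0))
    (by fun_prop) hqd hqper n
  have h2 : DivPow (2 * n + 5) (fun p => p.2 ^ (2 * n + 4) * (e p - e (p.1, 0))) :=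
    (DivPow.snd_pow (2 * n + 4)).mul
      (DivPow.one_of_contDiff (f := fun p => e p - e (p.1, 0)) (by fun_prop) (by simp))
  refine (h1.add h2).congr fun x u => ?_
  rw [h x u]
  field_simp
  ring

theorem isFlat_iff_odd {f : ℝ × ℝ → ℝ} : IsFlat f ↔ ∀ n, DivPow (2 * n + 3) f :=
  ⟨fun h n => h _, fun h n => (h n).mono (by omega)⟩

/-- A family of curves that is invariant to all orders at the boundary. -/
theorem exists_flat_curveFamily (T : ReversibleTwist) :
    ∃ Y, IsCurveFamily Y ∧ (∀ p, 1 / 2 ≤ partialSnd Y p) ∧ IsFlat (T.defect Y) := by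
  let Good : ℕ → (ℝ × ℝ → ℝ) → Prop := fun n Y =>
    IsCurveFamily Y ∧ DivPow (2 * n + 3) (T.defect Y)
  have h0 : Good 0 (fun p => p.2) := by
    refine ⟨isCurveFamily_snd, T.divPow_g.congr fun x u => rfl⟩
  have hstep : ∀ n (Y : {Y // Good n Y}), ∃ q : ℝ → ℝ, ContDiff ℝ ∞ q ∧ Function.Periodic q 1 ∧
      Good (n + 1) (fun p => Y.1 p + q p.1 * p.2 ^ (2 * n + 3)) := fun n Y => by
    obtain ⟨q, hq, hper, h⟩ := exists_improved_curveFamily Y.2.1 Y.2.2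
    exact ⟨q, hq, hper, Y.2.1.add_monomial hq hper n, h⟩
  choose Q hQ hQper hQgood using hstep
  let s : ∀ n, {Y // Good n Y} := fun n =>
    Nat.rec ⟨_, h0⟩ (fun n Y => ⟨_, hQgood n Y⟩) n
  have hs : ∀ N p, (s N).1 p = p.2 + ∑ n ∈ Finset.range N, Q n (s n) p.1 * p.2 ^ (2 * n + 3) := by
    intro N p
    induction N with
    | zero => simp [s]
    | succ N ih =>
      rw [Finset.sum_range_succ, ← add_assoc, ← ih]
  -- The correction added at step `n` never changes afterwards, so the corrections form one formal
  -- series in `u`, which is realized by the smooth function `b`.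
  obtain ⟨b, hb, hbper, hbodd, hbd, hbN⟩ := exists_borel_sum (q := fun n => Q n (s n))
    (fun n => hQ n _) (fun n => hQper n _)
  have hYc : IsCurveFamily (fun p => p.2 + b p) :=
    ⟨by fun_prop, fun x u => by simp only [hbper], fun x u => by simp only [hbodd]; ring,
      (hbN 0).congr fun x u => by simp⟩
  refine ⟨fun p => p.2 + b p, hYc, fun ⟨x, u⟩ => ?_, ?_⟩
  · have h1 := (hasDerivAt_id' u).fun_add (hb.hasDerivAt_snd x u)
    rw [(hYc.contDiff.hasDerivAt_snd x u).unique h1]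
    have := (abs_le.1 (hbd (x, u))).1
    linarith
  · refine isFlat_iff_odd.2 fun N => ?_
    have h1 : DivPow (2 * N + 3) (fun p => (p.2 + b p) - (s N).1 p) :=
      (hbN N).congr fun x u => by rw [hs]; ring
    exact ((divPow_defect_sub hYc.contDiff (s N).2.1.contDiff h1).add (s N).2.2).congr
      fun x u => by ring

end ReversibleTwist

/-! ### Area and area density along the curves -/

/-- A smooth family of increasing bijections of the line has a smooth family of inverses. -/
theorem exists_fiberwise_inverse {g : ℝ × ℝ → ℝ} (hg : ContDiff ℝ ∞ g)
    (hpos : ∀ p, 0 < partialSnd g p) (hsurj : ∀ x, Function.Surjective fun t => g (x, t)) :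
    ∃ j : ℝ × ℝ → ℝ, ContDiff ℝ ∞ j ∧ (∀ x v, g (x, j (x, v)) = v) ∧
      ∀ x t, j (x, g (x, t)) = t := by
  have hmono : ∀ x, StrictMono fun t => g (x, t) := fun x =>
    strictMono_of_hasDerivAt_pos (hg.hasDerivAt_snd x) fun t => hpos _
  choose j hj using hsurj
  have hjj : ∀ x v, g (x, j x v) = v := hj
  refine ⟨fun p => j p.1 p.2, ?_, hjj, fun x t => (hmono x).injective (hjj _ _)⟩
  rw [← contDiffOn_univ] at hg ⊢
  refine contDiffOn_fiberwise_inverse isOpen_univ isOpen_univ hg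
    (fun s t t' _ _ h => (hmono s).injective h) (fun s v _ => ⟨mem_univ _, hjj s v⟩)
    fun s t _ => ?_
  rw [((contDiffOn_univ.1 hg).hasDerivAt_snd s t).deriv]
  exact (hpos _).ne'

/-- A family of curves that is invariant to all orders and foliates the half plane. -/
structure InvariantFamily (T : ReversibleTwist) where
  Y : ℝ × ℝ → ℝ
  isCurveFamily : IsCurveFamily Y
  half_le : ∀ p, 1 / 2 ≤ partialSnd Y p
  isFlat_defect : IsFlat (T.defect Y)

namespace InvariantFamily

variable {T : ReversibleTwist} (Y : InvariantFamily T)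

theorem contDiff_Y : ContDiff ℝ ∞ Y.Y := Y.isCurveFamily.contDiff

theorem partialSnd_pos (p : ℝ × ℝ) : 0 < partialSnd Y.Y p := by
  linarith [Y.half_le p]

theorem partialSnd_add_one (x u : ℝ) : partialSnd Y.Y (x + 1, u) = partialSnd Y.Y (x, u) := by
  have h := Y.contDiff_Y.hasDerivAt_snd (x + 1) u
  simp only [Y.isCurveFamily.add_one] at h
  exact h.unique (Y.contDiff_Y.hasDerivAt_snd x u)

theorem partialSnd_even (x u : ℝ) : partialSnd Y.Y (x, -u) = partialSnd Y.Y (x, u) := by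
  have h := (Y.contDiff_Y.hasDerivAt_snd x (-u)).comp u (hasDerivAt_neg u)
  have e : ((fun u => Y.Y (x, u)) ∘ Neg.neg) = fun u => -Y.Y (x, u) :=
    funext fun u => Y.isCurveFamily.odd x u
  rw [e] at h
  have := h.unique (Y.contDiff_Y.hasDerivAt_snd x u).fun_neg
  linarith

/-- The quotient of `Y.Y` by the parameter. -/
noncomputable def quot (p : ℝ × ℝ) : ℝ := ∫ θ in (0 : ℝ)..1, partialSnd Y.Y (p.1, p.2 * θ)

theorem contDiff_quot : ContDiff ℝ ∞ Y.quot := by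
  have := Y.contDiff_Y.partialSnd
  exact contDiff_integral_unitInterval
    (f := fun z : (ℝ × ℝ) × ℝ => partialSnd Y.Y (z.1.1, z.1.2 * z.2)) (by fun_prop)

theorem Y_eq (x u : ℝ) : Y.Y (x, u) = u * Y.quot (x, u) := by
  have hc := Y.contDiff_Y.partialSnd.continuous
  have h := intervalIntegral.integral_eq_sub_of_hasDerivAt (a := 0) (b := 1)
    (f := fun θ : ℝ => Y.Y (x, u * θ)) (f' := fun θ => u * partialSnd Y.Y (x, u * θ))
    (fun θ _ => by
      have h1 : HasDerivAt (fun θ : ℝ => u * θ) u θ := by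
        simpa using (hasDerivAt_id θ).const_mul u
      rw [mul_comm]
      exact (Y.contDiff_Y.hasDerivAt_snd x (u * θ)).comp θ h1)
    (Continuous.intervalIntegrable (by fun_prop) 0 1)
  rw [intervalIntegral.integral_const_mul] at h
  simp only [mul_one, mul_zero, Y.isCurveFamily.zero, sub_zero] at h
  exact h.symm

theorem quot_pos (p : ℝ × ℝ) : 0 < Y.quot p := by
  have hc := Y.contDiff_Y.partialSnd.continuous
  exact intervalIntegral.intervalIntegral_pos_of_pos
    (Continuous.intervalIntegrable (by fun_prop) 0 1) (fun θ => Y.partialSnd_pos _) one_pos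

theorem quot_add_one (x u : ℝ) : Y.quot (x + 1, u) = Y.quot (x, u) := by
  simp only [quot, Y.partialSnd_add_one]

theorem quot_even (x u : ℝ) : Y.quot (x, -u) = Y.quot (x, u) := by
  simp only [quot, neg_mul, Y.partialSnd_even]

theorem quot_zero (x : ℝ) : Y.quot (x, 0) = 1 := by
  rw [← partialSnd_eq_of_eq_mul Y.contDiff_Y Y.contDiff_quot Y.Y_eq, Y.isCurveFamily.partialSnd_zero]

/-- The coefficient of the primitive of the area form along the curves. -/
noncomputable def p (z : ℝ × ℝ) : ℝ := T.P (z.1, Y.Y z)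

/-- The derivative of `Y.p` in the parameter, divided by the parameter. -/
noncomputable def pHat (z : ℝ × ℝ) : ℝ :=
  4 * T.L * Y.quot z * partialSnd Y.Y z / (1 + T.W z.1 * Y.Y z ^ 2) ^ 2

theorem contDiff_p : ContDiff ℝ ∞ Y.p := by
  have := T.contDiff_P
  have := Y.contDiff_Y
  unfold p
  fun_prop

theorem contDiff_pHat : ContDiff ℝ ∞ Y.pHat := by
  have := T.contDiff_W
  have := Y.contDiff_Y
  have := Y.contDiff_quot
  have := Y.contDiff_Y.partialSnd
  refine ContDiff.div (by fun_prop) (by fun_prop) fun z => ?_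
  exact pow_ne_zero 2 (T.denom_pos (z.1, Y.Y z)).ne'

theorem pHat_pos (z : ℝ × ℝ) : 0 < Y.pHat z := by
  have h1 := T.denom_pos (z.1, Y.Y z)
  have h2 := T.L_pos
  have h3 := Y.quot_pos z
  have h4 := Y.partialSnd_pos z
  simp only at h1
  unfold pHat
  positivity

theorem p_add_one (x u : ℝ) : Y.p (x + 1, u) = Y.p (x, u) := by
  simp only [p, ReversibleTwist.P, Y.isCurveFamily.add_one, T.W_add_one]

theorem pHat_add_one (x u : ℝ) : Y.pHat (x + 1, u) = Y.pHat (x, u) := by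
  simp only [pHat, Y.isCurveFamily.add_one, T.W_add_one, Y.quot_add_one, Y.partialSnd_add_one]

theorem pHat_even (x u : ℝ) : Y.pHat (x, -u) = Y.pHat (x, u) := by
  simp only [pHat, Y.isCurveFamily.odd, even_two.neg_pow, Y.quot_even, Y.partialSnd_even]

theorem pHat_zero (x : ℝ) : Y.pHat (x, 0) = 4 * T.L := by
  simp [pHat, Y.quot_zero, Y.isCurveFamily.zero, Y.isCurveFamily.partialSnd_zero]

theorem hasDerivAt_p (x u : ℝ) : HasDerivAt (fun u => Y.p (x, u)) (u * Y.pHat (x, u)) u := by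
  have h0 := Y.contDiff_Y.hasDerivAt_snd x u
  have hd := T.denom_pos (x, Y.Y (x, u))
  simp only at hd
  have h1 := ((h0.fun_pow 2).const_mul (2 * T.L)).fun_div
    (((h0.fun_pow 2).const_mul (T.W x)).const_add 1) hd.ne'
  convert! h1 using 1
  rw [pHat]
  conv_rhs => rw [Y.Y_eq]
  conv_lhs => rw [Y.Y_eq]
  rw [Y.Y_eq] at hd
  have := hd.ne'
  field_simp
  ring

/-- The mean of `Y.pHat` over the circle. -/
noncomputable def μ (u : ℝ) : ℝ := ∫ x in (0 : ℝ)..1, Y.pHat (x, u)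

/-- The area below a curve of the family. -/
noncomputable def M (u : ℝ) : ℝ := ∫ x in (0 : ℝ)..1, Y.p (x, u)

/-- The quotient of `Y.M` by the square of the parameter. -/
noncomputable def MHat (u : ℝ) : ℝ :=
  ∫ x in (0 : ℝ)..1, Y.quot (x, u) ^ 2 * T.density (x, Y.Y (x, u))

theorem contDiff_μ : ContDiff ℝ ∞ Y.μ := by
  have := Y.contDiff_pHat
  exact contDiff_integral_unitInterval (f := fun z : ℝ × ℝ => Y.pHat (z.2, z.1)) (by fun_prop)

theorem contDiff_M : ContDiff ℝ ∞ Y.M := by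
  have := Y.contDiff_p
  exact contDiff_integral_unitInterval (f := fun z : ℝ × ℝ => Y.p (z.2, z.1)) (by fun_prop)

theorem contDiff_MHat : ContDiff ℝ ∞ Y.MHat := by
  have := Y.contDiff_quot
  have := Y.contDiff_Y
  have := T.contDiff_density
  exact contDiff_integral_unitInterval
    (f := fun z : ℝ × ℝ => Y.quot (z.2, z.1) ^ 2 * T.density (z.2, Y.Y (z.2, z.1))) (by fun_prop)

theorem μ_pos (u : ℝ) : 0 < Y.μ u := by
  have hc := Y.contDiff_pHat.continuous
  exact intervalIntegral.intervalIntegral_pos_of_pos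
    (Continuous.intervalIntegrable (by fun_prop) 0 1) (fun θ => Y.pHat_pos _) one_pos

theorem μ_zero : Y.μ 0 = 4 * T.L := by simp [μ, Y.pHat_zero]

theorem MHat_pos (u : ℝ) : 0 < Y.MHat u := by
  have h1 := Y.contDiff_quot.continuous
  have h2 := Y.contDiff_Y.continuous
  have h3 := T.contDiff_density.continuous
  refine intervalIntegral.intervalIntegral_pos_of_pos
    (Continuous.intervalIntegrable (by fun_prop) 0 1) (fun θ => ?_) one_pos
  have := Y.quot_pos (θ, u)
  have := T.density_pos (θ, Y.Y (θ, u))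
  positivity

theorem MHat_zero : Y.MHat 0 = 2 * T.L := by
  simp [MHat, Y.quot_zero, Y.isCurveFamily.zero, T.density_zero]

theorem MHat_even (u : ℝ) : Y.MHat (-u) = Y.MHat u := by
  simp only [MHat, Y.quot_even, Y.isCurveFamily.odd, ReversibleTwist.density, even_two.neg_pow]

theorem μ_even (u : ℝ) : Y.μ (-u) = Y.μ u := by simp only [μ, Y.pHat_even]

theorem M_eq (u : ℝ) : Y.M u = u ^ 2 * Y.MHat u := by
  rw [M, MHat, ← intervalIntegral.integral_const_mul]
  refine intervalIntegral.integral_congr fun x _ => ?_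
  simp only [p, T.P_eq]
  conv_lhs => enter [1]; rw [Y.Y_eq]
  ring

theorem hasDerivAt_integral_p (x u : ℝ) :
    HasDerivAt (fun u => ∫ σ in (0 : ℝ)..x, Y.p (σ, u))
      (u * ∫ σ in (0 : ℝ)..x, Y.pHat (σ, u)) u := by
  have hp := Y.contDiff_p
  have hpc := hp.continuous
  have hq := Y.contDiff_pHat.continuous
  rw [← intervalIntegral.integral_const_mul]
  obtain ⟨C, hC⟩ := (isCompact_uIcc (a := 0) (b := x) |>.prod
    (isCompact_closedBall u 1)).exists_bound_of_continuousOn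
    (f := fun z : ℝ × ℝ => z.2 * Y.pHat z) (by fun_prop)
  refine (intervalIntegral.hasDerivAt_integral_of_dominated_loc_of_deriv_le
    (F := fun u σ => Y.p (σ, u)) (F' := fun u σ => u * Y.pHat (σ, u)) (bound := fun _ => C)
    (Metric.closedBall_mem_nhds u one_pos) ?_ ?_ ?_ ?_ ?_ ?_).2
  · exact Eventually.of_forall fun v => Continuous.aestronglyMeasurable (by fun_prop)
  · exact Continuous.intervalIntegrable (by fun_prop) 0 x
  · exact Continuous.aestronglyMeasurable (by fun_prop)
  · exact Eventually.of_forall fun σ hσ v hv => hC (σ, v) ⟨uIoc_subset_uIcc hσ, hv⟩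
  · exact intervalIntegrable_const
  · exact Eventually.of_forall fun σ _ v _ => Y.hasDerivAt_p σ v

theorem hasDerivAt_M (u : ℝ) : HasDerivAt Y.M (u * Y.μ u) u := Y.hasDerivAt_integral_p 1 u

end InvariantFamily

theorem IsFlat.add {f g : ℝ × ℝ → ℝ} (hf : IsFlat f) (hg : IsFlat g) :
    IsFlat (fun p => f p + g p) := fun m => (hf m).add (hg m)

theorem IsFlat.sub {f g : ℝ × ℝ → ℝ} (hf : IsFlat f) (hg : IsFlat g) :
    IsFlat (fun p => f p - g p) := fun m => (hf m).sub (hg m)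

theorem IsFlat.neg {f : ℝ × ℝ → ℝ} (hf : IsFlat f) : IsFlat (fun p => -f p) :=
  fun m => (hf m).neg

theorem IsFlat.mul_right {f g : ℝ × ℝ → ℝ} (hf : IsFlat f) (hg : ContDiff ℝ ∞ g) :
    IsFlat (fun p => f p * g p) := fun m => (hf m).mul_right hg

theorem IsFlat.congr {f g : ℝ × ℝ → ℝ} (hf : IsFlat f) (h : ∀ x u, g (x, u) = f (x, u)) :
    IsFlat g := fun m => (hf m).congr h

theorem IsFlat.partialSnd {f : ℝ × ℝ → ℝ} (hf : IsFlat f) : IsFlat (partialSnd f) :=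
  fun m => (hf (m + 1)).partialSnd

theorem IsFlat.integral_fst {f : ℝ × ℝ → ℝ} (hf : IsFlat f) :
    IsFlat (fun p => ∫ σ in (0 : ℝ)..p.1, f (σ, p.2)) := fun m => (hf m).integral_fst

theorem IsFlat.comp {f a b : ℝ × ℝ → ℝ} (hf : IsFlat f) (ha : ContDiff ℝ ∞ a)
    (hb : DivPow 1 b) : IsFlat (fun p => f (a p, b p)) := fun m => (hf m).comp ha hb

theorem IsFlat.comp_sub_comp {F a b c : ℝ × ℝ → ℝ} (hF : ContDiff ℝ ∞ F)
    (hc : ContDiff ℝ ∞ c) (ha : ContDiff ℝ ∞ a) (hb : ContDiff ℝ ∞ b)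
    (h : IsFlat (fun p => a p - b p)) : IsFlat (fun p => F (c p, a p) - F (c p, b p)) :=
  fun m => DivPow.comp_sub_comp hF hc ha hb (h m)

theorem IsFlat.of_mul_snd {f : ℝ × ℝ → ℝ} (hf : ContDiff ℝ ∞ f)
    (h : IsFlat (fun p => p.2 * f p)) : IsFlat f := by
  intro m
  obtain ⟨g, hg, h⟩ := h (m + 1)
  have hc := hf.continuous
  have hgc := hg.continuous
  refine ⟨g, hg, fun x => ?_⟩
  exact DivPow.quotient_unique (m := 1) (a := fun u => f (x, u)) (b := fun u => u ^ m * g (x, u))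
    (by fun_prop) (by fun_prop) fun u => by
      have := h x u
      simp only at this
      rw [pow_one, this]; ring

/-! ### The angle coordinate and the map in coordinates adapted to the curves -/

namespace InvariantFamily

variable {T : ReversibleTwist} (Y : InvariantFamily T)

/-- The angle coordinate of the family of curves. -/
noncomputable def angle (z : ℝ × ℝ) : ℝ := (∫ σ in (0 : ℝ)..z.1, Y.pHat (σ, z.2)) / Y.μ z.2

theorem contDiff_angle : ContDiff ℝ ∞ Y.angle := by
  have := contDiff_integral_fst Y.contDiff_pHat
  have := Y.contDiff_μ
  exact ContDiff.div (by fun_prop) (by fun_prop) fun z => (Y.μ_pos _).ne'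

theorem angle_add_one (x u : ℝ) : Y.angle (x + 1, u) = Y.angle (x, u) + 1 := by
  have hc := Y.contDiff_pHat.continuous
  have h1 := intervalIntegral.integral_add_adjacent_intervals (μ := MeasureTheory.volume)
    (Continuous.intervalIntegrable (by fun_prop : Continuous fun σ => Y.pHat (σ, u)) 0 x)
    (Continuous.intervalIntegrable (by fun_prop : Continuous fun σ => Y.pHat (σ, u)) x (x + 1))
  have hper : Function.Periodic (fun σ => Y.pHat (σ, u)) 1 := fun σ => Y.pHat_add_one σ u
  have h2 := hper.intervalIntegral_add_eq x 0
  rw [zero_add] at h2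
  have := (Y.μ_pos u).ne'
  simp only [angle]
  rw [← h1, h2, add_div]
  congr 1
  exact div_self this

theorem angle_even (x u : ℝ) : Y.angle (x, -u) = Y.angle (x, u) := by
  simp only [angle, Y.pHat_even, Y.μ_even]

theorem angle_at_zero (x : ℝ) : Y.angle (x, 0) = x := by
  have := T.L_pos.ne'
  simp [angle, Y.pHat_zero, Y.μ_zero]
  field_simp

theorem angle_zero (u : ℝ) : Y.angle (0, u) = 0 := by simp [angle]

theorem partialFst_angle_pos (z : ℝ × ℝ) : 0 < partialFst Y.angle z := by
  have hc := Y.contDiff_pHat.continuous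
  have h1 : HasDerivAt (fun x => Y.angle (x, z.2)) (Y.pHat z / Y.μ z.2) z.1 := by
    have hc' : Continuous fun σ => Y.pHat (σ, z.2) := by fun_prop
    have := (intervalIntegral.integral_hasDerivAt_right (hc'.intervalIntegrable 0 z.1)
      hc'.aestronglyMeasurable.stronglyMeasurableAtFilter hc'.continuousAt).div_const (Y.μ z.2)
    exact this
  rw [(Y.contDiff_angle.hasDerivAt_fst z.1 z.2).unique h1]
  exact div_pos (Y.pHat_pos _) (Y.μ_pos _)

theorem exists_angle_inverse : ∃ k : ℝ × ℝ → ℝ, ContDiff ℝ ∞ k ∧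
    (∀ x u, Y.angle (k (x, u), u) = x) ∧ ∀ x u, k (Y.angle (x, u), u) = x := by
  have hs := Y.contDiff_angle
  obtain ⟨j, hj, h1, h2⟩ := exists_fiberwise_inverse (g := fun z => Y.angle (z.2, z.1))
    (by fun_prop) (fun z => by
      have h1 : HasDerivAt (fun t => Y.angle (t, z.1)) (partialFst Y.angle (z.2, z.1)) z.2 :=
        hs.hasDerivAt_fst z.2 z.1
      have h2 : ContDiff ℝ ∞ (fun z : ℝ × ℝ => Y.angle (z.2, z.1)) := by fun_prop
      rw [(h2.hasDerivAt_snd z.1 z.2).unique h1]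
      exact Y.partialFst_angle_pos _) (fun u => by
      -- The angle fixes the integers, so the intermediate value theorem between consecutive
      -- integers gives surjectivity.
      have hn : ∀ n : ℤ, Y.angle (n, u) = n := by
        have hper : Function.Periodic (fun x => Y.angle (x, u) - x) 1 := fun x => by
          simp only [Y.angle_add_one]; ring
        intro n
        have := hper.int_mul n 0
        simp only [zero_add, mul_one, Y.angle_zero, sub_zero] at this
        linarith
      intro v
      have hc : Continuous fun x => Y.angle (x, u) := by have := hs.continuous; fun_prop
      obtain ⟨x, -, hx⟩ := intermediate_value_Icc (a := (⌊v⌋ : ℝ)) (b := ((⌊v⌋ + 1 : ℤ) : ℝ))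
        (by push_cast; linarith) hc.continuousOn (show v ∈ Icc _ _ by
          rw [hn, hn]
          exact ⟨Int.floor_le v, by push_cast; exact (Int.lt_floor_add_one v).le⟩)
      exact ⟨x, hx⟩)
  exact ⟨fun z => j (z.2, z.1), by fun_prop, fun x u => h1 u x, fun x u => h2 u x⟩

/-- Because the derivative in `u` is at least `1 / 2`, one has `u / 2 ≤ Y` for `u ≥ 0`. With oddness
every point of the plane lies on exactly one curve. -/
theorem exists_Y_inverse : ∃ U : ℝ × ℝ → ℝ, ContDiff ℝ ∞ U ∧
    (∀ x v, Y.Y (x, U (x, v)) = v) ∧ ∀ x u, U (x, Y.Y (x, u)) = u := by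
  refine exists_fiberwise_inverse Y.contDiff_Y Y.partialSnd_pos fun x v => ?_
  have hY := Y.contDiff_Y
  have hc : Continuous fun u => Y.Y (x, u) := by have := hY.continuous; fun_prop
  have hb : ∀ u, 0 ≤ u → u / 2 ≤ Y.Y (x, u) := fun u hu => by
    have hm : MonotoneOn (fun u => Y.Y (x, u) - u / 2) (Ici 0) := by
      have hd : ∀ u, HasDerivAt (fun u => Y.Y (x, u) - u / 2) (partialSnd Y.Y (x, u) - 1 / 2) u :=
        fun u => (hY.hasDerivAt_snd x u).fun_sub ((hasDerivAt_id' u).div_const 2)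
      refine (monotone_of_deriv_nonneg (fun u => (hd u).differentiableAt) fun u => ?_).monotoneOn _
      rw [(hd u).deriv]
      linarith [Y.half_le (x, u)]
    have := hm self_mem_Ici hu hu
    simp only [Y.isCurveFamily.zero] at this
    linarith
  have h1 := hb (2 * |v|) (by positivity)
  obtain ⟨u, -, hu⟩ := intermediate_value_Icc (a := -(2 * |v|)) (b := 2 * |v|)
    (by linarith [abs_nonneg v]) hc.continuousOn (show v ∈ Icc _ _ by
      simp only [Y.isCurveFamily.odd]
      constructor <;> linarith [le_abs_self v, neg_abs_le v])
  exact ⟨u, hu⟩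

/-- The inverse of the angle coordinate on each curve. -/
noncomputable def angleInv : ℝ × ℝ → ℝ := Y.exists_angle_inverse.choose

theorem contDiff_angleInv : ContDiff ℝ ∞ Y.angleInv := Y.exists_angle_inverse.choose_spec.1

theorem angle_angleInv (x u : ℝ) : Y.angle (Y.angleInv (x, u), u) = x :=
  Y.exists_angle_inverse.choose_spec.2.1 x u

theorem angleInv_angle (x u : ℝ) : Y.angleInv (Y.angle (x, u), u) = x :=
  Y.exists_angle_inverse.choose_spec.2.2 x u

theorem angleInv_add_one (x u : ℝ) : Y.angleInv (x + 1, u) = Y.angleInv (x, u) + 1 := by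
  conv_lhs => rw [← Y.angle_angleInv x u, ← Y.angle_add_one]
  rw [Y.angleInv_angle]

theorem angleInv_even (x u : ℝ) : Y.angleInv (x, -u) = Y.angleInv (x, u) := by
  conv_lhs => rw [← Y.angle_angleInv x u, ← Y.angle_even]
  rw [Y.angleInv_angle]

/-- The parameter of the curve through a point. -/
noncomputable def param : ℝ × ℝ → ℝ := Y.exists_Y_inverse.choose

theorem contDiff_param : ContDiff ℝ ∞ Y.param := Y.exists_Y_inverse.choose_spec.1

theorem Y_param (x v : ℝ) : Y.Y (x, Y.param (x, v)) = v := Y.exists_Y_inverse.choose_spec.2.1 x v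

theorem param_Y (x u : ℝ) : Y.param (x, Y.Y (x, u)) = u := Y.exists_Y_inverse.choose_spec.2.2 x u

theorem param_add_one (x v : ℝ) : Y.param (x + 1, v) = Y.param (x, v) := by
  conv_lhs => rw [← Y.Y_param x v, ← Y.isCurveFamily.add_one]
  rw [Y.param_Y]

theorem param_odd (x v : ℝ) : Y.param (x, -v) = -Y.param (x, v) := by
  conv_lhs => rw [← Y.Y_param x v, ← Y.isCurveFamily.odd]
  rw [Y.param_Y]

/-- The generating function of the change to the angle coordinate. -/
noncomputable def G (z : ℝ × ℝ) : ℝ :=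
  (∫ σ in (0 : ℝ)..z.1, Y.p (σ, z.2)) - Y.M z.2 * Y.angle z

theorem contDiff_G : ContDiff ℝ ∞ Y.G := by
  have := contDiff_integral_fst Y.contDiff_p
  have := Y.contDiff_M
  have := Y.contDiff_angle
  unfold G
  fun_prop

theorem G_add_one (x u : ℝ) : Y.G (x + 1, u) = Y.G (x, u) := by
  have hc := Y.contDiff_p.continuous
  have h1 := intervalIntegral.integral_add_adjacent_intervals (μ := MeasureTheory.volume)
    (Continuous.intervalIntegrable (by fun_prop : Continuous fun σ => Y.p (σ, u)) 0 x)
    (Continuous.intervalIntegrable (by fun_prop : Continuous fun σ => Y.p (σ, u)) x (x + 1))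
  have hper : Function.Periodic (fun σ => Y.p (σ, u)) 1 := fun σ => Y.p_add_one σ u
  have h2 := hper.intervalIntegral_add_eq x 0
  rw [zero_add] at h2
  simp only [G, Y.angle_add_one]
  rw [← h1, h2, M]
  ring

/-- In the direction of `u` the integral of `p` has derivative `u` times the integral of `pHat`. The
angle is normalized so that this equals `M'` times the angle, because `M' = u μ`; the two terms
cancel. -/
theorem fderiv_G (z w : ℝ × ℝ) :
    fderiv ℝ Y.G z w = Y.p z * w.1 - Y.M z.2 * fderiv ℝ Y.angle z w := by
  obtain ⟨x, u⟩ := z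
  have hc := Y.contDiff_p.continuous
  have ha := Y.contDiff_angle
  have hc' : Continuous fun σ => Y.p (σ, u) := by fun_prop
  have h1 : partialFst Y.G (x, u) = Y.p (x, u) - Y.M u * partialFst Y.angle (x, u) := by
    have h2 := (intervalIntegral.integral_hasDerivAt_right (hc'.intervalIntegrable 0 x)
      hc'.aestronglyMeasurable.stronglyMeasurableAtFilter hc'.continuousAt).fun_sub
      ((ha.hasDerivAt_fst x u).const_mul (Y.M u))
    exact (Y.contDiff_G.hasDerivAt_fst x u).unique h2
  have h2 : partialSnd Y.G (x, u) = -Y.M u * partialSnd Y.angle (x, u) := by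
    have h3 := (Y.hasDerivAt_integral_p x u).fun_sub
      ((Y.hasDerivAt_M u).fun_mul (ha.hasDerivAt_snd x u))
    rw [(Y.contDiff_G.hasDerivAt_snd x u).unique h3]
    have h4 : (∫ σ in (0 : ℝ)..x, Y.pHat (σ, u)) = Y.μ u * Y.angle (x, u) := by
      have := (Y.μ_pos u).ne'
      simp only [angle]
      field_simp
    rw [h4]
    ring
  rw [fderiv_apply_eq_partials, fderiv_apply_eq_partials, h1, h2]
  ring

/-- The first component of the map in the coordinates of the family. -/
noncomputable def f' (z : ℝ × ℝ) : ℝ := T.f (z.1, Y.Y z)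

/-- The second component of the map in the coordinates of the family. -/
noncomputable def g' (z : ℝ × ℝ) : ℝ := Y.param (Y.f' z, T.g (z.1, Y.Y z))

theorem contDiff_f' : ContDiff ℝ ∞ Y.f' := by
  have := T.contDiff_f
  have := Y.contDiff_Y
  unfold f'
  fun_prop

theorem contDiff_g' : ContDiff ℝ ∞ Y.g' := by
  have := T.contDiff_g
  have := Y.contDiff_f'
  have := Y.contDiff_param
  have := Y.contDiff_Y
  unfold g'
  fun_prop

theorem f'_add_one (x u : ℝ) : Y.f' (x + 1, u) = Y.f' (x, u) + 1 := by
  simp only [f', Y.isCurveFamily.add_one, T.f_add_one]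

theorem g'_add_one (x u : ℝ) : Y.g' (x + 1, u) = Y.g' (x, u) := by
  simp only [g', Y.isCurveFamily.add_one, T.g_add_one, f'_add_one, Y.param_add_one]

theorem Y_g' (z : ℝ × ℝ) : Y.Y (Y.f' z, Y.g' z) = T.g (z.1, Y.Y z) := Y.Y_param _ _

theorem rev_f' (z : ℝ × ℝ) : Y.f' (Y.f' z, -Y.g' z) = z.1 := by
  rw [f', Y.isCurveFamily.odd, Y_g']
  exact T.rev_f _

theorem rev_g' (z : ℝ × ℝ) : Y.g' (Y.f' z, -Y.g' z) = -z.2 := by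
  have h1 := Y.rev_f' z
  rw [g', h1, Y.isCurveFamily.odd, Y_g']
  have := T.rev_g (z.1, Y.Y z)
  rw [f', this, Y.param_odd, Y.param_Y]

/-- The parameter through the image point is compared with the parameter through the point of the
curve `u` over the same base; their heights differ by the flat defect. -/
theorem isFlat_g'_sub : IsFlat (fun z => Y.g' z - z.2) := by
  have h := Y.isFlat_defect
  have hf := Y.contDiff_f'
  have hY := Y.contDiff_Y
  have hg := T.contDiff_g
  have h1 := IsFlat.comp_sub_comp (F := Y.param) (c := Y.f') (a := fun z => T.g (z.1, Y.Y z))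
    (b := fun z => Y.Y (Y.f' z, z.2)) Y.contDiff_param hf (by fun_prop) (by fun_prop)
    (h.congr fun x u => rfl)
  exact h1.congr fun x u => by simp only [g', Y.param_Y]

theorem divPow_g' : DivPow 1 Y.g' :=
  ((Y.isFlat_g'_sub 1).add DivPow.snd).congr fun x u => by ring

/-- The displacement of the angle coordinate. -/
noncomputable def shift (z : ℝ × ℝ) : ℝ := Y.angle (Y.f' z, Y.g' z) - Y.angle z

theorem contDiff_shift : ContDiff ℝ ∞ Y.shift := by
  have := Y.contDiff_f'
  have := Y.contDiff_g'
  have := Y.contDiff_angle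
  unfold shift
  fun_prop

theorem shift_add_one (x u : ℝ) : Y.shift (x + 1, u) = Y.shift (x, u) := by
  simp only [shift, Y.f'_add_one, Y.g'_add_one, Y.angle_add_one]; ring

theorem shift_rev (z : ℝ × ℝ) : Y.shift (Y.f' z, -Y.g' z) = -Y.shift z := by
  simp only [shift, Y.rev_f', Y.rev_g', Y.angle_even]
  ring

end InvariantFamily

/-! ### The angle displacement up to flat terms -/

namespace InvariantFamily

variable {T : ReversibleTwist} (Y : InvariantFamily T)

/-- The generating function of the map in the coordinates given by the angle and the parameter. -/
noncomputable def genFun (z : ℝ × ℝ) : ℝ :=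
  T.F (z.1, Y.Y z) + Y.G z - Y.G (Y.f' z, Y.g' z)

theorem contDiff_genFun : ContDiff ℝ ∞ Y.genFun := by
  have := T.contDiff_F
  have := Y.contDiff_Y
  have := Y.contDiff_G
  have := Y.contDiff_f'
  have := Y.contDiff_g'
  unfold genFun
  fun_prop

/-- The map changes `P dx` by `dF`, and `dG` converts `P dx` into `M` times the differential of the
angle, at the point and at its image. -/
theorem fderiv_genFun (z w : ℝ × ℝ) :
    fderiv ℝ Y.genFun z w = Y.M (Y.g' z) * fderiv ℝ (fun z => Y.angle (Y.f' z, Y.g' z)) z w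
      - Y.M z.2 * fderiv ℝ Y.angle z w := by
  have dF : Differentiable ℝ T.F := T.contDiff_F.differentiable (by simp)
  have df : Differentiable ℝ T.f := T.contDiff_f.differentiable (by simp)
  have dY : Differentiable ℝ Y.Y := Y.contDiff_Y.differentiable (by simp)
  have dG : Differentiable ℝ Y.G := Y.contDiff_G.differentiable (by simp)
  have dA : Differentiable ℝ Y.angle := Y.contDiff_angle.differentiable (by simp)
  have df' : Differentiable ℝ Y.f' := Y.contDiff_f'.differentiable (by simp)
  have dg' : Differentiable ℝ Y.g' := Y.contDiff_g'.differentiable (by simp)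
  have hΓ : HasFDerivAt (fun z : ℝ × ℝ => (z.1, Y.Y z))
      ((ContinuousLinearMap.fst ℝ ℝ ℝ).prod (fderiv ℝ Y.Y z)) z :=
    hasFDerivAt_fst.prodMk (dY z).hasFDerivAt
  have hψ : HasFDerivAt (fun z : ℝ × ℝ => (Y.f' z, Y.g' z))
      ((fderiv ℝ Y.f' z).prod (fderiv ℝ Y.g' z)) z :=
    (df' z).hasFDerivAt.prodMk (dg' z).hasFDerivAt
  have h1 := (dF (z.1, Y.Y z)).hasFDerivAt.comp z hΓ
  have h2 := (df (z.1, Y.Y z)).hasFDerivAt.comp z hΓ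
  have h3 := (dG (Y.f' z, Y.g' z)).hasFDerivAt.comp z hψ
  have h4 := (dA (Y.f' z, Y.g' z)).hasFDerivAt.comp z hψ
  have h5 := (h1.fun_add (dG z).hasFDerivAt).fun_sub h3
  have e1 : fderiv ℝ Y.genFun z = _ := h5.fderiv
  have e2 : fderiv ℝ Y.f' z = _ := h2.fderiv
  have e3 : fderiv ℝ (fun z => Y.angle (Y.f' z, Y.g' z)) z = _ := h4.fderiv
  have e4 : fderiv ℝ Y.f' z w = fderiv ℝ T.f (z.1, Y.Y z) (w.1, fderiv ℝ Y.Y z w) := by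
    conv_lhs => rw [e2]
    rfl
  have e5 : ∀ v, fderiv ℝ T.F (z.1, Y.Y z) v
      = T.P (Y.f' z, T.g (z.1, Y.Y z)) * fderiv ℝ T.f (z.1, Y.Y z) v - T.P (z.1, Y.Y z) * v.1 := by
    intro v
    rw [fderiv_apply_eq_partials, fderiv_apply_eq_partials, ← T.exactness_fst, ← T.exactness_snd]
    simp only [f']
    ring
  rw [e1, e3]
  change fderiv ℝ T.F (z.1, Y.Y z) (w.1, fderiv ℝ Y.Y z w) + fderiv ℝ Y.G z w
    - fderiv ℝ Y.G (Y.f' z, Y.g' z) (fderiv ℝ Y.f' z w, fderiv ℝ Y.g' z w)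
    = Y.M (Y.g' z) * fderiv ℝ Y.angle (Y.f' z, Y.g' z) (fderiv ℝ Y.f' z w, fderiv ℝ Y.g' z w)
      - Y.M z.2 * fderiv ℝ Y.angle z w
  rw [e5, Y.fderiv_G, Y.fderiv_G, ← e4]
  simp only [p, Y.Y_g']
  ring

/-- To all orders at the boundary, the angle displacement depends on the curve only. -/
theorem isFlat_shift_sub : IsFlat (fun z => Y.shift z - Y.shift (0, z.2)) := by
  have hA := Y.contDiff_angle
  have hf' := Y.contDiff_f'
  have hg' := Y.contDiff_g'
  have hM := Y.contDiff_M
  have hS := Y.contDiff_shift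
  have hQ := Y.contDiff_genFun
  have hμ := Y.contDiff_μ
  set B : ℝ × ℝ → ℝ := fun z => Y.angle (Y.f' z, Y.g' z) with hB
  have hBs : ContDiff ℝ ∞ B := by fun_prop
  set N : ℝ × ℝ → ℝ := fun z => Y.M (Y.g' z) - Y.M z.2 with hN
  have hNflat : IsFlat N :=
    IsFlat.comp_sub_comp (F := fun q : ℝ × ℝ => Y.M q.2) (c := fun _ => 0) (by fun_prop)
      (by fun_prop) hg' contDiff_snd Y.isFlat_g'_sub
  -- Subtracting `M * shift` leaves `dK = (M (g') - M) dB - u μ shift du`. As the first term is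
  -- flat, `K` depends on `u` only up to flat terms, and its derivative in `u` then shows the same
  -- for `u μ shift`.
  set K : ℝ × ℝ → ℝ := fun z => Y.genFun z - Y.M z.2 * Y.shift z with hK
  have hKs : ContDiff ℝ ∞ K := by fun_prop
  have hSx : ∀ z, partialFst Y.shift z = partialFst B z - partialFst Y.angle z := fun z =>
    (hS.hasDerivAt_fst z.1 z.2).unique
      ((hBs.hasDerivAt_fst z.1 z.2).fun_sub (hA.hasDerivAt_fst z.1 z.2))
  have hSu : ∀ z, partialSnd Y.shift z = partialSnd B z - partialSnd Y.angle z := fun z =>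
    (hS.hasDerivAt_snd z.1 z.2).unique
      ((hBs.hasDerivAt_snd z.1 z.2).fun_sub (hA.hasDerivAt_snd z.1 z.2))
  have hKx : ∀ z, partialFst K z = N z * partialFst B z := fun z => by
    rw [(hKs.hasDerivAt_fst z.1 z.2).unique
      ((hQ.hasDerivAt_fst z.1 z.2).fun_sub ((hS.hasDerivAt_fst z.1 z.2).const_mul (Y.M z.2))),
      hSx]
    have h1 : partialFst Y.genFun z = _ := Y.fderiv_genFun z (1, 0)
    rw [h1]
    simp only [partialFst, hN]
    ring
  have hKu : ∀ z, partialSnd K z = N z * partialSnd B z - z.2 * Y.μ z.2 * Y.shift z := fun z => by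
    rw [(hKs.hasDerivAt_snd z.1 z.2).unique
      ((hQ.hasDerivAt_snd z.1 z.2).fun_sub ((Y.hasDerivAt_M z.2).fun_mul
        (hS.hasDerivAt_snd z.1 z.2))), hSu]
    have h1 : partialSnd Y.genFun z = _ := Y.fderiv_genFun z (0, 1)
    rw [h1]
    simp only [partialSnd, hN]
    ring
  have hNB : IsFlat (fun z => N z * partialSnd B z) := hNflat.mul_right hBs.partialSnd
  have hK0 : IsFlat (fun z => K z - K (0, z.2)) := by
    have h1 : IsFlat (partialFst K) :=
      (hNflat.mul_right hBs.partialFst).congr fun x u => hKx _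
    refine h1.integral_fst.congr fun x u => ?_
    have hc := hKs.partialFst.continuous
    exact (intervalIntegral.integral_eq_sub_of_hasDerivAt
      (fun σ _ => hKs.hasDerivAt_fst σ u)
      (Continuous.intervalIntegrable (by fun_prop) 0 x)).symm
  have hK1 : IsFlat (fun z => partialSnd K z - partialSnd K (0, z.2)) := by
    refine hK0.partialSnd.congr fun x u => ?_
    have hs : ContDiff ℝ ∞ (fun z : ℝ × ℝ => K z - K (0, z.2)) := by fun_prop
    exact ((hs.hasDerivAt_snd x u).unique
      ((hKs.hasDerivAt_snd x u).fun_sub (hKs.hasDerivAt_snd 0 u))).symm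
  have hNB0 : IsFlat (fun z : ℝ × ℝ => N (0, z.2) * partialSnd B (0, z.2)) :=
    hNB.comp (a := fun _ => 0) (b := fun z => z.2) contDiff_const DivPow.snd
  have hfin : IsFlat (fun z => z.2 * (Y.μ z.2 * (Y.shift z - Y.shift (0, z.2)))) :=
    ((hNB.sub hNB0).sub hK1).congr fun x u => by
      simp only [hKu]; ring
  have h6 : IsFlat (fun z => Y.μ z.2 * (Y.shift z - Y.shift (0, z.2))) :=
    IsFlat.of_mul_snd (by fun_prop) hfin
  have hinv : ContDiff ℝ ∞ (fun z : ℝ × ℝ => (Y.μ z.2)⁻¹) :=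
    ContDiff.inv (by fun_prop) fun z => (Y.μ_pos _).ne'
  refine (h6.mul_right hinv).congr fun x u => ?_
  have := (Y.μ_pos u).ne'
  field_simp

/-- The Birkhoff normal form: the angle displacement is an odd function of the parameter to all
orders at the boundary. -/
theorem exists_odd_shift : ∃ a : ℝ → ℝ, ContDiff ℝ ∞ a ∧ (∀ u, a (-u) = -a u) ∧
    HasDerivAt a T.τ 0 ∧ IsFlat (fun z => Y.shift z - a z.2) := by
  have hA := Y.contDiff_angle
  have hS := Y.contDiff_shift
  have hf' := Y.contDiff_f'
  have hg' := Y.contDiff_g'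
  have hfl := Y.isFlat_shift_sub
  set s : ℝ → ℝ := fun u => Y.shift (0, u) with hs
  have hss : ContDiff ℝ ∞ s := by fun_prop
  -- At `u = 0` the angle equals `x` and, being even in `u`, has no first-order term in `u`; only
  -- the twist of `f` contributes.
  have hsd : HasDerivAt s T.τ 0 := by
    have e1 : ∀ z, partialSnd Y.angle (z, 0) = 0 := fun z => by
      have h := hA.hasDerivAt_snd z 0
      have h' : HasDerivAt (fun u => Y.angle (z, u)) (partialSnd Y.angle (z, 0)) (-0) := by
        rwa [neg_zero]
      have h2 := h'.comp (0 : ℝ) (hasDerivAt_neg 0)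
      have e : ((fun u => Y.angle (z, u)) ∘ Neg.neg) = fun u => Y.angle (z, u) :=
        funext fun u => Y.angle_even z u
      rw [e] at h2
      have := h.unique h2
      linarith
    have hf0 : Y.f' (0, 0) = 0 := by simp [f', Y.isCurveFamily.zero, T.f_zero]
    have hg0 : Y.g' (0, 0) = 0 := by
      have h := Y.isCurveFamily.zero 0
      have := Y.param_Y 0 0
      rw [h] at this
      simp [g', hf0, h, T.g_zero, this]
    have hfd : HasDerivAt (fun u => Y.f' (0, u)) T.τ 0 := by
      have h1 := T.contDiff_f.hasDerivAt_comp_curve (hasDerivAt_const (0 : ℝ) (0 : ℝ))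
        (Y.contDiff_Y.hasDerivAt_snd 0 0)
      rw [Y.isCurveFamily.zero, T.twist, Y.isCurveFamily.partialSnd_zero] at h1
      convert! h1 using 1
      ring
    have e2 : partialFst Y.angle (0, 0) = 1 := by
      have h := hA.hasDerivAt_fst 0 0
      simp only [Y.angle_at_zero] at h
      exact h.unique (hasDerivAt_id' 0)
    have h1 := hA.hasDerivAt_comp_curve hfd (hg'.hasDerivAt_snd 0 0)
    rw [hf0, hg0, e1, e2] at h1
    have h2 := h1.fun_sub (hA.hasDerivAt_snd 0 0)
    rw [e1] at h2
    convert! h2 using 1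
    ring
  -- The reversed image has displacement `-shift` and parameter `-g'`, which is `-u` up to a flat
  -- term; and the displacement is determined by the parameter up to flat terms.
  have hsum : IsFlat (fun z => s z.2 + s (-z.2)) := by
    have h1 : IsFlat (fun z => Y.shift (Y.f' z, -Y.g' z) - s (-Y.g' z)) :=
      hfl.comp (a := Y.f') (b := fun z => -Y.g' z) hf' Y.divPow_g'.neg
    have h2 : IsFlat (fun z => s (-Y.g' z) - s (-z.2)) := by
      have := IsFlat.comp_sub_comp (F := fun q : ℝ × ℝ => s (-q.2)) (c := fun _ => 0)
        (by fun_prop) (by fun_prop) hg' contDiff_snd Y.isFlat_g'_sub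
      exact this
    refine ((h1.add h2).add hfl).neg.congr fun x u => ?_
    rw [Y.shift_rev]
    simp only [hs]
    ring
  -- The odd part of `s`, which differs from `s` by the flat function `(s u + s (-u)) / 2`.
  refine ⟨fun u => (s u - s (-u)) / 2, by fun_prop, fun u => by simp only [neg_neg]; ring, ?_, ?_⟩
  · have hsd' : HasDerivAt s T.τ (-0) := by rwa [neg_zero]
    have h1 := (hsd.fun_sub (hsd'.comp (0 : ℝ) (hasDerivAt_neg 0))).div_const 2
    convert! h1 using 1
    ring
  · have h3 : IsFlat (fun z : ℝ × ℝ => (s z.2 + s (-z.2)) * (1 / 2)) :=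
      hsum.mul_right contDiff_const
    exact (hfl.add h3).congr fun x u => by simp only [hs]; ring

end InvariantFamily

/-! ### Expansions of odd functions -/

theorem exists_even_quotient_of_odd {a : ℝ → ℝ} (ha : ContDiff ℝ ∞ a) (hodd : ∀ u, a (-u) = -a u) :
    ∃ h : ℝ → ℝ, ContDiff ℝ ∞ h ∧ (∀ u, h (-u) = h u) ∧ ∀ u, a u = u * h u := by
  have h0 : a 0 = 0 := by
    have := hodd 0
    rw [neg_zero] at this
    linarith
  obtain ⟨k, hk, h⟩ := DivPow.one_of_contDiff (f := fun z => a z.2) (by fun_prop) fun _ => h0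
  simp only [pow_one] at h
  have hc := hk.continuous
  refine ⟨fun u => k (0, u), by fun_prop, fun u => ?_, h 0⟩
  exact DivPow.quotient_unique (m := 1) (a := fun u => k (0, -u)) (b := fun u => k (0, u))
    (by fun_prop) (by fun_prop) (fun u => by
      rw [pow_one, ← h 0, ← neg_inj, ← hodd, h 0]; ring) u

theorem exists_even_quotient_of_even {a : ℝ → ℝ} (ha : ContDiff ℝ ∞ a) (heven : ∀ u, a (-u) = a u)
    (h0 : a 0 = 0) :
    ∃ h : ℝ → ℝ, ContDiff ℝ ∞ h ∧ (∀ u, h (-u) = h u) ∧ ∀ u, a u = u ^ 2 * h u := by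
  obtain ⟨k, hk, h⟩ := DivPow.one_of_contDiff (f := fun z => a z.2) (by fun_prop) fun _ => h0
  simp only [pow_one] at h
  have hc := hk.continuous
  have hodd : ∀ u, k (0, -u) = -k (0, u) := fun u =>
    DivPow.quotient_unique (m := 1) (a := fun u => k (0, -u)) (b := fun u => -k (0, u))
      (by fun_prop) (by fun_prop) (fun u => by
        have h1 := h 0 u
        have h2 := h 0 (-u)
        rw [heven] at h2
        rw [pow_one]
        linarith) u
  obtain ⟨l, hl, hle, hkl⟩ := exists_even_quotient_of_odd (a := fun u => k (0, u))
    (by fun_prop) hodd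
  exact ⟨l, hl, hle, fun u => by rw [h 0, hkl]; ring⟩

/-- The formal expansion of an odd smooth function in powers of another odd smooth function. -/
theorem exists_odd_expansion {a N : ℝ → ℝ} (ha : ContDiff ℝ ∞ a) (hodd : ∀ u, a (-u) = -a u)
    (hN : ContDiff ℝ ∞ N) (hNeven : ∀ u, N (-u) = N u) (hN0 : N 0 ≠ 0) {a' : ℝ}
    (ha' : HasDerivAt a a' 0) :
    ∃ c : ℕ → ℝ, c 1 = a' / N 0 ∧ ∀ n, ∃ h : ℝ → ℝ, ContDiff ℝ ∞ h ∧
      ∀ u, a u = ∑ i ∈ Finset.range n, c (2 * i + 1) * (u * N u) ^ (2 * i + 1)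
        + u ^ (2 * n + 1) * h u := by
  let Even' := {h : ℝ → ℝ // ContDiff ℝ ∞ h ∧ ∀ u, h (-u) = h u}
  -- The value at `0` is removed by a multiple of `N ^ (2 n + 1)`, so that the subtracted term is a
  -- power of `u * N u`. The remainder is even and vanishes at `0`, hence is divisible by `u ^ 2`.
  have hstep : ∀ (n : ℕ) (h : Even'), ∃ k : Even',
      ∀ u, h.1 u = h.1 0 / N 0 ^ (2 * n + 1) * N u ^ (2 * n + 1) + u ^ 2 * k.1 u := by
    rintro n ⟨h, hh, he⟩
    obtain ⟨k, hk, hke, hkh⟩ := exists_even_quotient_of_even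
      (a := fun u => h u - h 0 / N 0 ^ (2 * n + 1) * N u ^ (2 * n + 1)) (by fun_prop)
      (fun u => by simp only [he, hNeven]) (by field_simp; ring)
    exact ⟨⟨k, hk, hke⟩, fun u => by
      simp only
      linarith [hkh u]⟩
  choose next hnext using hstep
  obtain ⟨h₀, hh₀, he₀, hah⟩ := exists_even_quotient_of_odd ha hodd
  let s : ℕ → Even' := fun n => Nat.rec ⟨h₀, hh₀, he₀⟩ next n
  -- Only odd indices `j = 2 i + 1` matter, and for them `j / 2 = i`; the values at even indices are
  -- arbitrary.
  refine ⟨fun j => (s (j / 2)).1 0 / N 0 ^ (2 * (j / 2) + 1), ?_, fun n => ⟨(s n).1, (s n).2.1, ?_⟩⟩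
  · have h1 := (hasDerivAt_id (0 : ℝ)).mul ((hh₀.differentiable (by simp)) 0).hasDerivAt
    have h2 : (id * h₀ : ℝ → ℝ) = a := funext fun u => (hah u).symm
    rw [h2] at h1
    rw [ha'.unique h1]
    simp [s]
  · induction n with
    | zero => intro u; simp [s, hah u]
    | succ n ih =>
      intro u
      have hd : (2 * n + 1) / 2 = n := by omega
      rw [ih u, Finset.sum_range_succ]
      simp only [hd]
      rw [hnext n (s n) u, mul_pow]
      change _ = _ + u ^ (2 * (n + 1) + 1) * (next n (s n)).1 u
      ring

/-! ### The action coordinate -/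

namespace InvariantFamily

variable {T : ReversibleTwist} (Y : InvariantFamily T) (κ : ℝ)

/-- The quotient of the action coordinate by the parameter. -/
noncomputable def slope (u : ℝ) : ℝ := √(2 * Y.MHat u / κ)

/-- The action coordinate `y`, with `κ * y ^ 2 / 2` the area below the curve. -/
noncomputable def action (u : ℝ) : ℝ := u * Y.slope κ u

variable {κ}

theorem contDiff_slope (hκ : 0 < κ) : ContDiff ℝ ∞ (Y.slope κ) := by
  have := Y.contDiff_MHat
  refine ContDiff.sqrt (by fun_prop) fun u => ?_
  have := Y.MHat_pos u
  positivity

theorem slope_pos (hκ : 0 < κ) (u : ℝ) : 0 < Y.slope κ u := by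
  have := Y.MHat_pos u
  exact Real.sqrt_pos.2 (by positivity)

theorem slope_even (u : ℝ) : Y.slope κ (-u) = Y.slope κ u := by
  simp only [slope, Y.MHat_even]

theorem contDiff_action (hκ : 0 < κ) : ContDiff ℝ ∞ (Y.action κ) :=
  contDiff_id.mul (Y.contDiff_slope hκ)

theorem action_odd (u : ℝ) : Y.action κ (-u) = -Y.action κ u := by
  simp only [action, Y.slope_even]; ring

theorem action_sq (hκ : 0 < κ) (u : ℝ) : κ * (Y.action κ u ^ 2 / 2) = Y.M u := by
  have := Y.MHat_pos u
  rw [action, slope, mul_pow, Real.sq_sqrt (by positivity), Y.M_eq]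
  field_simp

/-- Differentiating `κ y ^ 2 / 2 = M` gives `κ y y' = u μ`. With `y = u * slope` the factor `u`
cancels, at `u = 0` by continuity. -/
theorem deriv_action (hκ : 0 < κ) (u : ℝ) :
    deriv (Y.action κ) u = Y.μ u / (κ * Y.slope κ u) := by
  have hy := Y.contDiff_action hκ
  have hd := fun v => ((hy.differentiable (by simp)) v).hasDerivAt
  have hyc : Continuous (deriv (Y.action κ)) := hy.continuous_deriv (by simp)
  have hsc := (Y.contDiff_slope hκ).continuous
  have hμc := Y.contDiff_μ.continuous
  have h1 := DivPow.quotient_unique (m := 1)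
    (a := fun u => κ * (Y.slope κ u * deriv (Y.action κ) u)) (b := Y.μ) (by fun_prop) hμc
    (fun v => by
      have h2 := ((hd v).fun_pow 2).div_const 2 |>.const_mul κ
      have h3 : (fun u => κ * (Y.action κ u ^ 2 / 2)) = Y.M := funext (Y.action_sq hκ)
      rw [h3] at h2
      have h4 := h2.unique (Y.hasDerivAt_M v)
      rw [pow_one, ← h4]
      simp only [action]
      norm_num
      ring) u
  have := Y.slope_pos hκ u
  rw [eq_div_iff (by positivity), ← h1]
  ring

theorem deriv_action_pos (hκ : 0 < κ) (u : ℝ) : 0 < deriv (Y.action κ) u := by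
  rw [Y.deriv_action hκ]
  have := Y.slope_pos hκ u
  have := Y.μ_pos u
  positivity

theorem strictMono_action (hκ : 0 < κ) : StrictMono (Y.action κ) :=
  strictMono_of_deriv_pos (Y.deriv_action_pos hκ)

/-- The area of the whole annulus is finite since `P ≤ 2 L / W`; this bounds the action, so its
supremum is a finite radius. -/
theorem M_le (u : ℝ) : Y.M u ≤ ∫ x in (0 : ℝ)..1, 2 * T.L / T.W x := by
  have hp := Y.contDiff_p.continuous
  have hW := T.contDiff_W.continuous
  refine intervalIntegral.integral_mono_on zero_le_one
    (Continuous.intervalIntegrable (by fun_prop) 0 1)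
    (Continuous.intervalIntegrable (by
      exact continuous_const.div hW fun x => (T.W_pos x).ne') 0 1) fun x _ => ?_
  have h1 := T.W_pos x
  have h2 := T.denom_pos (x, Y.Y (x, u))
  have h3 := T.L_pos
  simp only at h2
  rw [p, ReversibleTwist.P, div_le_div_iff₀ h2 h1]
  nlinarith

variable (κ) in
/-- The supremum of the action coordinate. -/
noncomputable def radius : ℝ := sSup (range (Y.action κ))

theorem bddAbove_action (hκ : 0 < κ) : BddAbove (range (Y.action κ)) := by
  -- A bound on `y ^ 2` is turned into one on `y` by `y ≤ 1 + y ^ 2`.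
  refine ⟨1 + 2 * (∫ x in (0 : ℝ)..1, 2 * T.L / T.W x) / κ, ?_⟩
  rintro _ ⟨u, rfl⟩
  have h1 := Y.M_le u
  rw [← Y.action_sq hκ] at h1
  have h2 : Y.action κ u ^ 2 ≤ 2 * (∫ x in (0 : ℝ)..1, 2 * T.L / T.W x) / κ := by
    rw [le_div_iff₀ hκ]
    linarith
  nlinarith [sq_nonneg (Y.action κ u - 1)]

theorem action_lt_radius (hκ : 0 < κ) (u : ℝ) : Y.action κ u < Y.radius κ :=
  (Y.strictMono_action hκ (lt_add_one u)).trans_le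
    (le_csSup (Y.bddAbove_action hκ) (mem_range_self _))

theorem abs_action_lt_radius (hκ : 0 < κ) (u : ℝ) : |Y.action κ u| < Y.radius κ := by
  refine abs_lt.2 ⟨?_, Y.action_lt_radius hκ u⟩
  have := Y.action_lt_radius hκ (-u)
  rw [Y.action_odd] at this
  linarith

theorem action_zero : Y.action κ 0 = 0 := by simp [action]

theorem radius_pos (hκ : 0 < κ) : 0 < Y.radius κ := by
  have := Y.action_lt_radius hκ 0
  rwa [Y.action_zero] at this

theorem exists_action_eq (hκ : 0 < κ) {y : ℝ} (hy : |y| < Y.radius κ) : ∃ u, Y.action κ u = y := by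
  obtain ⟨_, ⟨u, rfl⟩, hu⟩ := exists_lt_of_lt_csSup (range_nonempty _) hy
  have hc := (Y.contDiff_action hκ).continuous
  have hu0 : 0 < u := by
    rw [← (Y.strictMono_action hκ).lt_iff_lt, Y.action_zero]
    exact (abs_nonneg y).trans_lt hu
  obtain ⟨v, -, hv⟩ := intermediate_value_Icc (a := -u) (b := u) (by linarith) hc.continuousOn
    (show y ∈ Icc _ _ by
      rw [Y.action_odd]
      constructor <;> linarith [le_abs_self y, neg_abs_le y])
  exact ⟨v, hv⟩

variable (κ) in
/-- The inverse of the action coordinate. -/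
noncomputable def actionInv : ℝ → ℝ := Function.invFun (Y.action κ)

theorem action_actionInv (hκ : 0 < κ) {y : ℝ} (hy : |y| < Y.radius κ) :
    Y.action κ (Y.actionInv κ y) = y := Function.invFun_eq (Y.exists_action_eq hκ hy)

theorem actionInv_action (hκ : 0 < κ) (u : ℝ) : Y.actionInv κ (Y.action κ u) = u :=
  Function.leftInverse_invFun (Y.strictMono_action hκ).injective u

theorem isOpen_abs_lt (R : ℝ) : IsOpen {y : ℝ | |y| < R} := isOpen_lt continuous_abs continuous_const

theorem contDiffOn_actionInv (hκ : 0 < κ) :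
    ContDiffOn ℝ ∞ (Y.actionInv κ) {y | |y| < Y.radius κ} :=
  contDiffOn_inverse isOpen_univ (isOpen_abs_lt _) (Y.contDiff_action hκ).contDiffOn
    (Y.strictMono_action hκ).injective.injOn
    (fun _ hv => ⟨mem_univ _, Y.action_actionInv hκ hv⟩) fun u _ => (Y.deriv_action_pos hκ u).ne'

theorem actionInv_odd (hκ : 0 < κ) {y : ℝ} (hy : |y| < Y.radius κ) :
    Y.actionInv κ (-y) = -Y.actionInv κ y := by
  conv_lhs => rw [← Y.action_actionInv hκ hy, ← Y.action_odd, Y.actionInv_action hκ]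

theorem actionInv_nonneg (hκ : 0 < κ) {y : ℝ} (hy : |y| < Y.radius κ) (h0 : 0 ≤ y) :
    0 ≤ Y.actionInv κ y := by
  rw [← (Y.strictMono_action hκ).le_iff_le, Y.action_actionInv hκ hy, Y.action_zero]
  exact h0

theorem action_nonneg (hκ : 0 < κ) {u : ℝ} (h0 : 0 ≤ u) : 0 ≤ Y.action κ u :=
  mul_nonneg h0 (Y.slope_pos hκ u).le

end InvariantFamily

/-! ### Chords, signed chord angles and the bounce map -/

namespace BilliardTable

variable (B : BilliardTable)

theorem contDiff_deriv_ξ : ContDiff ℝ ∞ (deriv B.ξ) := by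
  have h : ContDiff ℝ (∞ + 1) B.ξ := B.contDiff_ξ
  exact (contDiff_succ_iff_deriv.1 h).2.2

theorem deriv_ξ_add_one (s : ℝ) : deriv B.ξ (s + 1) = deriv B.ξ s := by
  have h : (fun r => B.ξ (r + 1)) = B.ξ := funext B.periodic_ξ
  rw [← deriv_comp_add_const, h]

theorem deriv_ξ_ne_zero (s : ℝ) : deriv B.ξ s ≠ 0 := by
  rw [← norm_ne_zero_iff, B.unit_speed]
  exact one_ne_zero

theorem deriv_ξ_mul_conj (s : ℝ) : deriv B.ξ s * conj (deriv B.ξ s) = 1 := by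
  rw [Complex.mul_conj, Complex.normSq_eq_norm_sq, B.unit_speed s]; simp

/-- The mean tangent between two boundary points: a smooth multiple of the chord. -/
noncomputable def meanTangent (p : ℝ × ℝ) : ℂ :=
  ∫ θ in (0 : ℝ)..1, deriv B.ξ (p.1 + θ * (p.2 - p.1))

theorem contDiff_meanTangent : ContDiff ℝ ∞ B.meanTangent := by
  have := B.contDiff_deriv_ξ
  exact contDiff_integral_unitInterval
    (f := fun z : (ℝ × ℝ) × ℝ => deriv B.ξ (z.1.1 + z.2 * (z.1.2 - z.1.1))) (by fun_prop)

theorem chord_eq (s t : ℝ) : B.ξ t - B.ξ s = ((t - s : ℝ) : ℂ) * B.meanTangent (s, t) := by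
  have hc := B.contDiff_deriv_ξ.continuous
  have h := intervalIntegral.integral_eq_sub_of_hasDerivAt (a := 0) (b := 1)
    (f := fun θ : ℝ => B.ξ (s + θ * (t - s)))
    (f' := fun θ : ℝ => (t - s) • deriv B.ξ (s + θ * (t - s))) (fun θ _ => by
      have h1 : HasDerivAt (fun θ : ℝ => s + θ * (t - s)) (t - s) θ := by
        simpa using ((hasDerivAt_id θ).mul_const (t - s)).const_add s
      exact (B.hasDerivAt_ξ _).scomp θ h1)
    (Continuous.intervalIntegrable (by fun_prop) 0 1)
  rw [intervalIntegral.integral_smul] at h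
  simp only [one_mul, zero_mul, add_zero, add_sub_cancel] at h
  rw [← h, Complex.real_smul]
  rfl

theorem meanTangent_self (s : ℝ) : B.meanTangent (s, s) = deriv B.ξ s := by simp [meanTangent]

theorem meanTangent_symm (s t : ℝ) : B.meanTangent (t, s) = B.meanTangent (s, t) := by
  rcases eq_or_ne s t with rfl | h
  · rfl
  · have h1 := B.chord_eq s t
    have h2 := B.chord_eq t s
    have h3 : ((t - s : ℝ) : ℂ) ≠ 0 := by exact_mod_cast sub_ne_zero.2 h.symm
    refine mul_left_cancel₀ h3 ?_
    push_cast at *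
    linear_combination h1 + h2

theorem meanTangent_add_one (s t : ℝ) : B.meanTangent (s + 1, t + 1) = B.meanTangent (s, t) := by
  simp only [meanTangent, add_sub_add_right_eq_sub]
  congr 1
  funext θ
  rw [← B.deriv_ξ_add_one (s + θ * (t - s))]
  congr 1
  ring

/-- The mean tangent relative to the tangent at the first point. -/
noncomputable def relTangent (p : ℝ × ℝ) : ℂ := conj (deriv B.ξ p.1) * B.meanTangent p

theorem contDiff_relTangent : ContDiff ℝ ∞ B.relTangent := by
  have h1 := B.contDiff_deriv_ξ
  have h2 := B.contDiff_meanTangent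
  have h3 : ContDiff ℝ ∞ (fun z : ℂ => conj z) := Complex.conjCLE.contDiff
  exact (h3.comp (h1.comp contDiff_fst)).mul h2

/-- The pairs of parameters of distance less than one. -/
def nearPairs : Set (ℝ × ℝ) := {p | |p.2 - p.1| < 1}

theorem isOpen_nearPairs : IsOpen nearPairs :=
  isOpen_lt (by fun_prop) continuous_const

theorem mem_nearPairs {s t : ℝ} : (s, t) ∈ nearPairs ↔ |t - s| < 1 := Iff.rfl

theorem nearPairs_symm {s t : ℝ} (h : (s, t) ∈ nearPairs) : (t, s) ∈ nearPairs := by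
  rw [mem_nearPairs, abs_sub_comm]
  exact h

theorem height_pos_left {s t : ℝ} (ht : t ∈ Ioo (s - 1) s) :
    0 < (conj (deriv B.ξ s) * (B.ξ t - B.ξ s)).im := by
  rw [← B.periodic_ξ t]
  exact B.height_pos ⟨by linarith [ht.1], by linarith [ht.2]⟩

theorem relTangent_im (s t : ℝ) :
    (conj (deriv B.ξ s) * (B.ξ t - B.ξ s)).im = (t - s) * (B.relTangent (s, t)).im := by
  rw [B.chord_eq, relTangent, mul_left_comm, Complex.im_ofReal_mul]

theorem relTangent_im_pos {s t : ℝ} (h : t ∈ Ioo s (s + 1)) : 0 < (B.relTangent (s, t)).im := by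
  have h1 := B.height_pos h
  rw [B.relTangent_im] at h1
  exact (pos_iff_pos_of_mul_pos h1).1 (by linarith [h.1])

theorem relTangent_im_neg {s t : ℝ} (h : t ∈ Ioo (s - 1) s) : (B.relTangent (s, t)).im < 0 := by
  have h1 := B.height_pos_left h
  rw [B.relTangent_im] at h1
  nlinarith [h.2]

theorem relTangent_self (s : ℝ) : B.relTangent (s, s) = 1 := by
  rw [relTangent, B.meanTangent_self, mul_comm, B.deriv_ξ_mul_conj]

/-- By strict convexity the chord lies strictly to the left of the tangent. Divided by `t - s`, it
has positive imaginary part for `t > s` and negative for `t < s`, while at `t = s` the value is `1`.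
The branch cut of the argument is never met. -/
theorem relTangent_mem {p : ℝ × ℝ} (hp : p ∈ nearPairs) : B.relTangent p ∈ Complex.slitPlane := by
  obtain ⟨s, t⟩ := p
  obtain ⟨h1, h2⟩ := abs_lt.1 (mem_nearPairs.1 hp)
  rcases lt_trichotomy s t with h | rfl | h
  · exact Complex.mem_slitPlane_iff.2
      (Or.inr (B.relTangent_im_pos ⟨h, by linarith⟩).ne')
  · rw [B.relTangent_self]
    exact Complex.one_mem_slitPlane
  · exact Complex.mem_slitPlane_iff.2
      (Or.inr (B.relTangent_im_neg ⟨by linarith, h⟩).ne)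

theorem meanTangent_ne_zero {p : ℝ × ℝ} (hp : p ∈ nearPairs) : B.meanTangent p ≠ 0 := by
  intro h
  have := Complex.slitPlane_ne_zero (B.relTangent_mem hp)
  rw [relTangent, h, mul_zero] at this
  exact this rfl

theorem norm_relTangent (p : ℝ × ℝ) : ‖B.relTangent p‖ = ‖B.meanTangent p‖ := by
  rw [relTangent, norm_mul, RCLike.norm_conj, B.unit_speed, one_mul]

/-- The signed angle from the tangent at `p.1` to the chord between the parameters. -/
noncomputable def chordAngle (p : ℝ × ℝ) : ℝ := (B.relTangent p).arg

theorem contDiffOn_chordAngle : ContDiffOn ℝ ∞ B.chordAngle nearPairs := by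
  have h : ContDiffOn ℝ ∞ (fun p => (Complex.log (B.relTangent p)).im) nearPairs := fun p hp =>
    (Complex.imCLM.contDiff.contDiffAt.comp p
      (((Complex.contDiffAt_log (B.relTangent_mem hp)).restrict_scalars ℝ).comp p
        B.contDiff_relTangent.contDiffAt)).contDiffWithinAt
  simp only [Complex.log_im] at h
  exact h

theorem chordAngle_self (s : ℝ) : B.chordAngle (s, s) = 0 := by
  rw [chordAngle, B.relTangent_self, Complex.arg_one]

theorem abs_chordAngle_lt {p : ℝ × ℝ} (hp : p ∈ nearPairs) : |B.chordAngle p| < Real.pi := by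
  have := Complex.mem_slitPlane_iff_arg.1 (B.relTangent_mem hp)
  refine abs_lt.2 ⟨Complex.neg_pi_lt_arg _, lt_of_le_of_ne (Complex.arg_le_pi _) this.1⟩

theorem chordAngle_add_one (s t : ℝ) : B.chordAngle (s + 1, t + 1) = B.chordAngle (s, t) := by
  rw [chordAngle, chordAngle, relTangent, relTangent, B.meanTangent_add_one]
  simp only [B.deriv_ξ_add_one]

theorem chordAngle_neg {s t : ℝ} (h : t ∈ Ioo (s - 1) s) : B.chordAngle (s, t) < 0 :=
  Complex.arg_neg_iff.2 (B.relTangent_im_neg h)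

theorem chordAngle_eq_of_direction {s t v l : ℝ} (hl : 0 < l) (hv : v ∈ Ioo (-Real.pi) Real.pi)
    (h : B.meanTangent (s, t) = l * (Complex.exp (v * Complex.I) * deriv B.ξ s)) :
    B.chordAngle (s, t) = v := by
  have h1 : B.relTangent (s, t) = l * Complex.exp (v * Complex.I) := by
    rw [relTangent, h]
    linear_combination (l * Complex.exp (v * Complex.I)) * B.deriv_ξ_mul_conj s
  rw [chordAngle, h1, Complex.arg_real_mul _ hl, Complex.arg_exp_mul_I,
    toIocMod_eq_self]
  exact ⟨hv.1, by linarith [hv.2]⟩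

theorem hasDerivAt_meanTangent (s t : ℝ) : HasDerivAt (fun t => B.meanTangent (s, t))
    (fderiv ℝ B.meanTangent (s, t) (0, 1)) t :=
  ((B.contDiff_meanTangent.differentiable (by simp)) (s, t)).hasFDerivAt.comp_hasDerivAt t
    ((hasDerivAt_const t s).prodMk (hasDerivAt_id t))

theorem hasDerivAt_chordAngle {s t : ℝ} (h : (s, t) ∈ nearPairs) :
    HasDerivAt (fun t => B.chordAngle (s, t))
      (fderiv ℝ B.meanTangent (s, t) (0, 1) / B.meanTangent (s, t)).im t := by
  have h1 := (B.hasDerivAt_meanTangent s t).const_mul (conj (deriv B.ξ s))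
  have h2 := h1.clog_real (B.relTangent_mem h)
  have h3 := Complex.imCLM.hasFDerivAt.comp_hasDerivAt t h2
  have h0 : conj (deriv B.ξ s) ≠ 0 := (map_ne_zero _).2 (B.deriv_ξ_ne_zero s)
  rw [mul_div_mul_left _ _ h0] at h3
  have e : (Complex.imCLM ∘ fun t => Complex.log (conj (deriv B.ξ s) * B.meanTangent (s, t)))
      = fun t => B.chordAngle (s, t) := funext fun t => Complex.log_im _
  rw [e] at h3
  exact h3

/-- By symmetry the two partial derivatives agree on the diagonal, and their sum is the derivative
of the tangent. -/
theorem fderiv_meanTangent_self (s : ℝ) :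
    fderiv ℝ B.meanTangent (s, s) (0, 1) = deriv (deriv B.ξ) s / 2 := by
  have hd := (B.contDiff_meanTangent.differentiable (by simp)) (s, s)
  have h1 : HasDerivAt (fun s => B.meanTangent (s, s)) (fderiv ℝ B.meanTangent (s, s) (1, 1)) s :=
    hd.hasFDerivAt.comp_hasDerivAt (f := fun s : ℝ => (s, s)) s
      ((hasDerivAt_id s).prodMk (hasDerivAt_id s))
  simp only [B.meanTangent_self] at h1
  have h2 := (B.hasDerivAt_deriv_ξ s).unique h1
  have h3 : HasDerivAt (fun t => B.meanTangent (t, s)) (fderiv ℝ B.meanTangent (s, s) (1, 0)) s :=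
    hd.hasFDerivAt.comp_hasDerivAt (f := fun t : ℝ => (t, s)) s
      ((hasDerivAt_id s).prodMk (hasDerivAt_const s s))
  simp only [B.meanTangent_symm s] at h3
  have h4 := (B.hasDerivAt_meanTangent s s).unique h3
  have h5 : ((1, 1) : ℝ × ℝ) = (1, 0) + (0, 1) := by simp
  rw [h5, map_add, ← h4] at h2
  rw [h2]
  ring

theorem deriv_chordAngle_self (s : ℝ) :
    HasDerivAt (fun t => B.chordAngle (s, t)) (B.curvature s / 2) s := by
  have h := B.hasDerivAt_chordAngle (s := s) (t := s) (by simp [nearPairs])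
  rw [B.fderiv_meanTangent_self, B.meanTangent_self] at h
  convert! h using 1
  have h1 : deriv (deriv B.ξ) s / 2 / deriv B.ξ s
      = ((1 / 2 : ℝ) : ℂ) * (conj (deriv B.ξ s) * deriv (deriv B.ξ) s) := by
    rw [div_eq_iff (B.deriv_ξ_ne_zero s)]
    push_cast
    linear_combination (-(deriv (deriv B.ξ) s) / 2) * B.deriv_ξ_mul_conj s
  rw [h1, Complex.im_ofReal_mul, curvature]
  ring

/-- Off the diagonal, differentiating the chord shows that its turning rate has the sign of the
height of `ξ s` over the tangent at `ξ t`, which is positive by strict convexity. On the diagonal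
the rate is half the curvature. -/
theorem deriv_chordAngle_pos {s t : ℝ} (h : (s, t) ∈ nearPairs) :
    0 < deriv (fun t => B.chordAngle (s, t)) t := by
  rcases eq_or_ne s t with rfl | hst
  · rw [(B.deriv_chordAngle_self s).deriv]
    exact half_pos (B.curvature_pos s)
  rw [(B.hasDerivAt_chordAngle h).deriv]
  set q := B.meanTangent (s, t) with hq
  set q' := fderiv ℝ B.meanTangent (s, t) (0, 1) with hq'
  have hq0 : q ≠ 0 := B.meanTangent_ne_zero h
  have h1 : HasDerivAt (fun t => B.ξ t - B.ξ s) (deriv B.ξ t) t := (B.hasDerivAt_ξ t).sub_const _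
  have h2 : HasDerivAt (fun t : ℝ => ((t - s : ℝ) : ℂ) * B.meanTangent (s, t))
      (1 * q + ((t - s : ℝ) : ℂ) * q') t := by
    have h3 : HasDerivAt (fun t : ℝ => ((t - s : ℝ) : ℂ)) 1 t := by
      have := (((hasDerivAt_id t).sub_const s).ofReal_comp)
      simpa using this
    exact h3.mul (B.hasDerivAt_meanTangent s t)
  have h4 := h1.unique (by simpa only [← B.chord_eq] using h2)
  have hpos : 0 < (conj (deriv B.ξ t) * (B.ξ s - B.ξ t)).im := by
    obtain ⟨e1, e2⟩ := abs_lt.1 (mem_nearPairs.1 h)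
    rcases lt_or_gt_of_ne hst with hlt | hlt
    · exact B.height_pos_left ⟨by linarith, hlt⟩
    · exact B.height_pos ⟨hlt, by linarith⟩
  rw [B.relTangent_im, relTangent, B.meanTangent_symm, ← hq] at hpos
  simp only at hpos
  have hδ : (t - s : ℝ) ≠ 0 := sub_ne_zero.2 hst.symm
  have h5 : ((t - s : ℝ) : ℂ) * (q' / q) = deriv B.ξ t / q - 1 := by
    rw [h4]
    field_simp
    ring
  have h6 : (t - s) * (q' / q).im = (deriv B.ξ t / q).im := by
    rw [← Complex.im_ofReal_mul, h5]
    simp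
  have h7 : (deriv B.ξ t / q).im = -(conj (deriv B.ξ t) * q).im / Complex.normSq q := by
    rw [Complex.div_im, Complex.mul_im, Complex.conj_re, Complex.conj_im]
    ring
  have hn : 0 < Complex.normSq q := Complex.normSq_pos.2 hq0
  have h8 : 0 < (t - s) * ((t - s) * (q' / q).im) := by
    rw [h6, h7]
    have : (t - s) * (-(conj (deriv B.ξ t) * q).im / Complex.normSq q)
        = ((s - t) * (conj (deriv B.ξ t) * q).im) / Complex.normSq q := by ring
    rw [this]
    positivity
  rw [← mul_assoc] at h8
  exact (pos_iff_pos_of_mul_pos h8).1 (mul_self_pos.2 hδ)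

theorem strictMonoOn_chordAngle (s : ℝ) :
    StrictMonoOn (fun t => B.chordAngle (s, t)) (Ioo (s - 1) (s + 1)) := by
  have hn : ∀ t ∈ Ioo (s - 1) (s + 1), (s, t) ∈ nearPairs := fun t ht =>
    mem_nearPairs.2 (abs_lt.2 ⟨by linarith [ht.1], by linarith [ht.2]⟩)
  refine strictMonoOn_of_deriv_pos (convex_Ioo _ _)
    (fun t ht => (B.hasDerivAt_chordAngle (hn t ht)).continuousAt.continuousWithinAt) fun t ht => ?_
  rw [interior_Ioo] at ht
  exact B.deriv_chordAngle_pos (hn t ht)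

theorem chordAngle_injective {s t t' : ℝ} (h : (s, t) ∈ nearPairs) (h' : (s, t') ∈ nearPairs)
    (he : B.chordAngle (s, t) = B.chordAngle (s, t')) : t = t' := by
  have hn : ∀ {t}, (s, t) ∈ nearPairs → t ∈ Ioo (s - 1) (s + 1) := fun {t} ht => by
    obtain ⟨e1, e2⟩ := abs_lt.1 (mem_nearPairs.1 ht)
    exact ⟨by linarith, by linarith⟩
  exact (B.strictMonoOn_chordAngle s).injOn (hn h) (hn h') he

theorem IsNextBounce.chordAngle_eq {s v t : ℝ} (h : B.IsNextBounce s v t)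
    (hv : v ∈ Ioo 0 Real.pi) : B.chordAngle (s, t) = v := by
  obtain ⟨ht, l, hl, e⟩ := h
  have hts : 0 < t - s := by linarith [ht.1]
  refine B.chordAngle_eq_of_direction (l := l / (t - s)) (by positivity)
    ⟨by linarith [hv.1, Real.pi_pos], hv.2⟩ ?_
  have h1 := B.chord_eq s t
  rw [e, add_sub_cancel_left] at h1
  have h2 : ((t - s : ℝ) : ℂ) ≠ 0 := by exact_mod_cast hts.ne'
  rw [Complex.ofReal_div, div_mul_eq_mul_div, h1]
  field_simp

/-- The next bounce, extended by reversibility to negative angles. -/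
noncomputable def bounce (p : ℝ × ℝ) : ℝ :=
  if 0 < p.2 then B.nextBounce p.1 p.2
  else if p.2 < 0 then B.nextBounce p.1 (p.2 + Real.pi) - 1 else p.1

/-- The strip of angles. -/
def angleStrip : Set (ℝ × ℝ) := {p | |p.2| < Real.pi}

theorem isOpen_angleStrip : IsOpen angleStrip := isOpen_lt (by fun_prop) continuous_const

theorem bounce_spec {s v : ℝ} (hv : (s, v) ∈ angleStrip) :
    (s, B.bounce (s, v)) ∈ nearPairs ∧ B.chordAngle (s, B.bounce (s, v)) = v := by
  obtain ⟨h1, h2⟩ := abs_lt.1 (show |v| < Real.pi from hv)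
  rcases lt_trichotomy v 0 with h | rfl | h
  -- For negative `v` the ray is followed in the opposite direction `v + π`. Lowering the parameter
  -- by `1` makes `t - s` negative, and dividing the chord by it restores the direction `v`.
  · have hb : B.bounce (s, v) = B.nextBounce s (v + Real.pi) - 1 := by
      simp [bounce, h, h.not_gt]
    have hspec := B.nextBounce_spec s (v := v + Real.pi) ⟨by linarith, by linarith⟩
    rw [hb]
    set t := B.nextBounce s (v + Real.pi)
    obtain ⟨ht, l, hl, e⟩ := hspec
    have hts : 0 < s - (t - 1) := by linarith [ht.2]
    refine ⟨mem_nearPairs.2 (abs_lt.2 ⟨by linarith [ht.1], by linarith [ht.1]⟩), ?_⟩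
    refine B.chordAngle_eq_of_direction (l := l / (s - (t - 1))) (by positivity) ⟨h1, h2⟩ ?_
    have h3 := B.chord_eq s (t - 1)
    have h4 : B.ξ (t - 1) = B.ξ t := by
      rw [← B.periodic_ξ (t - 1), sub_add_cancel]
    rw [h4, e, add_sub_cancel_left] at h3
    have h5 : Complex.exp (((v + Real.pi : ℝ) : ℂ) * Complex.I)
        = -Complex.exp (v * Complex.I) := by
      push_cast
      rw [add_mul, Complex.exp_add, Complex.exp_pi_mul_I]
      ring
    rw [h5] at h3
    have h6 : ((s - (t - 1) : ℝ) : ℂ) ≠ 0 := by exact_mod_cast hts.ne'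
    rw [Complex.ofReal_div, div_mul_eq_mul_div, eq_div_iff h6]
    push_cast at *
    linear_combination h3
  · have hb : B.bounce (s, 0) = s := by simp [bounce]
    rw [hb]
    exact ⟨by simp [nearPairs], B.chordAngle_self s⟩
  · have hb : B.bounce (s, v) = B.nextBounce s v := by simp [bounce, h]
    have hspec := B.nextBounce_spec s (v := v) ⟨h, h2⟩
    rw [hb]
    exact ⟨mem_nearPairs.2 (abs_lt.2 ⟨by linarith [hspec.1.1], by linarith [hspec.1.2]⟩),
      hspec.chordAngle_eq B ⟨h, h2⟩⟩

theorem bounce_mem {p : ℝ × ℝ} (hp : p ∈ angleStrip) : (p.1, B.bounce p) ∈ nearPairs :=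
  (B.bounce_spec (s := p.1) (v := p.2) hp).1

theorem chordAngle_bounce {p : ℝ × ℝ} (hp : p ∈ angleStrip) :
    B.chordAngle (p.1, B.bounce p) = p.2 :=
  (B.bounce_spec (s := p.1) (v := p.2) hp).2

theorem bounce_chordAngle {s t : ℝ} (h : (s, t) ∈ nearPairs) :
    B.bounce (s, B.chordAngle (s, t)) = t := by
  have := B.bounce_spec (s := s) (v := B.chordAngle (s, t)) (B.abs_chordAngle_lt h)
  exact B.chordAngle_injective this.1 h this.2

theorem bounce_zero (s : ℝ) : B.bounce (s, 0) = s := by simp [bounce]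

theorem contDiffOn_bounce : ContDiffOn ℝ ∞ B.bounce angleStrip :=
  contDiffOn_fiberwise_inverse isOpen_nearPairs isOpen_angleStrip B.contDiffOn_chordAngle
    (fun _ _ _ h h' he => B.chordAngle_injective h h' he) (fun _ _ h => B.bounce_spec h)
    fun _ _ h => (B.deriv_chordAngle_pos h).ne'

theorem bounce_add_one {s v : ℝ} (hv : (s, v) ∈ angleStrip) :
    B.bounce (s + 1, v) = B.bounce (s, v) + 1 := by
  have h := B.bounce_mem hv
  have h1 : (s + 1, B.bounce (s, v) + 1) ∈ nearPairs := by
    rw [mem_nearPairs, add_sub_add_right_eq_sub]; exact h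
  have h2 := B.bounce_chordAngle h1
  rw [B.chordAngle_add_one, B.chordAngle_bounce hv] at h2
  exact h2

/-- The billiard map in terms of chord angles. -/
theorem billiardMap_eq {s v : ℝ} (h0 : 0 ≤ v) (hv : v < Real.pi) :
    B.billiardMap (s, v)
      = (B.bounce (s, v), -B.chordAngle (B.bounce (s, v), s)) := by
  rcases h0.eq_or_lt with rfl | h0
  · simp [billiardMap, B.bounce_zero, B.chordAngle_self]
  have hb : B.nextBounce s v = B.bounce (s, v) := by simp [bounce, h0]
  have hspec := B.nextBounce_spec s (v := v) ⟨h0, hv⟩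
  rw [hb] at hspec
  rw [billiardMap, if_neg (by simpa using h0), if_neg (by simpa using hv), hb]
  set t := B.bounce (s, v)
  refine Prod.ext rfl ?_
  obtain ⟨⟨h1, h2⟩, -⟩ := hspec
  have hnear : (s, t) ∈ nearPairs := mem_nearPairs.2 (abs_lt.2 ⟨by linarith, by linarith⟩)
  have hneg : B.chordAngle (t, s) < 0 := B.chordAngle_neg ⟨by linarith, h1⟩
  have hts : 0 < t - s := by linarith
  have hne : B.ξ t - B.ξ s ≠ 0 := by
    rw [B.chord_eq]
    exact mul_ne_zero (by exact_mod_cast hts.ne') (B.meanTangent_ne_zero hnear)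
  simp only
  -- The reflected angle is unsigned; at the later endpoint the chord angle towards the earlier one
  -- is negative, hence the minus sign in the statement.
  rw [Complex.angle_eq_abs_arg hne (B.deriv_ξ_ne_zero t)]
  have h3 : (B.ξ t - B.ξ s) / deriv B.ξ t = ((t - s : ℝ) : ℂ) * B.relTangent (t, s) := by
    rw [div_eq_iff (B.deriv_ξ_ne_zero t), B.chord_eq, relTangent, B.meanTangent_symm s t]
    linear_combination (-((t - s : ℝ) : ℂ) * B.meanTangent (s, t)) * B.deriv_ξ_mul_conj t
  rw [h3, Complex.arg_real_mul _ hts, ← chordAngle, abs_of_neg hneg]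

end BilliardTable

/-! ### The first variation of the chord length -/

namespace BilliardTable

variable (B : BilliardTable)

/-- The signed length of a chord. -/
noncomputable def chordLength (p : ℝ × ℝ) : ℝ := (p.2 - p.1) * ‖B.meanTangent p‖

theorem contDiffOn_chordLength : ContDiffOn ℝ ∞ B.chordLength nearPairs := by
  have h : ContDiffOn ℝ ∞ (fun p => ‖B.meanTangent p‖) nearPairs :=
    B.contDiff_meanTangent.contDiffOn.norm ℝ fun p hp => B.meanTangent_ne_zero hp
  exact ContDiffOn.mul (by fun_prop) h

theorem chordLength_add_one (s t : ℝ) :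
    B.chordLength (s + 1, t + 1) = B.chordLength (s, t) := by
  simp only [chordLength, B.meanTangent_add_one, add_sub_add_right_eq_sub]

theorem cos_chordAngle {p : ℝ × ℝ} (hp : p ∈ nearPairs) :
    Real.cos (B.chordAngle p) = (conj (B.meanTangent p) * deriv B.ξ p.1).re / ‖B.meanTangent p‖ := by
  rw [chordAngle, Complex.cos_arg (Complex.slitPlane_ne_zero (B.relTangent_mem hp)),
    B.norm_relTangent, relTangent]
  congr 1
  simp only [Complex.mul_re, Complex.conj_re, Complex.conj_im]
  ring

/-- The differential of the chord length: the first variation formula. -/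
theorem fderiv_chordLength {p : ℝ × ℝ} (hp : p ∈ nearPairs) (w : ℝ × ℝ) :
    fderiv ℝ B.chordLength p w
      = Real.cos (B.chordAngle (p.2, p.1)) * w.2 - Real.cos (B.chordAngle p) * w.1 := by
  obtain ⟨s, t⟩ := p
  set q := B.meanTangent (s, t) with hq
  have hq0 : q ≠ 0 := B.meanTangent_ne_zero hp
  have hn0 : ‖q‖ ≠ 0 := norm_ne_zero_iff.2 hq0
  have hd := ((B.contDiff_meanTangent.differentiable (by simp)) (s, t)).hasFDerivAt
  set A := fderiv ℝ B.meanTangent (s, t) with hA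
  have hline : ∀ a b : ℝ, HasDerivAt (fun ε : ℝ => a + ε * b) b 0 := fun a b => by
    simpa using ((hasDerivAt_id (0 : ℝ)).mul_const b).const_add a
  have hcurve : HasDerivAt (fun ε : ℝ => (s + ε * w.1, t + ε * w.2)) w 0 :=
    (hline s w.1).prodMk (hline t w.2)
  have hz : ((s + 0 * w.1, t + 0 * w.2) : ℝ × ℝ) = (s, t) := by simp
  have hqd : HasDerivAt (fun ε : ℝ => B.meanTangent (s + ε * w.1, t + ε * w.2)) (A w) 0 := by
    rw [← hz] at hd
    exact hd.comp_hasDerivAt 0 hcurve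
  have hld : HasDerivAt (fun ε : ℝ => B.chordLength (s + ε * w.1, t + ε * w.2))
      (fderiv ℝ B.chordLength (s, t) w) 0 := by
    have h1 := ((B.contDiffOn_chordLength.contDiffAt
      (isOpen_nearPairs.mem_nhds hp)).differentiableAt (by simp)).hasFDerivAt
    rw [← hz] at h1
    have h2 := h1.comp_hasDerivAt 0 hcurve
    rw [hz] at h2
    exact h2
  have hdiff : HasDerivAt (fun ε : ℝ => (t + ε * w.2) - (s + ε * w.1)) (w.2 - w.1) 0 :=
    (hline t w.2).fun_sub (hline s w.1)
  -- The chord is differentiated along the line `p + ε w` in two ways: as `(t - s) * q`, and as a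
  -- difference of boundary points. The real part of the product with `conj q` then gives the
  -- variation of the length without dividing by `t - s`, so the diagonal is included.
  have hchord : ((w.2 - w.1 : ℝ) : ℂ) * q + ((t - s : ℝ) : ℂ) * A w
      = w.2 * deriv B.ξ t - w.1 * deriv B.ξ s := by
    have h1 := hdiff.ofReal_comp.mul hqd
    have hξ : ∀ a b : ℝ, HasDerivAt (fun ε : ℝ => B.ξ (a + ε * b)) (b * deriv B.ξ a) 0 := by
      intro a b
      have h := B.hasDerivAt_ξ (a + 0 * b)
      have := h.scomp (0 : ℝ) (hline a b)
      simp only [zero_mul, add_zero, Complex.real_smul] at this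
      exact this
    have h2 := (hξ t w.2).fun_sub (hξ s w.1)
    have e : ((fun ε : ℝ => (((t + ε * w.2) - (s + ε * w.1) : ℝ) : ℂ))
        * fun ε : ℝ => B.meanTangent (s + ε * w.1, t + ε * w.2))
        = fun ε : ℝ => B.ξ (t + ε * w.2) - B.ξ (s + ε * w.1) :=
      funext fun ε => (B.chord_eq _ _).symm
    rw [e] at h1
    have h3 := h1.unique h2
    simpa [hq] using h3
  have hnd : HasDerivAt (fun ε : ℝ => ‖B.meanTangent (s + ε * w.1, t + ε * w.2)‖)
      ((conj q * A w).re / ‖q‖) 0 := by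
    have h1 := hqd.norm_sq
    have h2 := h1.sqrt (by simpa [← hq] using hq0)
    simp only [norm_nonneg, Real.sqrt_sq, zero_mul, add_zero, ← hq] at h2
    convert! h2 using 1
    rw [Complex.inner, mul_comm (A w)]
    field_simp
  have h4 := hld.unique (hdiff.mul hnd)
  simp only [zero_mul, add_zero, ← hq] at h4
  have h5 := congrArg (fun z => (conj q * z).re) hchord
  have h6 : conj q * (((w.2 - w.1 : ℝ) : ℂ) * q + ((t - s : ℝ) : ℂ) * A w)
      = ((w.2 - w.1 : ℝ) : ℂ) * (conj q * q) + ((t - s : ℝ) : ℂ) * (conj q * A w) := by ring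
  have h7 : conj q * (w.2 * deriv B.ξ t - w.1 * deriv B.ξ s)
      = (w.2 : ℂ) * (conj q * deriv B.ξ t) - (w.1 : ℂ) * (conj q * deriv B.ξ s) := by ring
  have h8 : (conj q * q).re = ‖q‖ ^ 2 := by
    rw [mul_comm, Complex.mul_conj, Complex.normSq_eq_norm_sq, Complex.ofReal_re]
  simp only [h6, h7, Complex.add_re, Complex.sub_re, Complex.re_ofReal_mul, h8] at h5
  rw [h4, B.cos_chordAngle hp, B.cos_chordAngle (nearPairs_symm hp)]
  simp only [B.meanTangent_symm s t, ← hq]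
  field_simp
  linear_combination h5

end BilliardTable

/-! ### Lazutkin's coordinates -/

/-- The half-angle tangent makes the primitive `(1 - cos v) ds` rational in the fiber coordinate,
while the chart still covers all angles of absolute value below `π`. -/
theorem one_sub_cos_two_arctan (z : ℝ) :
    1 - Real.cos (2 * Real.arctan z) = 2 * z ^ 2 / (1 + z ^ 2) := by
  have h : 0 < 1 + z ^ 2 := by positivity
  rw [Real.cos_two_mul, Real.cos_sq_arctan]
  field_simp
  ring

theorem abs_two_arctan_lt (z : ℝ) : |2 * Real.arctan z| < Real.pi := by
  have h1 := Real.arctan_lt_pi_div_two z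
  have h2 := Real.neg_pi_div_two_lt_arctan z
  exact abs_lt.2 ⟨by linarith, by linarith⟩

theorem two_arctan_tan_half {v : ℝ} (hv : |v| < Real.pi) : 2 * Real.arctan (Real.tan (v / 2)) = v := by
  obtain ⟨h1, h2⟩ := abs_lt.1 hv
  rw [Real.arctan_tan (by linarith) (by linarith)]
  ring

theorem contDiffOn_tan_half : ContDiffOn ℝ ∞ (fun v => Real.tan (v / 2)) {v | |v| < Real.pi} := by
  intro v hv
  obtain ⟨h1, h2⟩ := abs_lt.1 (show |v| < Real.pi from hv)
  have h3 : Real.cos (v / 2) ≠ 0 :=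
    (Real.cos_pos_of_mem_Ioo ⟨by linarith, by linarith⟩).ne'
  have h4 : ContDiffAt ℝ ∞ (fun v : ℝ => v / 2) v := by fun_prop
  exact (ContDiffAt.comp (g := Real.tan) v (Real.contDiffAt_tan.2 h3) h4).contDiffWithinAt

namespace BilliardTable

variable (B : BilliardTable)

theorem contDiff_curvature : ContDiff ℝ ∞ B.curvature := by
  have h1 := B.contDiff_deriv_ξ
  have h2 : ContDiff ℝ ∞ (deriv (deriv B.ξ)) := by
    have h : ContDiff ℝ (∞ + 1) (deriv B.ξ) := h1
    exact (contDiff_succ_iff_deriv.1 h).2.2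
  have h3 : ContDiff ℝ ∞ (fun z : ℂ => conj z) := Complex.conjCLE.contDiff
  exact Complex.imCLM.contDiff.comp ((h3.comp h1).mul h2)

theorem curvature_add_one (s : ℝ) : B.curvature (s + 1) = B.curvature s := by
  have h : (fun r => deriv B.ξ (r + 1)) = deriv B.ξ := funext B.deriv_ξ_add_one
  have h2 : deriv (deriv B.ξ) (s + 1) = deriv (deriv B.ξ) s := by
    conv_rhs => rw [← h]
    rw [deriv_comp_add_const]
  rw [curvature, curvature, B.deriv_ξ_add_one, h2]

/-- The cube root of the curvature. -/
noncomputable def cbrtCurvature (s : ℝ) : ℝ := B.curvature s ^ (1 / 3 : ℝ)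

theorem cbrtCurvature_pos (s : ℝ) : 0 < B.cbrtCurvature s :=
  Real.rpow_pos_of_pos (B.curvature_pos s) _

theorem contDiff_cbrtCurvature : ContDiff ℝ ∞ B.cbrtCurvature :=
  B.contDiff_curvature.rpow_const_of_ne fun s => (B.curvature_pos s).ne'

theorem cbrtCurvature_add_one (s : ℝ) : B.cbrtCurvature (s + 1) = B.cbrtCurvature s := by
  rw [cbrtCurvature, cbrtCurvature, B.curvature_add_one]

theorem cbrtCurvature_sq (s : ℝ) : B.cbrtCurvature s ^ 2 = B.curvature s ^ (2 / 3 : ℝ) := by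
  rw [cbrtCurvature, ← Real.rpow_natCast,
    ← Real.rpow_mul (show 0 ≤ B.curvature s from (B.curvature_pos s).le)]
  norm_num

theorem cbrtCurvature_cube (s : ℝ) : B.cbrtCurvature s ^ 3 = B.curvature s := by
  rw [cbrtCurvature, ← Real.rpow_natCast,
    ← Real.rpow_mul (show 0 ≤ B.curvature s from (B.curvature_pos s).le)]
  norm_num

/-- The affine length of the boundary. -/
noncomputable def affineLength : ℝ := ∫ s in (0 : ℝ)..1, B.cbrtCurvature s ^ 2

theorem lazutkinConst_eq : B.lazutkinConst = B.affineLength ^ 3 / 4 := by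
  simp only [lazutkinConst, affineLength, B.cbrtCurvature_sq]

theorem affineLength_pos : 0 < B.affineLength := by
  have hc := B.contDiff_cbrtCurvature.continuous
  refine intervalIntegral.intervalIntegral_pos_of_pos
    (Continuous.intervalIntegrable (by fun_prop) 0 1) (fun s => ?_) one_pos
  have := B.cbrtCurvature_pos s
  positivity

theorem lazutkinConst_pos : 0 < B.lazutkinConst := by
  have := B.affineLength_pos
  rw [B.lazutkinConst_eq]
  positivity

/-- The normalized affine arc length. -/
noncomputable def affineParam (s : ℝ) : ℝ :=
  (∫ σ in (0 : ℝ)..s, B.cbrtCurvature σ ^ 2) / B.affineLength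

theorem contDiff_affineParam : ContDiff ℝ ∞ B.affineParam := by
  have hc := B.contDiff_cbrtCurvature
  have h := contDiff_integral_fst (f := fun p => B.cbrtCurvature p.1 ^ 2) (by fun_prop)
  have h2 : ContDiff ℝ ∞ fun s : ℝ => ∫ σ in (0 : ℝ)..s, B.cbrtCurvature σ ^ 2 :=
    h.comp (f := fun s : ℝ => (s, (0 : ℝ))) (by fun_prop)
  exact h2.div_const _

theorem hasDerivAt_affineParam (s : ℝ) :
    HasDerivAt B.affineParam (B.cbrtCurvature s ^ 2 / B.affineLength) s := by
  have hc := B.contDiff_cbrtCurvature.continuous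
  have hc' : Continuous fun s => B.cbrtCurvature s ^ 2 := by fun_prop
  have := (intervalIntegral.integral_hasDerivAt_right (hc'.intervalIntegrable 0 s)
    hc'.aestronglyMeasurable.stronglyMeasurableAtFilter hc'.continuousAt).div_const B.affineLength
  exact this

theorem affineParam_add_one (s : ℝ) : B.affineParam (s + 1) = B.affineParam s + 1 := by
  have hc := B.contDiff_cbrtCurvature.continuous
  have hc' : Continuous fun s => B.cbrtCurvature s ^ 2 := by fun_prop
  have h1 := intervalIntegral.integral_add_adjacent_intervals (μ := MeasureTheory.volume)
    (hc'.intervalIntegrable 0 s) (hc'.intervalIntegrable s (s + 1))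
  have hper : Function.Periodic (fun s => B.cbrtCurvature s ^ 2) 1 := fun s => by
    simp only [B.cbrtCurvature_add_one]
  have h2 := hper.intervalIntegral_add_eq s 0
  rw [zero_add] at h2
  rw [affineParam, ← h1, h2, add_div]
  congr 1
  exact div_self B.affineLength_pos.ne'

theorem exists_affineParam_inverse : ∃ S : ℝ → ℝ, ContDiff ℝ ∞ S ∧
    (∀ x, B.affineParam (S x) = x) ∧ ∀ s, S (B.affineParam s) = s := by
  have hX := B.contDiff_affineParam
  have hL := B.affineLength_pos
  obtain ⟨j, hj, h1, h2⟩ := exists_fiberwise_inverse (g := fun z => B.affineParam z.2)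
    (by fun_prop) (fun z => by
      have h2 : ContDiff ℝ ∞ (fun z : ℝ × ℝ => B.affineParam z.2) := by fun_prop
      rw [(h2.hasDerivAt_snd z.1 z.2).unique (B.hasDerivAt_affineParam z.2)]
      have := B.cbrtCurvature_pos z.2
      positivity) (fun _ v => by
      have hper : Function.Periodic (fun x => B.affineParam x - x) 1 := fun x => by
        simp only [B.affineParam_add_one]; ring
      have hn : ∀ n : ℤ, B.affineParam n = n := by
        intro n
        have := hper.int_mul n 0
        simp only [zero_add, mul_one] at this
        have h0 : B.affineParam 0 = 0 := by simp [affineParam]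
        rw [h0] at this
        linarith
      obtain ⟨x, -, hx⟩ := intermediate_value_Icc (a := (⌊v⌋ : ℝ)) (b := ((⌊v⌋ + 1 : ℤ) : ℝ))
        (by push_cast; linarith) hX.continuous.continuousOn (show v ∈ Icc _ _ by
          rw [hn, hn]
          exact ⟨Int.floor_le v, by push_cast; exact (Int.lt_floor_add_one v).le⟩)
      exact ⟨x, hx⟩)
  exact ⟨fun x => j (0, x), by fun_prop, fun x => h1 0 x, fun x => h2 0 x⟩

/-- The arc length as a function of the normalized affine arc length. -/
noncomputable def arcParam : ℝ → ℝ := B.exists_affineParam_inverse.choose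

theorem contDiff_arcParam : ContDiff ℝ ∞ B.arcParam := B.exists_affineParam_inverse.choose_spec.1

theorem affineParam_arcParam (x : ℝ) : B.affineParam (B.arcParam x) = x :=
  B.exists_affineParam_inverse.choose_spec.2.1 x

theorem arcParam_affineParam (s : ℝ) : B.arcParam (B.affineParam s) = s :=
  B.exists_affineParam_inverse.choose_spec.2.2 s

theorem arcParam_add_one (x : ℝ) : B.arcParam (x + 1) = B.arcParam x + 1 := by
  conv_lhs => rw [← B.affineParam_arcParam x, ← B.affineParam_add_one]
  rw [B.arcParam_affineParam]

theorem hasDerivAt_arcParam (x : ℝ) :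
    HasDerivAt B.arcParam (B.affineLength / B.cbrtCurvature (B.arcParam x) ^ 2) x := by
  have h1 := ((B.contDiff_arcParam.differentiable (by simp)) x).hasDerivAt
  have h2 := (B.hasDerivAt_affineParam (B.arcParam x)).comp x h1
  have e : B.affineParam ∘ B.arcParam = id := funext B.affineParam_arcParam
  rw [e] at h2
  have h3 := h2.unique (hasDerivAt_id x)
  have := B.affineLength_pos.ne'
  have := (B.cbrtCurvature_pos (B.arcParam x)).ne'
  have h4 : B.affineLength / B.cbrtCurvature (B.arcParam x) ^ 2 = deriv B.arcParam x := by
    field_simp at h3 ⊢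
    linarith
  rw [h4]
  exact h1

/-- Lazutkin's coordinates: the point of the phase space with affine parameter `p.1` and
`tan (v / 2) = κ ^ (1 / 3) * p.2`. -/
noncomputable def chart (p : ℝ × ℝ) : ℝ × ℝ :=
  (B.arcParam p.1, 2 * Real.arctan (B.cbrtCurvature (B.arcParam p.1) * p.2))

/-- The inverse of Lazutkin's coordinates. -/
noncomputable def chartInv (q : ℝ × ℝ) : ℝ × ℝ :=
  (B.affineParam q.1, Real.tan (q.2 / 2) / B.cbrtCurvature q.1)

theorem contDiff_chart : ContDiff ℝ ∞ B.chart := by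
  have h1 := B.contDiff_arcParam
  have h2 := B.contDiff_cbrtCurvature
  exact (by fun_prop : ContDiff ℝ ∞ fun p : ℝ × ℝ => B.arcParam p.1).prodMk
    (contDiff_const.mul (Real.contDiff_arctan.comp (by fun_prop)))

theorem chart_mem (p : ℝ × ℝ) : B.chart p ∈ angleStrip := abs_two_arctan_lt _

theorem chartInv_chart (p : ℝ × ℝ) : B.chartInv (B.chart p) = p := by
  have := (B.cbrtCurvature_pos (B.arcParam p.1)).ne'
  refine Prod.ext (B.affineParam_arcParam _) ?_
  simp only [chartInv, chart]
  rw [mul_div_cancel_left₀ _ two_ne_zero, Real.tan_arctan]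
  field_simp

theorem chart_chartInv {q : ℝ × ℝ} (hq : q ∈ angleStrip) : B.chart (B.chartInv q) = q := by
  have := (B.cbrtCurvature_pos q.1).ne'
  refine Prod.ext (B.arcParam_affineParam _) ?_
  simp only [chartInv, chart, B.arcParam_affineParam]
  rw [mul_div_cancel₀ _ this]
  exact two_arctan_tan_half hq

theorem contDiffOn_chartInv : ContDiffOn ℝ ∞ B.chartInv angleStrip := by
  have h1 := B.contDiff_affineParam
  have h2 := B.contDiff_cbrtCurvature
  have h3 : ContDiffOn ℝ ∞ (fun q : ℝ × ℝ => Real.tan (q.2 / 2)) angleStrip :=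
    contDiffOn_tan_half.comp contDiffOn_snd fun q hq => hq
  exact (by fun_prop : ContDiff ℝ ∞ fun q : ℝ × ℝ => B.affineParam q.1).contDiffOn.prodMk
    (h3.div (by fun_prop) fun q _ => (B.cbrtCurvature_pos _).ne')

theorem chart_add_one (x r : ℝ) : B.chart (x + 1, r) = ((B.chart (x, r)).1 + 1, (B.chart (x, r)).2) := by
  simp only [chart, B.arcParam_add_one, B.cbrtCurvature_add_one]

theorem chart_neg (x r : ℝ) : B.chart (x, -r) = ((B.chart (x, r)).1, -(B.chart (x, r)).2) := by
  simp only [chart, mul_neg, Real.arctan_neg]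

theorem chart_snd_nonneg {p : ℝ × ℝ} (h : 0 ≤ p.2) : 0 ≤ (B.chart p).2 := by
  have := (B.cbrtCurvature_pos (B.arcParam p.1)).le
  have := Real.arctan_nonneg.2 (mul_nonneg this h)
  simp only [chart]
  positivity

theorem chartInv_snd_nonneg {q : ℝ × ℝ} (h0 : 0 ≤ q.2) (h : q.2 < Real.pi) :
    0 ≤ (B.chartInv q).2 := by
  have := (B.cbrtCurvature_pos q.1).le
  exact div_nonneg (Real.tan_nonneg_of_nonneg_of_le_pi_div_two (by linarith) (by linarith)) this

/-- The primitive of the area form in Lazutkin's coordinates. -/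
theorem one_sub_cos_chart (p : ℝ × ℝ) : (1 - Real.cos (B.chart p).2)
    * (B.affineLength / B.cbrtCurvature (B.arcParam p.1) ^ 2)
    = 2 * B.affineLength * p.2 ^ 2 / (1 + B.cbrtCurvature (B.arcParam p.1) ^ 2 * p.2 ^ 2) := by
  have := (B.cbrtCurvature_pos (B.arcParam p.1)).ne'
  simp only [chart]
  rw [one_sub_cos_two_arctan, mul_pow]
  field_simp

/-! ### The billiard map as an exact reversible twist map -/

/-- The parameter of the next bounce in Lazutkin's coordinates. -/
noncomputable def next (p : ℝ × ℝ) : ℝ := B.bounce (B.chart p)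

theorem contDiff_next : ContDiff ℝ ∞ B.next := by
  have := B.contDiffOn_bounce.comp B.contDiff_chart.contDiffOn (s := univ)
    fun p _ => B.chart_mem p
  exact contDiffOn_univ.1 this

theorem next_mem (p : ℝ × ℝ) : (B.arcParam p.1, B.next p) ∈ nearPairs :=
  B.bounce_mem (B.chart_mem p)

theorem chordAngle_next (p : ℝ × ℝ) :
    B.chordAngle (B.arcParam p.1, B.next p) = (B.chart p).2 :=
  B.chordAngle_bounce (B.chart_mem p)

theorem next_add_one (x r : ℝ) : B.next (x + 1, r) = B.next (x, r) + 1 := by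
  rw [next, B.chart_add_one]
  exact B.bounce_add_one (B.chart_mem (x, r))

theorem next_zero (x : ℝ) : B.next (x, 0) = B.arcParam x := by
  simp [next, chart, B.bounce_zero]

/-- The angle after the reflection in Lazutkin's coordinates. -/
noncomputable def nextAngle (p : ℝ × ℝ) : ℝ := -B.chordAngle (B.next p, B.arcParam p.1)

theorem contDiff_nextAngle : ContDiff ℝ ∞ B.nextAngle := by
  have h1 := B.contDiff_next
  have h2 := B.contDiff_arcParam
  have h3 := B.contDiffOn_chordAngle.comp (s := univ)
    (f := fun p : ℝ × ℝ => (B.next p, B.arcParam p.1)) (by fun_prop)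
    fun p _ => nearPairs_symm (B.next_mem p)
  exact (contDiffOn_univ.1 h3).neg

theorem abs_nextAngle_lt (p : ℝ × ℝ) : |B.nextAngle p| < Real.pi := by
  rw [nextAngle, abs_neg]
  exact B.abs_chordAngle_lt (nearPairs_symm (B.next_mem p))

theorem nextAngle_add_one (x r : ℝ) : B.nextAngle (x + 1, r) = B.nextAngle (x, r) := by
  simp only [nextAngle, B.next_add_one, B.arcParam_add_one, B.chordAngle_add_one]

theorem nextAngle_zero (x : ℝ) : B.nextAngle (x, 0) = 0 := by
  simp [nextAngle, B.next_zero, B.chordAngle_self]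

/-- The billiard map in Lazutkin's coordinates, extended by reversibility. -/
noncomputable def chartMap (p : ℝ × ℝ) : ℝ × ℝ := B.chartInv (B.next p, B.nextAngle p)

theorem chart_chartMap (p : ℝ × ℝ) : B.chart (B.chartMap p) = (B.next p, B.nextAngle p) :=
  B.chart_chartInv (B.abs_nextAngle_lt p)

theorem contDiff_chartMap : ContDiff ℝ ∞ B.chartMap := by
  have := B.contDiffOn_chartInv.comp (s := univ) (B.contDiff_next.prodMk B.contDiff_nextAngle).contDiffOn
    fun p _ => B.abs_nextAngle_lt p
  exact contDiffOn_univ.1 this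

theorem billiardMap_chart {p : ℝ × ℝ} (h : 0 ≤ p.2) :
    B.billiardMap (B.chart p) = B.chart (B.chartMap p) := by
  rw [B.chart_chartMap]
  exact B.billiardMap_eq (B.chart_snd_nonneg h) (abs_lt.1 (B.chart_mem p)).2

theorem arcParam_chartMap (p : ℝ × ℝ) : B.arcParam (B.chartMap p).1 = B.next p :=
  congrArg Prod.fst (B.chart_chartMap p)

/-- The signed angles at the ends of a chord are `chordAngle (s, t)` at departure and `-chordAngle
(t, s)` at arrival. Negating the arrival angle retraces the same chord, back to `s` with the negated
departure angle. -/
theorem chartMap_rev (p : ℝ × ℝ) :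
    B.chartMap ((B.chartMap p).1, -(B.chartMap p).2) = (p.1, -p.2) := by
  have h1 : B.chart ((B.chartMap p).1, -(B.chartMap p).2) = (B.next p, -B.nextAngle p) := by
    rw [B.chart_neg, Prod.mk.eta, B.chart_chartMap]
  have h2 : B.next ((B.chartMap p).1, -(B.chartMap p).2) = B.arcParam p.1 := by
    rw [next, h1, nextAngle, neg_neg]
    exact B.bounce_chordAngle (nearPairs_symm (B.next_mem p))
  have h3 : B.nextAngle ((B.chartMap p).1, -(B.chartMap p).2) = -(B.chart p).2 := by
    rw [nextAngle, h2]
    simp only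
    rw [B.arcParam_chartMap, B.chordAngle_next]
  have h4 : ((B.arcParam p.1, -(B.chart p).2) : ℝ × ℝ) = B.chart (p.1, -p.2) := by
    rw [B.chart_neg]; rfl
  rw [chartMap, h2, h3, h4, B.chartInv_chart]

/-- With `w` the cube root of the curvature, differentiating `chordAngle (s, next) = 2 arctan (w r)`
at `r = 0` gives `(w ^ 3 / 2) * next' = 2 w`. -/
theorem partialSnd_next_zero (x : ℝ) :
    partialSnd B.next (x, 0) = 4 / B.cbrtCurvature (B.arcParam x) ^ 2 := by
  have h1 := B.contDiff_next.hasDerivAt_snd x 0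
  have h2 := B.deriv_chordAngle_self (B.arcParam x)
  rw [← B.next_zero x] at h2
  have h3 := h2.comp (0 : ℝ) h1
  have e : ((fun t => B.chordAngle (B.next (x, 0), t)) ∘ fun r => B.next (x, r))
      = fun r => 2 * Real.arctan (B.cbrtCurvature (B.arcParam x) * r) := by
    funext r
    rw [B.next_zero]
    exact B.chordAngle_next (x, r)
  rw [e] at h3
  have h4 : HasDerivAt (fun r : ℝ => B.cbrtCurvature (B.arcParam x) * r)
      (B.cbrtCurvature (B.arcParam x)) 0 := by
    simpa using (hasDerivAt_id (0 : ℝ)).const_mul (B.cbrtCurvature (B.arcParam x))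
  have h5 := h3.unique (h4.arctan.const_mul 2)
  rw [B.next_zero, ← B.cbrtCurvature_cube] at h5
  have hw := (B.cbrtCurvature_pos (B.arcParam x)).ne'
  rw [eq_div_iff (pow_ne_zero 2 hw)]
  refine mul_left_cancel₀ hw ?_
  simp at h5
  linear_combination 2 * h5

/-- The generating function of the billiard map in Lazutkin's coordinates. -/
noncomputable def chartGenFun (p : ℝ × ℝ) : ℝ :=
  -- The term `t - s` accounts for the `1` in the primitive `(1 - cos v) ds`; the chord length alone
  -- generates the part with the cosine.
  (B.next p - B.arcParam p.1) - B.chordLength (B.arcParam p.1, B.next p)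

theorem contDiff_chartGenFun : ContDiff ℝ ∞ B.chartGenFun := by
  have h1 := B.contDiff_next
  have h2 := B.contDiff_arcParam
  have h3 := B.contDiffOn_chordLength.comp (s := univ)
    (f := fun p : ℝ × ℝ => (B.arcParam p.1, B.next p)) (by fun_prop) fun p _ => B.next_mem p
  have h4 : ContDiff ℝ ∞ fun p : ℝ × ℝ => B.chordLength (B.arcParam p.1, B.next p) :=
    contDiffOn_univ.1 h3
  unfold chartGenFun
  fun_prop

theorem fderiv_chartMap_fst (p w : ℝ × ℝ) : fderiv ℝ (fun p => (B.chartMap p).1) p w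
    = B.cbrtCurvature (B.next p) ^ 2 / B.affineLength * fderiv ℝ B.next p w := by
  have h1 := ((B.contDiff_next.differentiable (by simp)) p).hasFDerivAt
  have h2 := (B.hasDerivAt_affineParam (B.next p)).comp_hasFDerivAt p h1
  have h3 : fderiv ℝ (fun p => (B.chartMap p).1) p = _ := h2.fderiv
  rw [h3]
  simp

/-- The first variation formula gives `d (t - s - ℓ) = (1 - cos v') dt - (1 - cos v) ds` for the
chord length `ℓ`, and both terms are then written in the chart. -/
theorem fderiv_chartGenFun (p w : ℝ × ℝ) : fderiv ℝ B.chartGenFun p w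
    = 2 * B.affineLength * (B.chartMap p).2 ^ 2
        / (1 + B.cbrtCurvature (B.arcParam (B.chartMap p).1) ^ 2 * (B.chartMap p).2 ^ 2)
        * fderiv ℝ (fun p => (B.chartMap p).1) p w
      - 2 * B.affineLength * p.2 ^ 2 / (1 + B.cbrtCurvature (B.arcParam p.1) ^ 2 * p.2 ^ 2)
        * w.1 := by
  rw [← B.one_sub_cos_chart, ← B.one_sub_cos_chart, B.fderiv_chartMap_fst, B.arcParam_chartMap,
    B.chart_chartMap]
  have hN := ((B.contDiff_next.differentiable (by simp)) p).hasFDerivAt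
  have hS : HasFDerivAt (fun p : ℝ × ℝ => B.arcParam p.1)
      ((B.affineLength / B.cbrtCurvature (B.arcParam p.1) ^ 2) • ContinuousLinearMap.fst ℝ ℝ ℝ) p :=
    (B.hasDerivAt_arcParam p.1).comp_hasFDerivAt p hasFDerivAt_fst
  have hl := ((B.contDiffOn_chordLength.contDiffAt
    (isOpen_nearPairs.mem_nhds (B.next_mem p))).differentiableAt (by simp)).hasFDerivAt
  have h1 := (hN.fun_sub hS).fun_sub (hl.comp p (hS.prodMk hN))
  have h2 : fderiv ℝ B.chartGenFun p = _ := h1.fderiv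
  have h3 := B.fderiv_chordLength (B.next_mem p)
    ((B.affineLength / B.cbrtCurvature (B.arcParam p.1) ^ 2) * w.1, fderiv ℝ B.next p w)
  rw [h2]
  change fderiv ℝ B.next p w - (B.affineLength / B.cbrtCurvature (B.arcParam p.1) ^ 2) * w.1
    - fderiv ℝ B.chordLength (B.arcParam p.1, B.next p)
      ((B.affineLength / B.cbrtCurvature (B.arcParam p.1) ^ 2) * w.1, fderiv ℝ B.next p w) = _
  rw [h3, B.chordAngle_next]
  simp only [nextAngle, Real.cos_neg]
  have hL := B.affineLength_pos.ne'
  have hw := (B.cbrtCurvature_pos (B.next p)).ne'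
  have hw2 := (B.cbrtCurvature_pos (B.arcParam p.1)).ne'
  field_simp
  ring

/-- The billiard map in Lazutkin's coordinates as an exact reversible twist map. -/
noncomputable def reversibleTwist : ReversibleTwist where
  f p := (B.chartMap p).1
  g p := (B.chartMap p).2
  F := B.chartGenFun
  W x := B.cbrtCurvature (B.arcParam x) ^ 2
  L := B.affineLength
  τ := 4 / B.affineLength
  L_pos := B.affineLength_pos
  τ_pos := by have := B.affineLength_pos; positivity
  W_pos x := by have := B.cbrtCurvature_pos (B.arcParam x); positivity
  contDiff_f := contDiff_fst.comp B.contDiff_chartMap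
  contDiff_g := contDiff_snd.comp B.contDiff_chartMap
  contDiff_F := B.contDiff_chartGenFun
  contDiff_W := by
    have := B.contDiff_cbrtCurvature
    have := B.contDiff_arcParam
    fun_prop
  f_add_one x r := by
    simp only [chartMap, chartInv, B.next_add_one, B.affineParam_add_one]
  g_add_one x r := by
    simp only [chartMap, chartInv, B.next_add_one, B.cbrtCurvature_add_one, B.nextAngle_add_one]
  F_add_one x r := by
    simp only [chartGenFun, B.next_add_one, B.arcParam_add_one, B.chordLength_add_one]
    ring
  W_add_one x := by simp only [B.arcParam_add_one, B.cbrtCurvature_add_one]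
  f_zero x := by simp only [chartMap, chartInv, B.next_zero, B.affineParam_arcParam]
  g_zero x := by simp [chartMap, chartInv, B.nextAngle_zero]
  -- The factor `4 / w ^ 2` of the bounce meets the density `w ^ 2 / L` of the affine parameter. The
  -- curvature cancels, which is what the exponents in the chart are made for.
  twist x := by
    rw [partialSnd, B.fderiv_chartMap_fst, B.next_zero]
    have := B.partialSnd_next_zero x
    rw [partialSnd] at this
    rw [this]
    have hL := B.affineLength_pos.ne'
    have hw := (B.cbrtCurvature_pos (B.arcParam x)).ne'
    field_simp
  rev_f p := by rw [B.chartMap_rev]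
  rev_g p := by rw [B.chartMap_rev]
  exact_fst p := by
    rw [partialFst, partialFst, B.fderiv_chartGenFun]
    simp
  exact_snd p := by
    rw [partialSnd, partialSnd, B.fderiv_chartGenFun]
    simp

end BilliardTable

/-! ### Angle and action on the annulus, and the final assembly -/

theorem uniqueDiffOn_annulus (R : ℝ) : UniqueDiffOn ℝ (annulus R) := by
  have h : annulus R = univ ×ˢ Ico 0 R := by
    ext p
    simp [annulus]
  rw [h]
  exact uniqueDiffOn_univ.prod (uniqueDiffOn_Ico 0 R)

/-- The open strip that is the double of the annulus. -/
def doubleStrip (R : ℝ) : Set (ℝ × ℝ) := {p | |p.2| < R}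

theorem isOpen_doubleStrip (R : ℝ) : IsOpen (doubleStrip R) :=
  isOpen_lt (by fun_prop) continuous_const

theorem annulus_subset_doubleStrip (R : ℝ) : annulus R ⊆ doubleStrip R := fun _ hp =>
  abs_lt.2 ⟨by linarith [hp.1, hp.2], hp.2⟩

/-- A map smooth on the double strip has an ordinary derivative at the boundary circle, so one-sided
derivatives need no separate computation. -/
theorem fderivWithin_annulus {F : Type} [NormedAddCommGroup F] [NormedSpace ℝ F] {R : ℝ}
    {f : ℝ × ℝ → F} (hf : ContDiffOn ℝ ∞ f (doubleStrip R)) {p : ℝ × ℝ} (hp : p ∈ annulus R) :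
    fderivWithin ℝ f (annulus R) p = fderiv ℝ f p :=
  fderivWithin_eq_fderiv (uniqueDiffOn_annulus R p hp)
    ((hf.contDiffAt ((isOpen_doubleStrip R).mem_nhds
      (annulus_subset_doubleStrip R hp))).differentiableAt (by simp))

namespace InvariantFamily

variable {T : ReversibleTwist} (Y : InvariantFamily T) (κ : ℝ)

/-- The passage from angle and action to the base coordinate and the parameter. -/
noncomputable def toParam (p : ℝ × ℝ) : ℝ × ℝ :=
  (Y.angleInv (p.1, Y.actionInv κ p.2), Y.actionInv κ p.2)

/-- The passage from angle and action to the original coordinates. -/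
noncomputable def fromAction (p : ℝ × ℝ) : ℝ × ℝ :=
  ((Y.toParam κ p).1, Y.Y (Y.toParam κ p))

/-- The angle and action of a point. -/
noncomputable def toAction (q : ℝ × ℝ) : ℝ × ℝ :=
  (Y.angle (q.1, Y.param q), Y.action κ (Y.param q))

variable {κ}

theorem contDiffOn_toParam (hκ : 0 < κ) :
    ContDiffOn ℝ ∞ (Y.toParam κ) (doubleStrip (Y.radius κ)) := by
  have h1 : ContDiffOn ℝ ∞ (fun p : ℝ × ℝ => Y.actionInv κ p.2) (doubleStrip (Y.radius κ)) :=
    (Y.contDiffOn_actionInv hκ).comp contDiffOn_snd fun _ hp => hp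
  exact (Y.contDiff_angleInv.comp_contDiffOn (contDiffOn_fst.prodMk h1)).prodMk h1

theorem contDiffOn_fromAction (hκ : 0 < κ) :
    ContDiffOn ℝ ∞ (Y.fromAction κ) (doubleStrip (Y.radius κ)) :=
  (contDiff_fst.comp_contDiffOn (Y.contDiffOn_toParam hκ)).prodMk
    (Y.contDiff_Y.comp_contDiffOn (Y.contDiffOn_toParam hκ))

theorem contDiff_toAction (hκ : 0 < κ) : ContDiff ℝ ∞ (Y.toAction κ) := by
  have h1 := Y.contDiff_param
  have h2 := Y.contDiff_angle
  have h3 := Y.contDiff_action hκ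
  exact (by fun_prop : ContDiff ℝ ∞ fun q : ℝ × ℝ => Y.angle (q.1, Y.param q)).prodMk
    (h3.comp h1)

theorem toAction_eq (x u : ℝ) :
    Y.toAction κ (x, Y.Y (x, u)) = (Y.angle (x, u), Y.action κ u) := by
  simp only [toAction, Y.param_Y]

theorem toAction_fromAction (hκ : 0 < κ) {p : ℝ × ℝ} (hp : p ∈ doubleStrip (Y.radius κ)) :
    Y.toAction κ (Y.fromAction κ p) = p := by
  refine (Y.toAction_eq _ _).trans (Prod.ext (Y.angle_angleInv _ _) ?_)
  exact Y.action_actionInv hκ hp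

theorem fromAction_toAction (hκ : 0 < κ) (q : ℝ × ℝ) :
    Y.fromAction κ (Y.toAction κ q) = q := by
  have h : Y.toParam κ (Y.toAction κ q) = (q.1, Y.param q) := by
    simp only [toParam, toAction, Y.actionInv_action hκ, Y.angleInv_angle]
  rw [fromAction, h]
  exact Prod.ext rfl (Y.Y_param _ _)

theorem toAction_mem (hκ : 0 < κ) (q : ℝ × ℝ) : Y.toAction κ q ∈ doubleStrip (Y.radius κ) :=
  Y.abs_action_lt_radius hκ _

theorem fromAction_add_one (x y : ℝ) :
    Y.fromAction κ (x + 1, y) = ((Y.fromAction κ (x, y)).1 + 1, (Y.fromAction κ (x, y)).2) := by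
  simp only [fromAction, toParam, Y.angleInv_add_one, Y.isCurveFamily.add_one]

theorem fromAction_neg (hκ : 0 < κ) {x y : ℝ} (hy : |y| < Y.radius κ) :
    Y.fromAction κ (x, -y) = ((Y.fromAction κ (x, y)).1, -(Y.fromAction κ (x, y)).2) := by
  simp only [fromAction, toParam, Y.actionInv_odd hκ hy, Y.angleInv_even, Y.isCurveFamily.odd]

theorem fromAction_nonneg (hκ : 0 < κ) {p : ℝ × ℝ} (hp : |p.2| < Y.radius κ) (h0 : 0 ≤ p.2) :
    0 ≤ (Y.fromAction κ p).2 := by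
  have h1 := Y.actionInv_nonneg hκ hp h0
  have h2 := Y.Y_eq (Y.angleInv (p.1, Y.actionInv κ p.2)) (Y.actionInv κ p.2)
  change 0 ≤ Y.Y _
  rw [toParam, h2]
  exact mul_nonneg h1 (Y.quot_pos _).le

theorem toAction_nonneg (hκ : 0 < κ) {q : ℝ × ℝ} (h0 : 0 ≤ q.2) : 0 ≤ (Y.toAction κ q).2 := by
  refine Y.action_nonneg hκ ?_
  have h1 := Y.Y_param q.1 q.2
  rw [Y.Y_eq] at h1
  by_contra h
  push Not at h
  have h2 : Y.param q * Y.quot (q.1, Y.param q) < 0 := mul_neg_of_neg_of_pos h (Y.quot_pos _)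
  have h3 : Y.param (q.1, q.2) * Y.quot (q.1, Y.param (q.1, q.2)) < 0 := h2
  linarith

/-- The primitive of the area form in angle and action coordinates. -/
theorem fderiv_G_comp_toParam (hκ : 0 < κ) {p : ℝ × ℝ} (hp : p ∈ doubleStrip (Y.radius κ))
    (w : ℝ × ℝ) : T.P (Y.fromAction κ p) * fderiv ℝ (fun p => (Y.fromAction κ p).1) p w
      - κ * (p.2 ^ 2 / 2) * w.1 = fderiv ℝ (fun p => Y.G (Y.toParam κ p)) p w := by
  have hnhds := (isOpen_doubleStrip (Y.radius κ)).mem_nhds hp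
  have hE := (((Y.contDiffOn_toParam hκ).contDiffAt hnhds).differentiableAt (by simp)).hasFDerivAt
  have hG := ((Y.contDiff_G.differentiable (by simp)) (Y.toParam κ p)).hasFDerivAt
  have hA := ((Y.contDiff_angle.differentiable (by simp)) (Y.toParam κ p)).hasFDerivAt
  -- The angle of `toParam p` is `p.1`, so the differential of the angle pulls back to `dx`.
  have h1 := (hA.comp p hE).congr_of_eventuallyEq (f₁ := Prod.fst) (by
    filter_upwards [hnhds] with q hq
    exact (Y.angle_angleInv _ _).symm)
  have h2 := h1.unique hasFDerivAt_fst
  have h3 : fderiv ℝ Y.angle (Y.toParam κ p) (fderiv ℝ (Y.toParam κ) p w) = w.1 :=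
    DFunLike.congr_fun h2 w
  have h4 : fderiv ℝ (fun p => Y.G (Y.toParam κ p)) p = _ := (hG.comp p hE).fderiv
  have h5 : fderiv ℝ (fun p => (Y.fromAction κ p).1) p = _ := hE.fst.fderiv
  rw [h4, h5]
  change _ = fderiv ℝ Y.G (Y.toParam κ p) (fderiv ℝ (Y.toParam κ) p w)
  rw [Y.fderiv_G, h3]
  have h6 : Y.M (Y.toParam κ p).2 = κ * (p.2 ^ 2 / 2) := by
    change Y.M (Y.actionInv κ p.2) = _
    rw [← Y.action_sq hκ, Y.action_actionInv hκ hp]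
  rw [h6]
  rfl

theorem toAction_map_fromAction (κ : ℝ) (p : ℝ × ℝ) :
    Y.toAction κ (T.f (Y.fromAction κ p), T.g (Y.fromAction κ p))
      = (p.1 + Y.shift (Y.toParam κ p), Y.action κ (Y.g' (Y.toParam κ p))) := by
  refine Prod.ext ?_ rfl
  have h := Y.angle_angleInv p.1 (Y.actionInv κ p.2)
  change Y.angle (Y.f' (Y.toParam κ p), Y.g' (Y.toParam κ p)) = _
  rw [shift]
  change _ = p.1 + (_ - Y.angle (Y.angleInv (p.1, Y.actionInv κ p.2), Y.actionInv κ p.2))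
  rw [h]
  ring

theorem divisor_add_one {m : ℕ} {d e : ℝ × ℝ → ℝ} (he : ContDiff ℝ ∞ e)
    (hd : ∀ x u, d (x + 1, u) = d (x, u)) (h : ∀ x u, d (x, u) = u ^ m * e (x, u)) (x u : ℝ) :
    e (x + 1, u) = e (x, u) := by
  have hc := he.continuous
  exact DivPow.quotient_unique (m := m) (a := fun u => e (x + 1, u)) (b := fun u => e (x, u))
    (by fun_prop) (by fun_prop) (fun u => by rw [← h, ← h, hd]) u

theorem slope_zero_sq (hκ : 0 < κ) : Y.slope κ 0 ^ 2 = 4 * T.L / κ := by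
  rw [slope, Y.MHat_zero, Real.sq_sqrt (by have := T.L_pos; positivity)]
  ring

/-- The formal Birkhoff normal form in angle and action coordinates. -/
theorem exists_normalForm (hκ : 0 < κ) : ∃ c : ℕ → ℝ, c 1 = T.τ / Y.slope κ 0 ∧ ∀ N : ℕ,
    ∃ f g : ℝ × ℝ → ℝ, ContDiffOn ℝ ∞ f (doubleStrip (Y.radius κ)) ∧
      ContDiffOn ℝ ∞ g (doubleStrip (Y.radius κ)) ∧
      (∀ p : ℝ × ℝ, f (p.1 + 1, p.2) = f p ∧ g (p.1 + 1, p.2) = g p) ∧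
      ∀ p ∈ doubleStrip (Y.radius κ),
        Y.toAction κ (T.f (Y.fromAction κ p), T.g (Y.fromAction κ p)) =
          (p.1 + ∑ i ∈ Finset.range (N + 1), c (2 * i + 1) * p.2 ^ (2 * i + 1)
            + p.2 ^ (2 * N + 3) * f p, p.2 + p.2 ^ (2 * N + 4) * g p) := by
  obtain ⟨a, ha, hodd, hda, hflat⟩ := Y.exists_odd_shift
  have hslope := Y.contDiff_slope hκ
  have hact := Y.contDiff_action hκ
  have hg' := Y.contDiff_g'
  obtain ⟨c, hc1, hc⟩ := exists_odd_expansion ha hodd hslope Y.slope_even (Y.slope_pos hκ 0).ne' hda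
  refine ⟨c, hc1, fun N => ?_⟩
  -- `N + 1` terms leave the remainder `u ^ (2 (N + 1) + 1) = u ^ (2 N + 3)`, the order at which the
  -- flat part of the shift is divided next.
  obtain ⟨h, hh, hah⟩ := hc (N + 1)
  obtain ⟨e, he, hde⟩ := hflat (2 * N + 3)
  have hact_flat : IsFlat (fun z => Y.action κ (Y.g' z) - Y.action κ z.2) :=
    IsFlat.comp_sub_comp (F := fun q : ℝ × ℝ => Y.action κ q.2) (c := fun _ => 0) (by fun_prop)
      (by fun_prop) hg' contDiff_snd Y.isFlat_g'_sub
  obtain ⟨d, hd, hdd⟩ := hact_flat (2 * N + 4)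
  have hinv : ContDiff ℝ ∞ fun z : ℝ × ℝ => (Y.slope κ z.2)⁻¹ :=
    ContDiff.inv (by fun_prop) fun z => (Y.slope_pos hκ _).ne'
  have hpar := Y.contDiffOn_toParam hκ
  -- The powers of the inverse slope convert `u ^ m` into `y ^ m`, because `y = u * slope u`.
  set f₁ : ℝ × ℝ → ℝ := fun z => (e z + h z.2) * (Y.slope κ z.2)⁻¹ ^ (2 * N + 3) with hf₁
  set g₁ : ℝ × ℝ → ℝ := fun z => d z * (Y.slope κ z.2)⁻¹ ^ (2 * N + 4) with hg₁
  have hf₁s : ContDiff ℝ ∞ f₁ := by fun_prop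
  have hg₁s : ContDiff ℝ ∞ g₁ := by fun_prop
  have hf₁p : ∀ x u, f₁ (x + 1, u) = f₁ (x, u) := fun x u => by
    simp only [hf₁]
    rw [divisor_add_one (d := fun z => Y.shift z - a z.2) he (fun x u => by simp only [Y.shift_add_one]) hde]
  have hg₁p : ∀ x u, g₁ (x + 1, u) = g₁ (x, u) := fun x u => by
    simp only [hg₁]
    rw [divisor_add_one (d := fun z => Y.action κ (Y.g' z) - Y.action κ z.2) hd (fun x u => by simp only [Y.g'_add_one]) hdd]
  refine ⟨fun p => f₁ (Y.toParam κ p), fun p => g₁ (Y.toParam κ p), hf₁s.comp_contDiffOn hpar,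
    hg₁s.comp_contDiffOn hpar, fun p => ?_, fun p hp => ?_⟩
  · simp only [toParam, Y.angleInv_add_one, hf₁p, hg₁p]
    exact ⟨trivial, trivial⟩
  · rw [Y.toAction_map_fromAction]
    obtain ⟨X, y⟩ := p
    have hy := Y.action_actionInv hκ hp
    simp only [toParam] at hy ⊢
    set u := Y.actionInv κ y
    set x := Y.angleInv (X, u)
    have hs := (Y.slope_pos hκ u).ne'
    have hyu : y = u * Y.slope κ u := hy.symm
    have hpow : ∀ m : ℕ, y ^ m * (Y.slope κ u)⁻¹ ^ m = u ^ m := fun m => by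
      rw [← mul_pow, hyu, mul_assoc, mul_inv_cancel₀ hs, mul_one]
    refine Prod.ext ?_ ?_
    · have h1 := hde x u
      have h2 := hah u
      rw [← hyu] at h2
      simp only [hf₁] at h1 ⊢
      have h3 : 2 * (N + 1) + 1 = 2 * N + 3 := by ring
      rw [h3] at h2
      linear_combination h1 + h2 - (e (x, u) + h u) * hpow (2 * N + 3)
    · have h1 := hdd x u
      simp only [hg₁] at h1 ⊢
      rw [hy] at h1
      linear_combination h1 - d (x, u) * hpow (2 * N + 4)

end InvariantFamily

theorem theorem1 (B : BilliardTable) :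
    ∃ (R : ℝ) (Φ : AnnulusDiffeo R Real.pi) (c : ℕ → ℝ),
      0 < R ∧
      IsExactSymplectic B.lazutkinConst R Φ.toFun ∧
      ContDiffOn ℝ ∞ (mirrorExtend Φ.toFun) {p : ℝ × ℝ | |p.2| < R} ∧
      c 1 = 1 ∧
      IsFormalBirkhoffNormalForm R (fun p => Φ.invFun (B.billiardMap (Φ.toFun p))) c := by
  obtain ⟨Y₀, hY₀, hhalf, hflat⟩ := B.reversibleTwist.exists_flat_curveFamily
  let Y : InvariantFamily B.reversibleTwist := ⟨Y₀, hY₀, hhalf, hflat⟩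
  have hκ := B.lazutkinConst_pos
  set κ := B.lazutkinConst with hκdef
  set R := Y.radius κ with hR
  have hsub := annulus_subset_doubleStrip R
  have hΦs : ContDiffOn ℝ ∞ (fun p => B.chart (Y.fromAction κ p)) (doubleStrip R) :=
    B.contDiff_chart.comp_contDiffOn (Y.contDiffOn_fromAction hκ)
  have hangle : annulus Real.pi ⊆ BilliardTable.angleStrip := annulus_subset_doubleStrip Real.pi
  -- The inverse of the angle-action map followed by Lazutkin's chart. The curves foliate the whole
  -- plane and the chart covers all angles, so the image is the full annulus.
  let Φ : AnnulusDiffeo R Real.pi :=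
    { toFun := fun p => B.chart (Y.fromAction κ p)
      invFun := fun q => Y.toAction κ (B.chartInv q)
      mapsTo_toFun := fun p hp => ⟨B.chart_snd_nonneg (Y.fromAction_nonneg hκ (hsub hp) hp.1),
        (abs_lt.1 (B.chart_mem _)).2⟩
      mapsTo_invFun := fun q hq => ⟨Y.toAction_nonneg hκ (B.chartInv_snd_nonneg hq.1 hq.2),
        (abs_lt.1 (Y.toAction_mem hκ _)).2⟩
      left_inv := fun p hp => by
        simp only [B.chartInv_chart, Y.toAction_fromAction hκ (hsub hp)]
      right_inv := fun q hq => by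
        simp only [Y.fromAction_toAction hκ, B.chart_chartInv (hangle hq)]
      contDiffOn_toFun := hΦs.mono hsub
      contDiffOn_invFun := (Y.contDiff_toAction hκ).comp_contDiffOn
        (B.contDiffOn_chartInv.mono hangle)
      toFun_add_one := fun p _ => by
        rw [Y.fromAction_add_one, B.chart_add_one] }
  obtain ⟨c, hc1, hc⟩ := Y.exists_normalForm hκ
  refine ⟨R, Φ, c, Y.radius_pos hκ, ?_, ?_, ?_, fun N => ?_⟩
  -- The chart pulls `(1 - cos v) ds` back to `P dx` with no exact correction, so the function
  -- required is the generating function of the angle-action change alone.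
  · have hGs : ContDiffOn ℝ ∞ (fun p => Y.G (Y.toParam κ p)) (doubleStrip R) :=
      Y.contDiff_G.comp_contDiffOn (Y.contDiffOn_toParam hκ)
    refine ⟨fun p => Y.G (Y.toParam κ p), hGs.mono hsub, fun p _ => ?_, fun p hp w => ?_⟩
    · simp only [InvariantFamily.toParam, Y.angleInv_add_one, Y.G_add_one]
    · rw [fderivWithin_annulus hGs hp, fderivWithin_annulus hΦs hp,
        ← Y.fderiv_G_comp_toParam hκ (hsub hp)]
      have hnhds := (isOpen_doubleStrip R).mem_nhds (hsub hp)
      have hd := ((hΦs.contDiffAt hnhds).differentiableAt (by simp)).hasFDerivAt.fst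
      have hE := (((Y.contDiffOn_fromAction hκ).contDiffAt hnhds).differentiableAt
        (by simp)).hasFDerivAt.fst
      have h1 := (B.hasDerivAt_arcParam (Y.fromAction κ p).1).comp_hasFDerivAt p hE
      have h2 := DFunLike.congr_fun (hd.unique h1) w
      have h3 : (fderiv ℝ (fun p => B.chart (Y.fromAction κ p)) p w).1
          = B.affineLength / B.cbrtCurvature (B.arcParam (Y.fromAction κ p).1) ^ 2
            * fderiv ℝ (fun p => (Y.fromAction κ p).1) p w := by
        rw [hE.fderiv]
        exact h2
      have h4 : (1 - Real.cos (B.chart (Y.fromAction κ p)).2)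
          * (B.affineLength / B.cbrtCurvature (B.arcParam (Y.fromAction κ p).1) ^ 2)
          = B.reversibleTwist.P (Y.fromAction κ p) := B.one_sub_cos_chart _
      rw [h3, ← h4, ← mul_assoc]
  -- The formula for `Φ` already commutes with the reflection on the double strip, where it is
  -- smooth, so the mirror extension coincides with it.
  · refine hΦs.congr fun p hp => ?_
    obtain ⟨x, y⟩ := p
    have hy : |y| < R := hp
    by_cases h : 0 ≤ y
    · simp [mirrorExtend, h, Φ]
    · have h1 := Y.fromAction_neg hκ (x := x) hy
      simp only [mirrorExtend, h, if_false, Φ]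
      rw [h1, B.chart_neg, neg_neg]
  -- The value of `κ` enters here: with `κ = L ^ 3 / 4` the squared slope `4 L / κ` equals `(4 / L)
  -- ^ 2`, so the slope equals the twist and `c 1 = τ / slope = 1`.
  · have h1 := Y.slope_zero_sq hκ
    have hL := B.affineLength_pos
    have h2 : Y.slope κ 0 = 4 / B.affineLength := by
      refine (sq_eq_sq₀ (Y.slope_pos hκ 0).le (by positivity)).1 ?_
      rw [h1, hκdef, B.lazutkinConst_eq]
      change 4 * B.affineLength / _ = _
      field_simp
    rw [hc1, h2]
    change 4 / B.affineLength / _ = 1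
    exact div_self (by positivity)
  · obtain ⟨f, g, hf, hg, hper, h⟩ := hc N
    refine ⟨f, g, hf.mono hsub, hg.mono hsub, fun p _ => hper p, fun p hp => ?_⟩
    have h1 : B.billiardMap (B.chart (Y.fromAction κ p)) = B.chart (B.chartMap (Y.fromAction κ p)) :=
      B.billiardMap_chart (Y.fromAction_nonneg hκ (hsub hp) hp.1)
    simp only [Φ]
    rw [h1, B.chartInv_chart]
    exact h p (hsub hp)
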